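/- **Setting.** All generators of Markov semigroups below are $L^2$-generators: if $(P_t)_{t\ge0}$ is the semigroup of (honest) transition kernels of a Markov process and $\mu$ a reversible probability measure, then $f\in D(L)$ and $Lf=g$ mean $f,g\in L^2(\mu)$ and $(P_tf-f)/t\to g$ in $L^2(\mu)$ as $t\downarrow0$. Put $\Gamma(f,g)=\frac12\big(L(fg)-fLg-gLf\big)$, $\Gamma(f)=\Gamma(f,f)$, $\Gamma_2(f)=\frac12\big(L\Gamma(f)-2\Gamma(f,Lf)\big)$. For $f$ with $f,f^2\in D(L)$ we say that $\Gamma_2(f)$ is defined if $Lf,\ fLf,\ \Gamma(f)\in D(L)$. *Diffusion part.* Let $(P^c_t)$ be a Markov semigroup on a measurable space $E$ with reversible probability measure $\mu_c$, strongly continuous on $L^2(\mu_c)$, for which $\mu_c$ is the only invariant probability measure (it suffices: among those absolutely continuous with respect to $\mu_c$). Let $L_c$ be its generator, with operators $\Gamma,\Gamma_2$. Let $\mathcal A\subset D(L_c)$ be an algebra (with constants) of bounded measurable functions, stable under composition with functions $H\in C^\infty(\mathbb R)$, on which the diffusion property $L_cH(f)=H'(f)L_cf+H''(f)\Gamma(f)$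 holds $\mu_c$-a.e. $L_c$ satisfies $CD(\kappa_c,\infty)$ if $\Gamma_2(f)\ge\kappa_c\Gamma(f)$ $\mu_c$-a.e. for all $f\in\mathcal A$ for which $\Gamma_2(f)$ is defined. *Discrete part.* Let $X$ be countable, and let $k(x,y)\ge0$ ($x\ne y$) be rates with $\sum_yk(x,y)=0$, $M_1(x)=\sum_{y\neq x}k(x,y)<\infty$ and $\sum_{y\ne x}k(x,y)M_1(y)<\infty$ for all $x$. Let $(P^d_t)$ be the semigroup of an irreducible, positive recurrent Markov chain on $X$ with rates $k$ (no mass is lost) and reversible probability measure $\mu_d>0$ (detailed balance). Put $\Upsilon(r)=e^r-1-r$, $L_df(x)=\sum_yk(x,y)(f(y)-f(x))$, $\Psi_\Upsilon(f)(x)=\sum_yk(x,y)\Upsilon(f(y)-f(x))$, $B_{\Upsilon'}(f,g)(x)=\sum_yk(x,y)\Upsilon'(f(y)-f(x))(g(y)-g(x))$, $\Psi_{2,\Upsilon}(f)=\frac12\big(L_d\Psi_\Upsilon(f)-B_{\Upsilon'}(f,L_df)\big)$. $L_d$ satisfies $CD_\Upsilon(\kappa_d,\infty)$ if $\Psi_{2,\Upsilon}(f)\ge\kappa_d\Psi_\Upsilon(f)$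 on $X$ for all bounded $f$. *Product.* Let $P_t=P_t^c\otimes P_t^d$ on $E\times X$ and $\mu=\mu_c\otimes\mu_d$. For operators $A$ on functions on $E$ and $B$ on functions on $X$, $(A\oplus B)(u)(x,i)=A(u(\cdot,i))(x)+B(u(x,\cdot))(i)$. With $L=L_c\oplus L_d$ let $$(\Gamma\oplus\Psi_\Upsilon)_2(u)=\tfrac12\Big(L\,(\Gamma\oplus\Psi_\Upsilon)(u)-2\Gamma(u,Lu)-B_{\Upsilon'}(u,Lu)\Big),$$ where $\Gamma$ acts in the first and $B_{\Upsilon'}$ in the second variable. Further let $\mathcal H(f)=\int f\log f\,d\mu$ and $\mathcal I(f)=\int f\,(\Gamma\oplus\Psi_\Upsilon)(\log f)\,d\mu$. *Regularity.* A function $u:E\times X\to\mathbb R$ is *sufficiently regular* if it is bounded, if for every $i$ one has $u(\cdot,i)\in\mathcal A$ and $\Gamma_2(u(\cdot,i))$ is defined, and if $\sum_{j\ne i}k(i,j)\big(\|L_cu(\cdot,j)\|_{L^2(\mu_c)}+\|\Gamma(u(\cdot,j))\|_{L^2(\mu_c)}\big)<\infty$ for every $i$ (automatic for finite $X$). A *sufficiently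 regular positive density* is a measurable $f:E\times X\to\mathbb R$ with $\int f\,d\mu=1$ and $0<c\le f\le C$ for constants $c,C$, which lies in the domain of the square of the generator of $(P_t)$ on $L^2(\mu)$, and such that for all $t\ge0$ the function $g=\log P_tf$ is sufficiently regular, lies in the domain of the generator of $(P_t)$ on $L^2(\mu)$, and satisfies $L_cg,\Gamma(g)\in L^2(\mu)$ and $M_1\cdot(\Gamma\oplus\Psi_\Upsilon)(g),\ M_1\cdot Lg,\ (\Gamma\oplus\Psi_\Upsilon)_2(g)\in L^1(\mu)$, where $M_1$ is evaluated at the second variable. **Theorem.** 1. $(\Gamma\oplus\Psi_\Upsilon)_2(u)\ge(\Gamma_2\oplus\Psi_{2,\Upsilon})(u)$ holds $\mu$-a.e. for every sufficiently regular $u$. 2. For every sufficiently regular positive density $f$ and all $t\ge0$ (one-sided derivatives at $t=0$), $$\frac{d}{dt}\mathcal H(P_tf)=-\mathcal I(P_tf),\qquad \frac{d^2}{dt^2}\mathcal H(P_tf)=2\int P_tf\,(\Gamma\oplus\Psi_\Upsilon)_2(\log P_tf)\,d\mu ;$$ both derivatives exist and the integrands are integrable. 3. If $L_c$ satisfies $CD(\kappa_c,\infty)$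 and $L_d$ satisfies $CD_\Upsilon(\kappa_d,\infty)$ with $\kappa_c,\kappa_d\in\mathbb R$, and $\kappa=\min\{\kappa_c,\kappa_d\}$, then for every sufficiently regular positive density $f$ and all $t\ge0$ $$\frac{d^2}{dt^2}\mathcal H(P_tf)\ge-2\kappa\,\frac{d}{dt}\mathcal H(P_tf).$$ 4. If moreover $\kappa_c,\kappa_d>0$, then the modified logarithmic Sobolev inequality $\mathcal H(f)\le\frac1{2\kappa}\mathcal I(f)$ holds for every sufficiently regular positive density $f$. -/

import Mathlib

open MeasureTheory ProbabilityTheory Filter Topology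
open scoped NNReal ENNReal ContDiff

noncomputable section

namespace Hybrid

/-! ### Markov semigroups and their `L²`-generators -/

/-- A Markov semigroup on a measurable space: the transition kernels of a time-homogeneous
(honest) Markov process. -/
structure MarkovSemigroup (Ω : Type*) [MeasurableSpace Ω] where
  kernel : ℝ≥0 → Kernel Ω Ω
  markov : ∀ t, IsMarkovKernel (kernel t)
  zero : kernel 0 = Kernel.id
  add : ∀ s t, kernel (s + t) = kernel s ∘ₖ kernel t

namespace MarkovSemigroup

variable {Ω : Type*} [MeasurableSpace Ω]

/-- `P_t f (x) = 𝔼 (f (Z_t) | Z_0 = x)`. -/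
def act (P : MarkovSemigroup Ω) (t : ℝ≥0) (f : Ω → ℝ) : Ω → ℝ :=
  fun x => ∫ y, f y ∂(P.kernel t x)

/-- The measure `μ` is reversible for the process: every transition kernel is reversible. -/
def IsReversible (P : MarkovSemigroup Ω) (μ : Measure Ω) : Prop :=
  ∀ t, (P.kernel t).IsReversible μ

/-- Strong continuity of the semigroup on `L²(μ)`. -/
def IsStronglyContinuous (P : MarkovSemigroup Ω) (μ : Measure Ω) : Prop :=
  ∀ f : Ω → ℝ, MemLp f 2 μ →
    Tendsto (fun t : ℝ≥0 => eLpNorm (fun x => P.act t f x - f x) 2 μ) (𝓝[>] 0) (𝓝 0)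

/-- Uniqueness of the invariant probability measure `μ` (among those absolutely continuous
with respect to `μ`, which is all that is ever needed: it is the ergodicity of `μ`). -/
def HasUniqueInvariant (P : MarkovSemigroup Ω) (μ : Measure Ω) : Prop :=
  ∀ ν : Measure Ω, IsProbabilityMeasure ν → ν ≪ μ → (∀ t, (P.kernel t).Invariant ν) → ν = μ

/-- `f` belongs to the domain of the `L²(μ)`-generator, and the generator maps `f` to `g`:
`(P_t f - f) / t → g` in `L²(μ)` as `t ↓ 0`. -/
def HasGen (P : MarkovSemigroup Ω) (μ : Measure Ω) (f g : Ω → ℝ) : Prop :=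
  MemLp f 2 μ ∧ MemLp g 2 μ ∧
    Tendsto (fun t : ℝ≥0 => eLpNorm (fun x => (t : ℝ)⁻¹ * (P.act t f x - f x) - g x) 2 μ)
      (𝓝[>] 0) (𝓝 0)

/-- `f` lies in the domain of the `L²(μ)`-generator. -/
def InDomain (P : MarkovSemigroup Ω) (μ : Measure Ω) (f : Ω → ℝ) : Prop :=
  ∃ g, P.HasGen μ f g

open Classical in
/-- The `L²(μ)`-generator `L`; the value is determined up to `μ`-null sets for `f` in the
domain, and it is `0` by convention outside of the domain. -/
def gen (P : MarkovSemigroup Ω) (μ : Measure Ω) (f : Ω → ℝ) : Ω → ℝ :=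
  if h : P.InDomain μ f then h.choose else 0

/-- The carré du champ operator `Γ(f,g) = (L(fg) - f Lg - g Lf) / 2`. -/
def carre (P : MarkovSemigroup Ω) (μ : Measure Ω) (f g : Ω → ℝ) : Ω → ℝ :=
  fun x => (P.gen μ (f * g) x - f x * P.gen μ g x - g x * P.gen μ f x) / 2

/-- `Γ(f) = Γ(f,f)`. -/
def carreDiag (P : MarkovSemigroup Ω) (μ : Measure Ω) (f : Ω → ℝ) : Ω → ℝ :=
  P.carre μ f f

/-- The iterated carré du champ operator `Γ₂(f) = (L Γ(f) - 2 Γ(f, L f)) / 2`. -/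
def carreTwo (P : MarkovSemigroup Ω) (μ : Measure Ω) (f : Ω → ℝ) : Ω → ℝ :=
  fun x => (P.gen μ (P.carreDiag μ f) x - 2 * P.carre μ f (P.gen μ f) x) / 2

/-- For `f` such that `f` and `f ^ 2` are in the domain of `L`: all the remaining functions to
which `L` is applied in the definition of `Γ₂(f)` are in the domain of `L`. -/
structure CarreTwoDefined (P : MarkovSemigroup Ω) (μ : Measure Ω) (f : Ω → ℝ) : Prop where
  gen_mem : P.InDomain μ (P.gen μ f)
  mul_gen_mem : P.InDomain μ (f * P.gen μ f)
  carre_mem : P.InDomain μ (P.carreDiag μ f)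

/-- The diffusion property on an algebra `𝒜` of bounded functions in the domain of the generator
which is stable under composition with smooth functions:
`L (H(f)) = H'(f) L f + H''(f) Γ(f)`. -/
structure IsDiffusion (P : MarkovSemigroup Ω) (μ : Measure Ω) (𝒜 : Subalgebra ℝ (Ω → ℝ)) :
    Prop where
  measurable : ∀ f ∈ 𝒜, Measurable f
  bounded : ∀ f ∈ 𝒜, ∃ C : ℝ, ∀ x, |f x| ≤ C
  domain : ∀ f ∈ 𝒜, P.InDomain μ f
  comp : ∀ f ∈ 𝒜, ∀ H : ℝ → ℝ, ContDiff ℝ ∞ H → H ∘ f ∈ 𝒜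
  chain : ∀ f ∈ 𝒜, ∀ H : ℝ → ℝ, ContDiff ℝ ∞ H →
    ∀ᵐ x ∂μ, P.gen μ (H ∘ f) x =
      deriv H (f x) * P.gen μ f x + deriv (deriv H) (f x) * P.carreDiag μ f x

/-- The Bakry–Émery condition `CD(κ,∞)`: `Γ₂(f) ≥ κ Γ(f)` almost everywhere, for all `f` in the
algebra `𝒜` for which `Γ₂(f)` is defined. -/
def CD (P : MarkovSemigroup Ω) (μ : Measure Ω) (𝒜 : Subalgebra ℝ (Ω → ℝ)) (κ : ℝ) : Prop :=
  ∀ f ∈ 𝒜, P.CarreTwoDefined μ f → ∀ᵐ x ∂μ, κ * P.carreDiag μ f x ≤ P.carreTwo μ f x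

/-- The semigroup of the product process `(Z_t, Y_t)` with independent components. -/
def prod {E X : Type*} [MeasurableSpace E] [MeasurableSpace X]
    (P : MarkovSemigroup E) (Q : MarkovSemigroup X) : MarkovSemigroup (E × X) where
  kernel t := P.kernel t ∥ₖ Q.kernel t
  markov t := by
    have := P.markov t
    have := Q.markov t
    infer_instance
  zero := by rw [P.zero, Q.zero, Kernel.id_parallelComp_id]
  add s t := by
    have := P.markov t
    have := Q.markov t
    have := P.markov s
    have := Q.markov s
    rw [P.add, Q.add, Kernel.parallelComp_comp_parallelComp]

end MarkovSemigroup

/-! ### The discrete calculus of a Markov chain with transition rates `k` -/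

section Discrete

variable {X : Type*}

/-- `Υ(r) = e^r - 1 - r`. -/
def upsilon (r : ℝ) : ℝ := Real.exp r - 1 - r

/-- The generator `L f (x) = ∑_y k(x,y) (f(y) - f(x))`. -/
def discGen (k : X → X → ℝ) (f : X → ℝ) : X → ℝ :=
  fun x => ∑' y, k x y * (f y - f x)

/-- `Ψ_H(f)(x) = ∑_y k(x,y) H(f(y) - f(x))`. -/
def discPsi (k : X → X → ℝ) (H : ℝ → ℝ) (f : X → ℝ) : X → ℝ :=
  fun x => ∑' y, k x y * H (f y - f x)

/-- `B_H(f,g)(x) = ∑_y k(x,y) H(f(y) - f(x)) (g(y) - g(x))`. -/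
def discB (k : X → X → ℝ) (H : ℝ → ℝ) (f g : X → ℝ) : X → ℝ :=
  fun x => ∑' y, k x y * H (f y - f x) * (g y - g x)

/-- `Ψ_{2,Υ}(f) = (L Ψ_Υ(f) - B_{Υ'}(f, L f)) / 2`. -/
def discPsiTwo (k : X → X → ℝ) (f : X → ℝ) : X → ℝ :=
  fun x => (discGen k (discPsi k upsilon f) x - discB k (deriv upsilon) f (discGen k f) x) / 2

/-- The condition `CD_Υ(κ,∞)`: `Ψ_{2,Υ}(f) ≥ κ Ψ_Υ(f)` on `X` for all bounded `f`. -/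
def CDUpsilon (k : X → X → ℝ) (κ : ℝ) : Prop :=
  ∀ f : X → ℝ, (∃ C : ℝ, ∀ x, |f x| ≤ C) → ∀ x, κ * discPsi k upsilon f x ≤ discPsiTwo k f x

/-- The exit rate `M₁(x) = ∑_{y ≠ x} k(x,y)`. -/
def exitRate (k : X → X → ℝ) (x : X) : ℝ := ∑' y : {y // y ≠ x}, k x y

/-- `Q` is the semigroup of an irreducible, positive recurrent continuous-time Markov chain on
`X` with transition rates `k` and reversible probability measure `μ`. As `Q` is a
`MarkovSemigroup`, no mass is lost. -/
structure IsReversibleChain [MeasurableSpace X] (Q : MarkovSemigroup X) (k : X → X → ℝ)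
    (μ : Measure X) : Prop where
  nonneg : ∀ x y, x ≠ y → 0 ≤ k x y
  /-- `∑_y k(x,y) = 0`; in particular `M₁(x) = -k(x,x)` is finite -/
  conservative : ∀ x, HasSum (k x) 0
  /-- `M₂(x) = ∑_{y ≠ x} k(x,y) ∑_{z ≠ y} k(y,z)` is finite -/
  summable_two : ∀ x, Summable fun y : {y // y ≠ x} => k x y * exitRate k y
  irreducible : ∀ x y, Relation.ReflTransGen (fun a b => 0 < k a b) x y
  pos : ∀ x, 0 < μ.real {x}
  detailedBalance : ∀ x y, μ.real {x} * k x y = μ.real {y} * k y x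
  reversible : Q.IsReversible μ
  /-- the transition probabilities have the derivative `k` at time `0` -/
  rates : ∀ x y, Tendsto
    (fun t : ℝ≥0 => (t : ℝ)⁻¹ * ((Q.kernel t x).real {y} - (Q.kernel 0 x).real {y}))
    (𝓝[>] 0) (𝓝 (k x y))

end Discrete

/-! ### Hybrid processes -/

section Product

variable {E X : Type*}

/-- `A ⊕ B`, where `A` acts on the continuous and `B` on the discrete variable. -/
def oplus (A : (E → ℝ) → E → ℝ) (B : (X → ℝ) → X → ℝ) (u : E × X → ℝ) : E × X → ℝ :=
  fun z => A (fun x => u (x, z.2)) z.1 + B (fun j => u (z.1, j)) z.2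

variable [MeasurableSpace E]

/-- `L_c ⊕ L_d`. -/
def hybridGen (P : MarkovSemigroup E) (μ : Measure E) (k : X → X → ℝ) :
    (E × X → ℝ) → E × X → ℝ :=
  oplus (P.gen μ) (discGen k)

/-- `Γ ⊕ Ψ_Υ`. -/
def hybridGamma (P : MarkovSemigroup E) (μ : Measure E) (k : X → X → ℝ) :
    (E × X → ℝ) → E × X → ℝ :=
  oplus (P.carreDiag μ) (discPsi k upsilon)

/-- `Γ₂ ⊕ Ψ_{2,Υ}`. -/
def sumOfTwos (P : MarkovSemigroup E) (μ : Measure E) (k : X → X → ℝ) :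
    (E × X → ℝ) → E × X → ℝ :=
  oplus (P.carreTwo μ) (discPsiTwo k)

/-- `(Γ ⊕ Ψ_Υ)₂(u) = (L (Γ ⊕ Ψ_Υ)(u) - 2 Γ(u, L u) - B_{Υ'}(u, L u)) / 2`, `L = L_c ⊕ L_d`. -/
def hybridTwo (P : MarkovSemigroup E) (μ : Measure E) (k : X → X → ℝ) (u : E × X → ℝ) :
    E × X → ℝ :=
  fun z => (hybridGen P μ k (hybridGamma P μ k u) z
    - 2 * P.carre μ (fun x => u (x, z.2)) (fun x => hybridGen P μ k u (x, z.2)) z.1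
    - discB k (deriv upsilon) (fun j => u (z.1, j)) (fun j => hybridGen P μ k u (z.1, j)) z.2) / 2

/-- The sufficiently regular functions `u : E × X → ℝ`: bounded, with slices in the algebra `𝒜`
on which `Γ₂` is defined, and such that the rates `k(i,·)` sum the `L²`-norms of `L_c u(·,j)` and
`Γ(u(·,j))` (which is automatic for finite `X`). -/
structure IsRegular (P : MarkovSemigroup E) (μ : Measure E) (𝒜 : Subalgebra ℝ (E → ℝ))
    (k : X → X → ℝ) (u : E × X → ℝ) : Prop where
  bounded : ∃ C : ℝ, ∀ z, |u z| ≤ C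
  slice_mem : ∀ i, (fun x => u (x, i)) ∈ 𝒜
  slice_two : ∀ i, P.CarreTwoDefined μ (fun x => u (x, i))
  summable_gen : ∀ i, Summable fun j : {j // j ≠ i} =>
    k i j * (eLpNorm (P.gen μ (fun x => u (x, j))) 2 μ).toReal
  summable_carre : ∀ i, Summable fun j : {j // j ≠ i} =>
    k i j * (eLpNorm (P.carreDiag μ (fun x => u (x, j))) 2 μ).toReal

variable [MeasurableSpace X]

/-- The entropy `ℋ(f) = ∫ f log f dμ`. -/
def entropy (μc : Measure E) (μd : Measure X) (f : E × X → ℝ) : ℝ :=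
  ∫ z, f z * Real.log (f z) ∂(μc.prod μd)

/-- The Fisher information `ℐ(f) = ∫ f (Γ ⊕ Ψ_Υ)(log f) dμ`. -/
def fisher (P : MarkovSemigroup E) (μc : Measure E) (k : X → X → ℝ) (μd : Measure X)
    (f : E × X → ℝ) : ℝ :=
  ∫ z, f z * hybridGamma P μc k (fun w => Real.log (f w)) z ∂(μc.prod μd)

/-- The logarithm `log P_t f` along the flow of the product process. -/
def logFlow (P : MarkovSemigroup E) (Q : MarkovSemigroup X) (t : ℝ≥0) (f : E × X → ℝ) :
    E × X → ℝ :=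
  fun z => Real.log ((P.prod Q).act t f z)

/-- The entropy along the flow, `t ↦ ℋ(P_t f)` for `t ≥ 0`. -/
def flowEntropy (P : MarkovSemigroup E) (μc : Measure E) (Q : MarkovSemigroup X)
    (μd : Measure X) (f : E × X → ℝ) (t : ℝ) : ℝ :=
  entropy μc μd ((P.prod Q).act t.toNNReal f)

/-- The sufficiently regular positive probability densities `f` with respect to `μ = μ_c ⊗ μ_d`:
bounded from above and away from zero, in the domain of the square of the generator of the
product process on `L²(μ)`, and with `log P_t f` sufficiently regular for all `t ≥ 0`; the last
five conditions are integrability conditions for the functions entering `(Γ ⊕ Ψ_Υ)₂(log P_t f)`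
(`M₁` is the exit rate of the chain). -/
structure IsRegularDensity (P : MarkovSemigroup E) (μc : Measure E) (𝒜 : Subalgebra ℝ (E → ℝ))
    (Q : MarkovSemigroup X) (k : X → X → ℝ) (μd : Measure X) (f : E × X → ℝ) : Prop where
  measurable : Measurable f
  bounds : ∃ c C : ℝ, 0 < c ∧ ∀ z, c ≤ f z ∧ f z ≤ C
  integral_eq_one : ∫ z, f z ∂(μc.prod μd) = 1
  domain : (P.prod Q).InDomain (μc.prod μd) f
  domain_sq : (P.prod Q).InDomain (μc.prod μd) ((P.prod Q).gen (μc.prod μd) f)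
  log_regular : ∀ t, IsRegular P μc 𝒜 k (logFlow P Q t f)
  log_domain : ∀ t, (P.prod Q).InDomain (μc.prod μd) (logFlow P Q t f)
  memLp_gen : ∀ t, MemLp
    (fun z : E × X => P.gen μc (fun x => logFlow P Q t f (x, z.2)) z.1) 2 (μc.prod μd)
  memLp_carre : ∀ t, MemLp
    (fun z : E × X => P.carreDiag μc (fun x => logFlow P Q t f (x, z.2)) z.1) 2 (μc.prod μd)
  integrable_gamma : ∀ t, Integrable
    (fun z => exitRate k z.2 * hybridGamma P μc k (logFlow P Q t f) z) (μc.prod μd)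
  integrable_gen : ∀ t, Integrable
    (fun z => exitRate k z.2 * hybridGen P μc k (logFlow P Q t f) z) (μc.prod μd)
  integrable_two : ∀ t, Integrable (hybridTwo P μc k (logFlow P Q t f)) (μc.prod μd)

end Product

end Hybrid

end

open Hybrid

/-! Pointwise comparison. Fix `i` and put `w_j = u(·,j) - u(·,i)`. Twice the difference of the two
sides consists only of mixed terms, `∑_j k(i,j) [L_c Υ(w_j) + Γ(u_j) - Γ(u_i) - 2 Γ(u_i, w_j) -
Υ'(w_j) L_c w_j]`. The diffusion property gives `L_c Υ(w) = Υ'(w) L_c w + e^w Γ(w)`, and bilinearity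
gives `Γ(u_j) - Γ(u_i) - 2 Γ(u_i, w_j) = Γ(w_j)`. The sum is therefore `∑_j k(i,j) (e^{w_j} + 1)
Γ(w_j) ≥ 0`, the negative diagonal rate being harmless because `w_i = 0`. The analytic content is
the exchange of `L_c` with the sum over `j`, which follows from closedness of the generator
(`hasGen_tsum_of_bound`); the inequality itself is `sumOfTwos_le_hybridTwo_slice`.

Derivatives. Let `F = P_t f`, `g = log F`, `N = L g` and `Θ = (Γ ⊕ Ψ_Υ)(g)`. Since `e^r - 1 = r +
Υ(r)`, both components obey the same rule for exponentials, so that `L F = F (N + Θ)` (`act_gen`).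
By symmetry of `L` and `∫ L F = 0`, the derivative of the entropy is `∫ g L F = ∫ F N = -∫ F Θ`.
Differentiating `∫ g L F` once more gives `∫ g L²F + ∫ (L F)² / F = ∫ F (N + Θ)(2N + Θ)`, and
integration by parts in each variable identifies this with twice the integral of `F (Γ ⊕ Ψ_Υ)₂(g)`
(`integral_exp_mul_hybridTwo`). This requires that the generator of the product process be `L_c ⊕
L_d` on the functions concerned (`gen_prod_slice`), and that entropy integrals be differentiable
along curves which are differentiable only in `L²`.

Functional inequality. Comparison and curvature bounds give `H'' ≥ -2κ H'`, so `H + H' / (2κ)` is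
nondecreasing. As `H' ≤ 0`, it is bounded by `H(P_t f) ≤ ∫ (P_t f - 1)²`, which tends to `0`: a
symmetric contraction semigroup converges strongly to an invariant vector (`exists_tendsto_atTop`),
and invariant functions of the product process are constant (`ae_eq_const_of_invariant`). At `t = 0`
this is the claim. -/

noncomputable section

namespace Hybrid

/-! ### Symmetric contraction semigroups on a Hilbert space. -/

/-- A semigroup of symmetric contractions on a real Hilbert space. -/
structure SymmSemigroup (V : Type*) [NormedAddCommGroup V] [InnerProductSpace ℝ V] where
  op : ℝ≥0 → V →L[ℝ] V
  zero : ∀ v, op 0 v = v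
  add : ∀ s t v, op (s + t) v = op s (op t v)
  norm_le : ∀ t v, ‖op t v‖ ≤ ‖v‖
  symm : ∀ t v w, inner ℝ (op t v) w = inner ℝ v (op t w)

namespace SymmSemigroup

variable {V : Type*} [NormedAddCommGroup V] [InnerProductSpace ℝ V] (S : SymmSemigroup V)

/-- The generator of `S` maps `v` to `w`. -/
def IsGen (v w : V) : Prop :=
  Tendsto (fun t : ℝ≥0 => (t : ℝ)⁻¹ • (S.op t v - v)) (𝓝[>] 0) (𝓝 w)

variable {S}

theorem IsGen.unique {v w w' : V} (h : S.IsGen v w) (h' : S.IsGen v w') : w = w' :=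
  tendsto_nhds_unique h h'

theorem IsGen.add {v w v' w' : V} (h : S.IsGen v w) (h' : S.IsGen v' w') :
    S.IsGen (v + v') (w + w') := by
  refine (Tendsto.add h h').congr fun t => ?_
  rw [map_add, ← smul_add]
  congr 1
  abel

theorem IsGen.smul {v w : V} (c : ℝ) (h : S.IsGen v w) : S.IsGen (c • v) (c • w) := by
  refine (Tendsto.const_smul h c).congr fun t => ?_
  rw [map_smul, smul_comm, smul_sub]

theorem IsGen.inner_comm {v w v' w' : V} (h : S.IsGen v w) (h' : S.IsGen v' w') :
    inner ℝ w v' = inner ℝ v w' := by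
  have h1 := Tendsto.inner (𝕜 := ℝ) h (tendsto_const_nhds (x := v'))
  have h2 := Tendsto.inner (𝕜 := ℝ) (tendsto_const_nhds (x := v)) h'
  refine tendsto_nhds_unique h1 (h2.congr fun t => ?_)
  rw [inner_smul_left, inner_smul_right, inner_sub_left, inner_sub_right, S.symm]
  simp

theorem IsGen.map {v w : V} (h : S.IsGen v w) (t : ℝ≥0) : S.IsGen (S.op t v) (S.op t w) := by
  refine (((S.op t).continuous.tendsto w).comp h).congr fun s => ?_
  simp only [Function.comp_apply, map_smul, map_sub]
  rw [← S.add, ← S.add, add_comm]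

variable (S) in
/-- The orbit of `v` is continuous at time `0`. -/
def IsCont (v : V) : Prop := Tendsto (fun t : ℝ≥0 => S.op t v) (𝓝[>] 0) (𝓝 v)

theorem IsCont.map {v : V} (h : S.IsCont v) (t : ℝ≥0) : S.IsCont (S.op t v) := by
  refine (((S.op t).continuous.tendsto v).comp h).congr fun s => ?_
  simp only [Function.comp_apply]
  rw [← S.add, ← S.add, add_comm]

theorem IsCont.sub {v w : V} (h : S.IsCont v) (h' : S.IsCont w) : S.IsCont (v - w) := by
  refine (Tendsto.sub h h').congr fun s => ?_
  rw [map_sub]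

theorem IsCont.smul {v : V} (c : ℝ) (h : S.IsCont v) : S.IsCont (c • v) := by
  refine (Tendsto.const_smul h c).congr fun s => ?_
  rw [map_smul]

theorem IsGen.isCont_left {v w : V} (h : S.IsGen v w) : S.IsCont v := by
  have h0 : Tendsto (fun t : ℝ≥0 => (t : ℝ)) (𝓝[>] 0) (𝓝 0) :=
    (NNReal.continuous_coe.tendsto' 0 0 rfl).mono_left nhdsWithin_le_nhds
  have h1 := (h0.smul h).add_const v
  rw [zero_smul, zero_add] at h1
  refine h1.congr' ?_
  filter_upwards [self_mem_nhdsWithin] with t ht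
  have : (t : ℝ) ≠ 0 := by
    have : (0 : ℝ≥0) < t := ht
    positivity
  rw [smul_inv_smul₀ this, sub_add_cancel]

/-- Contractivity bounds the error uniformly in `t`, so an `ε/3` argument makes the set of
continuity vectors closed. -/
theorem isCont_of_tendsto {ι : Type*} {l : Filter ι} [l.NeBot] {a : ι → V} {v : V}
    (ha : ∀ᶠ i in l, S.IsCont (a i)) (h : Tendsto a l (𝓝 v)) : S.IsCont v := by
  rw [IsCont, Metric.tendsto_nhds]
  intro ε hε
  obtain ⟨i, hi, hi'⟩ := (ha.and (Metric.tendsto_nhds.1 h (ε / 3) (by positivity))).exists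
  filter_upwards [Metric.tendsto_nhds.1 hi (ε / 3) (by positivity)] with t ht
  have h1 : dist (S.op t v) (S.op t (a i)) ≤ dist v (a i) := by
    rw [dist_eq_norm, dist_eq_norm, ← map_sub]
    exact S.norm_le _ _
  rw [dist_comm] at hi'
  calc dist (S.op t v) v ≤ dist (S.op t v) (S.op t (a i)) + dist (S.op t (a i)) (a i)
        + dist (a i) v := dist_triangle4 _ _ _ _
    _ < ε := by rw [dist_comm (a i) v]; linarith

/-- `w` is a limit of difference quotients of `v`, all of which are continuity vectors. Continuity
of the orbit of `w` is what turns right derivatives of the orbit of `v` into two-sided ones. -/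
theorem IsGen.isCont_right {v w : V} (h : S.IsGen v w) : S.IsCont w :=
  isCont_of_tendsto (Eventually.of_forall fun t =>
    ((h.isCont_left.map t).sub h.isCont_left).smul _) h

/-- The orbit map, as a function of real time. -/
def orbit (S : SymmSemigroup V) (v : V) (t : ℝ) : V := S.op t.toNNReal v

theorem norm_orbit_sub_le (v : V) {s t : ℝ} (hst : s ≤ t) (hs : 0 ≤ s) :
    ‖S.orbit v t - S.orbit v s‖ ≤ ‖S.op (t - s).toNNReal v - v‖ := by
  have : t.toNNReal = s.toNNReal + (t - s).toNNReal := by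
    rw [← Real.toNNReal_add hs (by linarith)]
    congr 1
    ring
  rw [orbit, orbit, this, S.add, ← map_sub]
  exact S.norm_le _ _

theorem tendsto_toNNReal_nhdsGT : Tendsto Real.toNNReal (𝓝[>] 0) (𝓝[>] 0) := by
  refine tendsto_nhdsWithin_iff.2 ⟨?_, ?_⟩
  · exact (continuous_real_toNNReal.tendsto' 0 0 (by simp)).mono_left nhdsWithin_le_nhds
  · filter_upwards [self_mem_nhdsWithin] with t ht
    simpa using ht

theorem IsCont.continuousOn_orbit {v : V} (h : S.IsCont v) :
    ContinuousOn (S.orbit v) (Set.Ici 0) := by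
  have h1 : ∀ ε > 0, ∃ δ > 0, ∀ r : ℝ, 0 ≤ r → r < δ → ‖S.op r.toNNReal v - v‖ < ε := by
    intro ε hε
    have h2 := Metric.tendsto_nhds.1 (Tendsto.comp h tendsto_toNNReal_nhdsGT) ε hε
    rw [eventually_nhdsWithin_iff, Metric.eventually_nhds_iff] at h2
    obtain ⟨δ, hδ, h2⟩ := h2
    refine ⟨δ, hδ, fun r hr hrδ => ?_⟩
    rcases hr.eq_or_lt with rfl | hr
    · simpa [S.zero] using hε
    · have := h2 (y := r) (by simpa [abs_of_pos hr] using hrδ) hr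
      simpa [dist_eq_norm] using this
  rw [Metric.continuousOn_iff]
  intro t ht ε hε
  obtain ⟨δ, hδ, h1⟩ := h1 ε hε
  refine ⟨δ, hδ, fun s hs hst => ?_⟩
  rw [Real.dist_eq] at hst
  rw [dist_eq_norm]
  rcases le_total s t with hle | hle
  · rw [norm_sub_rev]
    refine (norm_orbit_sub_le v hle hs).trans_lt (h1 _ (by linarith) ?_)
    rw [abs_sub_comm, abs_of_nonneg (by linarith)] at hst
    exact hst
  · refine (norm_orbit_sub_le v hle ht).trans_lt (h1 _ (by linarith) ?_)
    rw [abs_of_nonneg (by linarith)] at hst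
    exact hst

theorem IsGen.hasDerivWithinAt_orbit_right {v w : V} (h : S.IsGen v w) {t : ℝ} (ht : 0 ≤ t) :
    HasDerivWithinAt (S.orbit v) (S.orbit w t) (Set.Ici t) t := by
  rw [← hasDerivWithinAt_Ioi_iff_Ici, hasDerivWithinAt_iff_tendsto_slope' (by simp)]
  have h1 : Tendsto (fun s : ℝ => s - t) (𝓝[>] t) (𝓝[>] 0) := by
    refine tendsto_nhdsWithin_iff.2 ⟨?_, ?_⟩
    · exact (Continuous.tendsto' (by fun_prop) t 0 (by simp)).mono_left nhdsWithin_le_nhds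
    · filter_upwards [self_mem_nhdsWithin] with s hs
      simpa using hs
  refine (Tendsto.comp (h.map t.toNNReal) (tendsto_toNNReal_nhdsGT.comp h1)).congr' ?_
  filter_upwards [self_mem_nhdsWithin] with s hs
  have hs' : t < s := hs
  have h2 : s.toNNReal = (s - t).toNNReal + t.toNNReal := by
    rw [← Real.toNNReal_add (by linarith) ht]
    congr 1
    ring
  simp only [Function.comp_apply, slope, orbit, h2, vsub_eq_sub]
  rw [S.add, Real.coe_toNNReal _ (by linarith)]

/-- The mean value inequality along the orbit, whose right derivative `S_t w` has norm at most
`‖w‖`. It serves as the dominating bound for series of difference quotients. -/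
theorem IsGen.norm_sub_le {v w : V} (h : S.IsGen v w) (t : ℝ≥0) :
    ‖S.op t v - v‖ ≤ t * ‖w‖ := by
  have h1 := norm_image_sub_le_of_norm_deriv_right_le_segment (a := 0) (b := t) (C := ‖w‖)
    (h.isCont_left.continuousOn_orbit.mono Set.Icc_subset_Ici_self)
    (fun x hx => h.hasDerivWithinAt_orbit_right hx.1)
    (fun x _ => S.norm_le _ _) t (Set.right_mem_Icc.2 t.2)
  simpa [orbit, S.zero, mul_comm] using h1

theorem IsGen.hasDerivWithinAt_orbit {v w : V} (h : S.IsGen v w) {t : ℝ} (ht : 0 ≤ t) :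
    HasDerivWithinAt (S.orbit v) (S.orbit w t) (Set.Ici 0) t := by
  have hr := h.hasDerivWithinAt_orbit_right ht
  rcases ht.eq_or_lt with rfl | ht'
  · exact hr
  have hl : HasDerivWithinAt (S.orbit v) (S.orbit w t) (Set.Icc 0 t) t := by
    rw [← hasDerivWithinAt_sdiff_singleton, Set.Icc_sdiff_right,
      hasDerivWithinAt_iff_tendsto_slope' (by simp)]
    rw [Metric.tendsto_nhds]
    intro ε hε
    have hc : ContinuousWithinAt (S.orbit w) (Set.Ico 0 t) t :=
      ((h.isCont_right.continuousOn_orbit) t ht).mono Set.Ico_subset_Ici_self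
    have h1 : Tendsto (fun s : ℝ => t - s) (𝓝[Set.Ico 0 t] t) (𝓝[>] 0) := by
      refine tendsto_nhdsWithin_iff.2 ⟨?_, ?_⟩
      · exact (Continuous.tendsto' (by fun_prop) t 0 (by simp)).mono_left nhdsWithin_le_nhds
      · filter_upwards [self_mem_nhdsWithin] with s hs
        simpa using hs.2
    filter_upwards [self_mem_nhdsWithin, Metric.tendsto_nhds.1 hc (ε / 2) (by positivity),
      Metric.tendsto_nhds.1 (Tendsto.comp h (tendsto_toNNReal_nhdsGT.comp h1)) (ε / 2)
        (by positivity)] with s hs h2 h3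
    have hst : s < t := hs.2
    have h4 : t.toNNReal = s.toNNReal + (t - s).toNNReal := by
      rw [← Real.toNNReal_add hs.1 (by linarith)]
      congr 1
      ring
    -- A backward quotient at `t` is `S_s` applied to a forward quotient at time `0`. The
    -- contraction `S_s` does not increase the distance of that quotient to `w`, and `S_s w → S_t w`
    -- as `s ↑ t`.
    have h5 : slope (S.orbit v) t s
        = S.op s.toNNReal ((t - s)⁻¹ • (S.op (t - s).toNNReal v - v)) := by
      rw [slope_comm]
      simp only [slope, orbit, vsub_eq_sub, map_smul, map_sub]
      rw [h4, S.add]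
    simp only [Function.comp_apply] at h3
    rw [Real.coe_toNNReal _ (by linarith)] at h3
    rw [h5]
    refine (dist_triangle _ (S.orbit w s) _).trans_lt ?_
    have h6 : dist (S.op s.toNNReal ((t - s)⁻¹ • (S.op (t - s).toNNReal v - v))) (S.orbit w s)
        ≤ dist ((t - s)⁻¹ • (S.op (t - s).toNNReal v - v)) w := by
      rw [dist_eq_norm, dist_eq_norm, orbit, ← map_sub]
      exact S.norm_le _ _
    linarith
  have := hl.union hr
  rwa [Set.Icc_union_Ici_eq_Ici ht] at this

/-- Dominated convergence for series: the difference quotient of `v i` never exceeds `‖w i‖` in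
norm, uniformly in `t`. -/
theorem IsGen.hasSum {ι : Type*} [CompleteSpace V] {v w : ι → V} (h : ∀ i, S.IsGen (v i) (w i))
    (hv : Summable fun i => ‖v i‖) (hw : Summable fun i => ‖w i‖) :
    S.IsGen (∑' i, v i) (∑' i, w i) := by
  have h1 := tendsto_tsum_of_dominated_convergence (𝓕 := 𝓝[>] (0 : ℝ≥0))
    (f := fun (t : ℝ≥0) i => (t : ℝ)⁻¹ • (S.op t (v i) - v i)) (g := w) hw (fun i => h i) ?_
  · refine h1.congr fun t => ?_
    have hs : Summable v := hv.of_norm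
    rw [tsum_const_smul'', (Summable.tsum_sub (hs.mapL _) hs), (S.op t).map_tsum hs]
  · filter_upwards [self_mem_nhdsWithin] with t ht i
    have ht' : (0 : ℝ) < t := by exact_mod_cast ht
    rw [norm_smul, norm_inv, Real.norm_of_nonneg ht'.le, inv_mul_le_iff₀ ht']
    exact (h i).norm_sub_le t

/-- By symmetry the cross term `⟨S_{s+2r} v, S_s v⟩` equals `‖S_{s+r} v‖²`, so distances along the
orbit are controlled by the monotone function `t ↦ ‖S_t v‖²` alone. -/
theorem norm_sub_sq (v : V) (s r : ℝ≥0) :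
    ‖S.op (s + r + r) v - S.op s v‖ ^ 2
      = ‖S.op (s + r + r) v‖ ^ 2 + ‖S.op s v‖ ^ 2 - 2 * ‖S.op (s + r) v‖ ^ 2 := by
  rw [norm_sub_sq_real]
  have : inner ℝ (S.op (s + r + r) v) (S.op s v) = ‖S.op (s + r) v‖ ^ 2 := by
    rw [show s + r + r = r + (s + r) by ring, S.add, S.symm, ← S.add, add_comm r s,
      real_inner_self_eq_norm_sq]
  rw [this]
  ring

theorem antitone_norm (v : V) : Antitone fun t : ℝ≥0 => ‖S.op t v‖ ^ 2 := by
  intro s t hst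
  obtain ⟨r, rfl⟩ := exists_add_of_le hst
  simp only
  rw [add_comm, S.add]
  gcongr
  exact S.norm_le _ _

variable (S) in
/-- A symmetric contraction semigroup converges strongly to its invariant vectors. -/
theorem exists_tendsto_atTop [CompleteSpace V] (v : V) :
    ∃ w, Tendsto (fun t => S.op t v) atTop (𝓝 w) ∧ ∀ s, S.op s w = w := by
  obtain ⟨N, hN⟩ : ∃ N, Tendsto (fun t : ℝ≥0 => ‖S.op t v‖ ^ 2) atTop (𝓝 N) :=
    ⟨_, tendsto_atTop_ciInf (antitone_norm v) ⟨0, by rintro _ ⟨t, rfl⟩; positivity⟩⟩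
  have hNle : ∀ t, N ≤ ‖S.op t v‖ ^ 2 := fun t => (antitone_norm v).le_of_tendsto hN t
  -- The squared norms decrease to `N`; beyond `T` the two positive terms of `norm_sub_sq` are below
  -- `N + ε/2` and the subtracted one is at least `2N`.
  have key : ∀ ε > 0, ∃ T : ℝ≥0, ∀ s ≥ T, ∀ r, ‖S.op (s + r + r) v - S.op s v‖ ^ 2 < ε := by
    intro ε hε
    obtain ⟨T, hT⟩ := (hN.eventually (gt_mem_nhds (show N < N + ε / 2 by linarith))).exists_forall_of_atTop
    refine ⟨T, fun s hs r => ?_⟩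
    rw [norm_sub_sq]
    have h1 := hT s hs
    have h2 := hT (s + r + r) (by rw [add_assoc]; exact le_add_right hs)
    have h3 := hNle (s + r)
    linarith
  have hc : Cauchy (map (fun t => S.op t v) atTop) := by
    rw [Metric.cauchy_iff]
    refine ⟨inferInstance, fun ε hε => ?_⟩
    obtain ⟨T, hT⟩ := key ((ε / 2) ^ 2) (by positivity)
    refine ⟨_, image_mem_map (Ici_mem_atTop T), ?_⟩
    have h1 : ∀ s ≥ T, ‖S.op s v - S.op T v‖ < ε / 2 := by
      intro s hs
      obtain ⟨r, rfl⟩ := exists_add_of_le hs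
      -- The estimate compares times that differ by twice the parameter, hence `r / 2`.
      have := hT T le_rfl (r / 2)
      rw [add_assoc, add_halves] at this
      exact lt_of_pow_lt_pow_left₀ 2 (by positivity) this
    rintro _ ⟨s, hs, rfl⟩ _ ⟨t, ht, rfl⟩
    rw [dist_eq_norm, show S.op s v - S.op t v = (S.op s v - S.op T v) - (S.op t v - S.op T v) by abel]
    exact (norm_sub_le _ _).trans_lt (by linarith [h1 s hs, h1 t ht])
  obtain ⟨w, hw⟩ := CompleteSpace.complete hc
  refine ⟨w, hw, fun s => ?_⟩
  have h1 : Tendsto (fun t => S.op s (S.op t v)) atTop (𝓝 (S.op s w)) :=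
    ((S.op s).continuous.tendsto w).comp hw
  have h2 : Tendsto (fun t => S.op (s + t) v) atTop (𝓝 w) :=
    Tendsto.comp hw (tendsto_atTop_mono (fun t => le_add_self) tendsto_id)
  refine tendsto_nhds_unique h1 (h2.congr fun t => S.add _ _ _)

end SymmSemigroup

/-! ### Invariant and reversible Markov kernels on `L²`. -/

section ReversibleKernel

variable {Ω : Type*} [MeasurableSpace Ω] {κ : Kernel Ω Ω} {μ : Measure Ω}

/-- Reversibility says that the joint law of start and end point is exchangeable; as a measure on a
product it is determined by rectangles. -/
theorem compProd_swap_eq_of_isReversible [IsProbabilityMeasure μ] [IsMarkovKernel κ]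
    (h : κ.IsReversible μ) : (μ ⊗ₘ κ).map Prod.swap = μ ⊗ₘ κ := by
  have : IsProbabilityMeasure ((μ ⊗ₘ κ).map Prod.swap) :=
    Measure.isProbabilityMeasure_map measurable_swap.aemeasurable
  refine Measure.ext_prod fun {s t} hs ht => ?_
  rw [Measure.map_apply measurable_swap (hs.prod ht), Set.preimage_swap_prod,
    Measure.compProd_apply_prod hs ht, Measure.compProd_apply_prod ht hs, h ht hs]

theorem measurePreserving_fst_compProd [SFinite μ] [IsMarkovKernel κ] :
    MeasurePreserving Prod.fst (μ ⊗ₘ κ) μ :=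
  ⟨measurable_fst, Measure.fst_compProd μ κ⟩

theorem measurePreserving_snd_compProd [SFinite μ] [IsMarkovKernel κ]
    (h : κ.Invariant μ) : MeasurePreserving Prod.snd (μ ⊗ₘ κ) μ :=
  ⟨measurable_snd, (Measure.snd_compProd μ κ).trans h⟩

/-- A `μ`-null set is null for `κ x` for almost every `x`, because `μ` is the `μ`-average of the `κ
x`. Hence the kernel acts on almost-everywhere classes. -/
theorem ae_ae_of_invariant (h : κ.Invariant μ) {p : Ω → Prop} (hp : ∀ᵐ x ∂μ, p x) :
    ∀ᵐ x ∂μ, ∀ᵐ y ∂(κ x), p y := by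
  rw [← h.def] at hp
  exact Measure.ae_ae_of_ae_comp hp

theorem aestronglyMeasurable_kernel_of_invariant (h : κ.Invariant μ) {f : Ω → ℝ}
    (hf : AEStronglyMeasurable f μ) : ∀ᵐ x ∂μ, AEStronglyMeasurable f (κ x) := by
  filter_upwards [ae_ae_of_invariant h hf.ae_eq_mk] with x hx
  exact ⟨_, hf.stronglyMeasurable_mk, hx⟩

theorem ae_integrable_of_invariant (h : κ.Invariant μ) {f : Ω → ℝ} (hf : Integrable f μ) :
    ∀ᵐ x ∂μ, Integrable f (κ x) := by
  rw [← h.def] at hf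
  exact Measure.ae_integrable_of_integrable_comp hf

theorem aestronglyMeasurable_integral_of_invariant (h : κ.Invariant μ) {f : Ω → ℝ}
    (hf : AEStronglyMeasurable f μ) : AEStronglyMeasurable (fun x => ∫ y, f y ∂(κ x)) μ := by
  refine ⟨fun x => ∫ y, hf.mk f y ∂(κ x), hf.stronglyMeasurable_mk.integral_kernel, ?_⟩
  filter_upwards [ae_ae_of_invariant h hf.ae_eq_mk] with x hx using integral_congr_ae hx

theorem lintegral_lintegral_of_invariant (h : κ.Invariant μ) {f : Ω → ℝ≥0∞}
    (hf : AEMeasurable f μ) : ∫⁻ x, ∫⁻ y, f y ∂(κ x) ∂μ = ∫⁻ x, f x ∂μ := by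
  conv_rhs => rw [← h.def]
  rw [Measure.lintegral_bind κ.aemeasurable (by rwa [h.def])]

theorem enorm_integral_sq_le [IsProbabilityMeasure μ] {f : Ω → ℝ}
    (hf : AEStronglyMeasurable f μ) : ‖∫ y, f y ∂μ‖ₑ ^ 2 ≤ ∫⁻ y, ‖f y‖ₑ ^ 2 ∂μ := by
  have h1 : ‖∫ y, f y ∂μ‖ₑ ≤ eLpNorm f 2 μ :=
    (enorm_integral_le_lintegral_enorm f).trans
      ((eLpNorm_one_eq_lintegral_enorm (μ := μ) (f := f)).symm.le.trans
        (eLpNorm_le_eLpNorm_of_exponent_le (by norm_num) hf))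
  calc ‖∫ y, f y ∂μ‖ₑ ^ 2 ≤ eLpNorm f 2 μ ^ 2 := by gcongr
    _ = _ := by simpa using eLpNorm_nnreal_pow_eq_lintegral (f := f) (μ := μ) (p := 2) (by simp)

/-- Jensen's inequality for the square under each `κ x`, integrated with the help of invariance. -/
theorem eLpNorm_integral_le_of_invariant [IsMarkovKernel κ] (h : κ.Invariant μ) {f : Ω → ℝ}
    (hf : AEStronglyMeasurable f μ) :
    eLpNorm (fun x => ∫ y, f y ∂(κ x)) 2 μ ≤ eLpNorm f 2 μ := by
  have key : eLpNorm (fun x => ∫ y, f y ∂(κ x)) 2 μ ^ 2 ≤ eLpNorm f 2 μ ^ 2 := by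
    have e1 := eLpNorm_nnreal_pow_eq_lintegral (f := f) (μ := μ) (p := 2) (by simp)
    have e2 := eLpNorm_nnreal_pow_eq_lintegral (f := fun x => ∫ y, f y ∂(κ x)) (μ := μ) (p := 2)
      (by simp)
    simp only [NNReal.coe_ofNat, ENNReal.rpow_ofNat, ENNReal.coe_ofNat] at e1 e2
    rw [e1, e2, ← lintegral_lintegral_of_invariant h (hf.enorm.pow_const 2)]
    refine lintegral_mono_ae ?_
    filter_upwards [aestronglyMeasurable_kernel_of_invariant h hf] with x hx
    exact enorm_integral_sq_le hx
  exact (ENNReal.pow_le_pow_left_iff two_ne_zero).1 key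

theorem memLp_integral_of_invariant [IsMarkovKernel κ] (h : κ.Invariant μ) {f : Ω → ℝ}
    (hf : MemLp f 2 μ) : MemLp (fun x => ∫ y, f y ∂(κ x)) 2 μ :=
  ⟨aestronglyMeasurable_integral_of_invariant h hf.1,
    (eLpNorm_integral_le_of_invariant h hf.1).trans_lt hf.2⟩

theorem integrable_mul_compProd [SFinite μ] [IsMarkovKernel κ] (h : κ.Invariant μ)
    {f g : Ω → ℝ} (hf : MemLp f 2 μ) (hg : MemLp g 2 μ) :
    Integrable (fun p : Ω × Ω => f p.1 * g p.2) (μ ⊗ₘ κ) :=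
  (hf.comp_measurePreserving measurePreserving_fst_compProd).integrable_mul
    (hg.comp_measurePreserving (measurePreserving_snd_compProd h))

theorem integral_mul_compProd [SFinite μ] [IsMarkovKernel κ] (h : κ.Invariant μ)
    {f g : Ω → ℝ} (hf : MemLp f 2 μ) (hg : MemLp g 2 μ) :
    ∫ p, f p.1 * g p.2 ∂(μ ⊗ₘ κ) = ∫ x, f x * ∫ y, g y ∂(κ x) ∂μ := by
  rw [Measure.integral_compProd (integrable_mul_compProd h hf hg)]
  simp_rw [integral_const_mul]

/-- Both sides are integrals against the joint law of start and end point, with the two coordinates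
interchanged. -/
theorem integral_mul_integral_comm [IsProbabilityMeasure μ] [IsMarkovKernel κ]
    (h : κ.IsReversible μ) {f g : Ω → ℝ} (hf : MemLp f 2 μ) (hg : MemLp g 2 μ) :
    ∫ x, (∫ y, f y ∂(κ x)) * g x ∂μ = ∫ x, f x * ∫ y, g y ∂(κ x) ∂μ := by
  rw [← integral_mul_compProd h.invariant hf hg]
  conv_rhs => rw [← compProd_swap_eq_of_isReversible h]
  rw [integral_map measurable_swap.aemeasurable]
  · simp only [Prod.fst_swap, Prod.snd_swap]
    simp_rw [mul_comm _ (g _)]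
    rw [integral_mul_compProd h.invariant hg hf]
  · rw [compProd_swap_eq_of_isReversible h]
    exact (integrable_mul_compProd h.invariant hf hg).1

/-- Reversibility of a kernel on a product space needs to be checked on rectangles only. -/
theorem isReversible_of_rectangles {E X : Type*} [MeasurableSpace E] [MeasurableSpace X]
    {κ : Kernel (E × X) (E × X)} [IsMarkovKernel κ] {μ : Measure (E × X)} [IsProbabilityMeasure μ]
    (h : ∀ ⦃A A' : Set E⦄ ⦃B B' : Set X⦄, MeasurableSet A → MeasurableSet A' → MeasurableSet B →
      MeasurableSet B' →
      ∫⁻ z in A ×ˢ B, κ z (A' ×ˢ B') ∂μ = ∫⁻ z in A' ×ˢ B', κ z (A ×ˢ B) ∂μ) :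
    κ.IsReversible μ := by
  have e1 : ∀ S : Set (E × X), ∀ T, MeasurableSet T →
      ((μ.restrict S).bind κ) T = ∫⁻ z in S, κ z T ∂μ := fun S T hT =>
    Measure.bind_apply hT κ.aemeasurable
  have e2 : ∀ S T : Set (E × X), MeasurableSet T →
      (μ.withDensity fun z => κ z S) T = ∫⁻ z in T, κ z S ∂μ := fun S T hT =>
    withDensity_apply _ hT
  have hfin : ∀ S, IsFiniteMeasure ((μ.restrict S).bind κ) := fun S => by infer_instance
  -- For a fixed rectangle both sides are measures in `T`, so `T` can be made arbitrary. The same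
  -- argument in the other variable then frees the first set as well.
  have h1 : ∀ ⦃A : Set E⦄ ⦃B : Set X⦄, MeasurableSet A → MeasurableSet B → ∀ T, MeasurableSet T →
      ∫⁻ z in A ×ˢ B, κ z T ∂μ = ∫⁻ z in T, κ z (A ×ˢ B) ∂μ := by
    intro A B hA hB T hT
    rw [← e1 _ _ hT, ← e2 _ _ hT]
    congr 1
    refine Measure.ext_prod fun {A' B'} hA' hB' => ?_
    rw [e1 _ _ (hA'.prod hB'), e2 _ _ (hA'.prod hB')]
    exact h hA hA' hB hB'
  intro S T hS hT
  rw [← e1 _ _ hT, ← e2 _ _ hT]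
  congr 1
  refine Measure.ext_prod fun {A' B'} hA' hB' => ?_
  rw [e1 _ _ (hA'.prod hB'), e2 _ _ (hA'.prod hB')]
  exact (h1 hA' hB' S hS).symm

theorem isReversible_parallelComp {E X : Type*} [MeasurableSpace E] [MeasurableSpace X]
    {κ : Kernel E E} {η : Kernel X X} [IsMarkovKernel κ] [IsMarkovKernel η] {μ : Measure E}
    {ν : Measure X} [IsProbabilityMeasure μ] [IsProbabilityMeasure ν] (hκ : κ.IsReversible μ)
    (hη : η.IsReversible ν) : (κ ∥ₖ η).IsReversible (μ.prod ν) := by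
  refine isReversible_of_rectangles fun A A' B B' hA hA' hB hB' => ?_
  rw [← Measure.prod_restrict, ← Measure.prod_restrict]
  simp_rw [Kernel.parallelComp_apply, Measure.prod_prod]
  rw [lintegral_prod_mul (κ.measurable_coe hA').aemeasurable (η.measurable_coe hB').aemeasurable,
    lintegral_prod_mul (κ.measurable_coe hA).aemeasurable (η.measurable_coe hB).aemeasurable,
    hκ hA hA', hη hB hB']

end ReversibleKernel

/-! ### The `L²` semigroup of a reversible Markov semigroup and its generator. -/

namespace MarkovSemigroup

variable {Ω : Type*} [MeasurableSpace Ω] {P : MarkovSemigroup Ω} {μ : Measure Ω}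

instance (t : ℝ≥0) : IsMarkovKernel (P.kernel t) := P.markov t

theorem IsReversible.invariant (h : P.IsReversible μ) (t : ℝ≥0) : (P.kernel t).Invariant μ :=
  (h t).invariant

theorem IsReversible.prod {E X : Type*} [MeasurableSpace E] [MeasurableSpace X]
    {P : MarkovSemigroup E} {Q : MarkovSemigroup X} {μ : Measure E}
    {ν : Measure X} [IsProbabilityMeasure μ] [IsProbabilityMeasure ν] (hP : P.IsReversible μ)
    (hQ : Q.IsReversible ν) : (P.prod Q).IsReversible (μ.prod ν) := fun t =>
  isReversible_parallelComp (hP t) (hQ t)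

theorem IsReversible.memLp_act (h : P.IsReversible μ) (t : ℝ≥0) {f : Ω → ℝ} (hf : MemLp f 2 μ) :
    MemLp (P.act t f) 2 μ :=
  memLp_integral_of_invariant (h.invariant t) hf

theorem IsReversible.act_congr (h : P.IsReversible μ) (t : ℝ≥0) {f g : Ω → ℝ} (hfg : f =ᵐ[μ] g) :
    P.act t f =ᵐ[μ] P.act t g := by
  filter_upwards [ae_ae_of_invariant (h.invariant t) hfg] with x hx using integral_congr_ae hx

theorem IsReversible.act_add (h : P.IsReversible μ) (t : ℝ≥0) {f g : Ω → ℝ} (hf : Integrable f μ)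
    (hg : Integrable g μ) : P.act t (f + g) =ᵐ[μ] P.act t f + P.act t g := by
  filter_upwards [ae_integrable_of_invariant (h.invariant t) hf,
    ae_integrable_of_invariant (h.invariant t) hg] with x hx hx' using integral_add hx hx'

theorem act_smul (t : ℝ≥0) (c : ℝ) (f : Ω → ℝ) : P.act t (c • f) = c • P.act t f := by
  ext x
  simp [act, integral_const_mul]

theorem act_zero (f : Ω → ℝ) (hf : Measurable f) : P.act 0 f = f := by
  ext x
  rw [act, P.zero, Kernel.id_apply, integral_dirac' _ _ hf.stronglyMeasurable]

theorem IsReversible.act_act (h : P.IsReversible μ) (s t : ℝ≥0) {f : Ω → ℝ}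
    (hf : Integrable f μ) : P.act (s + t) f =ᵐ[μ] P.act s (P.act t f) := by
  have h1 := h.invariant (s + t)
  filter_upwards [ae_integrable_of_invariant h1 hf] with x hx
  have e : P.kernel (s + t) = P.kernel t ∘ₖ P.kernel s := by rw [add_comm, P.add]
  rw [e] at hx
  change ∫ y, f y ∂(P.kernel (s + t) x) = _
  rw [e, Kernel.integral_comp hx]
  rfl

theorem coeFn_eq_of_toLp {f : Ω → ℝ} {v : Lp ℝ 2 μ} (hf : MemLp f 2 μ) (h : ⇑v =ᵐ[μ] f) :
    v = hf.toLp f := by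
  rw [← Lp.toLp_coeFn v (Lp.memLp v)]
  exact MemLp.toLp_eq_toLp_iff _ _ |>.2 h

variable [IsProbabilityMeasure μ]

/-- The semigroup of operators on `L²(μ)` of a reversible Markov semigroup. -/
def IsReversible.toSymm (h : P.IsReversible μ) : SymmSemigroup (Lp ℝ 2 μ) where
  op t := LinearMap.mkContinuous
    { toFun := fun v => (h.memLp_act t (Lp.memLp v)).toLp _
      map_add' := fun v w => by
        rw [← MemLp.toLp_add]
        refine (MemLp.toLp_eq_toLp_iff _ _).2 ?_
        refine (h.act_congr t (Lp.coeFn_add v w)).trans ?_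
        exact h.act_add t ((Lp.memLp v).integrable (by norm_num))
          ((Lp.memLp w).integrable (by norm_num))
      map_smul' := fun c v => by
        rw [RingHom.id_apply, ← MemLp.toLp_const_smul]
        refine (MemLp.toLp_eq_toLp_iff _ _).2 ?_
        refine (h.act_congr t (Lp.coeFn_smul c v)).trans ?_
        rw [act_smul] } 1
    (fun v => by
      simp only [LinearMap.coe_mk, AddHom.coe_mk, one_mul]
      rw [Lp.norm_toLp, Lp.norm_def]
      exact ENNReal.toReal_mono (Lp.eLpNorm_ne_top v)
        (eLpNorm_integral_le_of_invariant (h.invariant t) (Lp.aestronglyMeasurable v)))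
  zero v := by
    symm
    refine coeFn_eq_of_toLp (h.memLp_act 0 (Lp.memLp v)) ?_
    have h1 := (Lp.aestronglyMeasurable v).ae_eq_mk
    have h2 := h.act_congr 0 h1
    rw [act_zero _ (Lp.aestronglyMeasurable v).stronglyMeasurable_mk.measurable] at h2
    exact h1.trans h2.symm
  add s t v := by
    refine (MemLp.toLp_eq_toLp_iff (h.memLp_act _ (Lp.memLp v))
      (h.memLp_act s (Lp.memLp _))).2 ?_
    refine (h.act_act s t ((Lp.memLp v).integrable (by norm_num))).trans ?_
    exact h.act_congr s (MemLp.coeFn_toLp (h.memLp_act t (Lp.memLp v))).symm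
  norm_le t v := by
    simp only [LinearMap.mkContinuous_apply, LinearMap.coe_mk, AddHom.coe_mk]
    rw [Lp.norm_toLp, Lp.norm_def]
    exact ENNReal.toReal_mono (Lp.eLpNorm_ne_top v)
      (eLpNorm_integral_le_of_invariant (h.invariant t) (Lp.aestronglyMeasurable v))
  symm t v w := by
    simp only [LinearMap.mkContinuous_apply, LinearMap.coe_mk, AddHom.coe_mk]
    rw [L2.inner_def, L2.inner_def]
    have h1 := integral_mul_integral_comm (h t) (Lp.memLp w) (Lp.memLp v)
    refine Eq.trans ?_ (h1.symm.trans ?_)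
    · refine integral_congr_ae ?_
      filter_upwards [MemLp.coeFn_toLp (h.memLp_act t (Lp.memLp v))] with x hx
      rw [hx]
      rfl
    · refine integral_congr_ae ?_
      filter_upwards [MemLp.coeFn_toLp (h.memLp_act t (Lp.memLp w))] with x hx
      rw [hx]
      rfl

theorem IsReversible.toSymm_toLp (h : P.IsReversible μ) (t : ℝ≥0) {f : Ω → ℝ} (hf : MemLp f 2 μ) :
    h.toSymm.op t (hf.toLp f) = (h.memLp_act t hf).toLp _ :=
  (MemLp.toLp_eq_toLp_iff (h.memLp_act t (Lp.memLp _)) (h.memLp_act t hf)).2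
    (h.act_congr t hf.coeFn_toLp)

/-- The bridge to the Hilbert space: uniqueness, symmetry, closedness and derivatives of orbits are
inherited from the abstract semigroup. -/
theorem IsReversible.hasGen_iff (h : P.IsReversible μ) {f g : Ω → ℝ} (hf : MemLp f 2 μ)
    (hg : MemLp g 2 μ) :
    P.HasGen μ f g ↔ h.toSymm.IsGen (hf.toLp f) (hg.toLp g) := by
  have h1 : ∀ t : ℝ≥0, MemLp ((t : ℝ)⁻¹ • (P.act t f - f)) 2 μ := fun t =>
    ((h.memLp_act t hf).sub hf).const_smul _
  have h2 : ∀ t : ℝ≥0, (t : ℝ)⁻¹ • (h.toSymm.op t (hf.toLp f) - hf.toLp f) = (h1 t).toLp _ := by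
    intro t
    rw [h.toSymm_toLp, ← MemLp.toLp_sub, ← MemLp.toLp_const_smul]
  rw [SymmSemigroup.IsGen]
  simp_rw [h2]
  rw [Lp.tendsto_Lp_iff_tendsto_eLpNorm'']
  exact ⟨fun H => H.2.2, fun H => ⟨hf, hg, H⟩⟩

end MarkovSemigroup

namespace MarkovSemigroup

variable {Ω : Type*} [MeasurableSpace Ω] {P : MarkovSemigroup Ω} {μ : Measure Ω}

theorem InDomain.hasGen {f : Ω → ℝ} (hf : P.InDomain μ f) : P.HasGen μ f (P.gen μ f) := by
  rw [gen, dif_pos hf]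
  exact hf.choose_spec

theorem InDomain.memLp {f : Ω → ℝ} (hf : P.InDomain μ f) : MemLp f 2 μ := hf.hasGen.1

theorem InDomain.memLp_gen {f : Ω → ℝ} (hf : P.InDomain μ f) : MemLp (P.gen μ f) 2 μ :=
  hf.hasGen.2.1

theorem HasGen.inDomain {f g : Ω → ℝ} (hf : P.HasGen μ f g) : P.InDomain μ f := ⟨g, hf⟩

theorem _root_.Hybrid.toReal_eLpNorm_const_mul (c : ℝ) (f : Ω → ℝ) :
    (eLpNorm (fun x => c * f x) 2 μ).toReal = |c| * (eLpNorm f 2 μ).toReal := by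
  have := eLpNorm_const_smul c f 2 μ
  rw [show (fun x => c * f x) = c • f from rfl, this, ENNReal.toReal_mul]
  simp

variable [IsProbabilityMeasure μ]

namespace IsReversible

variable (h : P.IsReversible μ)
include h

theorem isGen {f g : Ω → ℝ} (hf : P.HasGen μ f g) :
    h.toSymm.IsGen (hf.1.toLp f) (hf.2.1.toLp g) :=
  (h.hasGen_iff hf.1 hf.2.1).1 hf

theorem hasGen_congr {f g f' g' : Ω → ℝ} (hf : P.HasGen μ f g) (e : f =ᵐ[μ] f')
    (e' : g =ᵐ[μ] g') : P.HasGen μ f' g' := by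
  have h1 := hf.1.ae_eq e
  have h2 := hf.2.1.ae_eq e'
  rw [h.hasGen_iff h1 h2]
  convert h.isGen hf using 1
  · exact (MemLp.toLp_eq_toLp_iff _ _).2 e.symm
  · exact (MemLp.toLp_eq_toLp_iff _ _).2 e'.symm

theorem hasGen_unique {f g g' : Ω → ℝ} (hf : P.HasGen μ f g) (hf' : P.HasGen μ f g') :
    g =ᵐ[μ] g' :=
  (MemLp.toLp_eq_toLp_iff hf.2.1 hf'.2.1).1 ((h.isGen hf).unique (h.isGen hf'))

theorem gen_eq {f g : Ω → ℝ} (hf : P.HasGen μ f g) : P.gen μ f =ᵐ[μ] g :=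
  h.hasGen_unique hf.inDomain.hasGen hf

theorem hasGen_add {f g f' g' : Ω → ℝ} (hf : P.HasGen μ f g) (hf' : P.HasGen μ f' g') :
    P.HasGen μ (f + f') (g + g') := by
  rw [h.hasGen_iff (hf.1.add hf'.1) (hf.2.1.add hf'.2.1), MemLp.toLp_add hf.1 hf'.1,
    MemLp.toLp_add hf.2.1 hf'.2.1]
  exact (h.isGen hf).add (h.isGen hf')

theorem hasGen_const_smul {f g : Ω → ℝ} (c : ℝ) (hf : P.HasGen μ f g) :
    P.HasGen μ (c • f) (c • g) := by
  rw [h.hasGen_iff (hf.1.const_smul c) (hf.2.1.const_smul c), MemLp.toLp_const_smul,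
    MemLp.toLp_const_smul]
  exact (h.isGen hf).smul c

theorem hasGen_sub {f g f' g' : Ω → ℝ} (hf : P.HasGen μ f g) (hf' : P.HasGen μ f' g') :
    P.HasGen μ (f - f') (g - g') := by
  have := h.hasGen_add hf (h.hasGen_const_smul (-1) hf')
  simpa [sub_eq_add_neg] using this

omit h in
theorem _root_.Hybrid.MarkovSemigroup.hasGen_const (c : ℝ) :
    P.HasGen μ (fun _ => c) (fun _ => 0) := by
  refine ⟨memLp_const c, memLp_const 0, ?_⟩
  simp [act]

theorem integral_gen_mul_comm {f g f' g' : Ω → ℝ} (hf : P.HasGen μ f g)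
    (hf' : P.HasGen μ f' g') : ∫ x, g x * f' x ∂μ = ∫ x, f x * g' x ∂μ := by
  have key := (h.isGen hf).inner_comm (h.isGen hf')
  rw [L2.inner_def, L2.inner_def] at key
  refine Eq.trans ?_ (key.trans ?_)
  · refine integral_congr_ae ?_
    filter_upwards [hf.2.1.coeFn_toLp, hf'.1.coeFn_toLp] with x h1 h2
    rw [h1, h2]
    exact mul_comm _ _
  · refine integral_congr_ae ?_
    filter_upwards [hf.1.coeFn_toLp, hf'.2.1.coeFn_toLp] with x h1 h2
    rw [h1, h2]
    exact mul_comm _ _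

theorem integral_gen_eq_zero {f g : Ω → ℝ} (hf : P.HasGen μ f g) : ∫ x, g x ∂μ = 0 := by
  have := h.integral_gen_mul_comm hf (hasGen_const 1)
  simpa using this

theorem hasGen_act {f g : Ω → ℝ} (hf : P.HasGen μ f g) (t : ℝ≥0) :
    P.HasGen μ (P.act t f) (P.act t g) := by
  rw [h.hasGen_iff (h.memLp_act t hf.1) (h.memLp_act t hf.2.1), ← h.toSymm_toLp t hf.1,
    ← h.toSymm_toLp t hf.2.1]
  exact (h.isGen hf).map t

theorem hasGen_tsum {ι : Type*} [Countable ι] {f g : ι → Ω → ℝ}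
    (hf : ∀ i, P.HasGen μ (f i) (g i)) (h1 : Summable fun i => (eLpNorm (f i) 2 μ).toReal)
    (h2 : Summable fun i => (eLpNorm (g i) 2 μ).toReal) :
    P.HasGen μ (fun x => ∑' i, f i x) (fun x => ∑' i, g i x) := by
  have key : ∀ {f : ι → Ω → ℝ} (hf : ∀ i, MemLp (f i) 2 μ),
      (Summable fun i => (eLpNorm (f i) 2 μ).toReal) →
      (⇑(∑' i, (hf i).toLp (f i)) : Ω → ℝ) =ᵐ[μ] fun x => ∑' i, f i x := by
    intro f hf hs
    have h3 : Summable fun i => ‖(hf i).toLp (f i)‖ := by simpa only [Lp.norm_toLp] using hs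
    have h4 := Lp.coeFn_tsum (tsum_enorm_ne_top_iff_summable_norm.2 h3)
    filter_upwards [h4, ae_all_iff.2 fun i => (hf i).coeFn_toLp] with x hx hx'
    rw [hx]
    exact tsum_congr hx'
  have e1 := key (fun i => (hf i).1) h1
  have e2 := key (fun i => (hf i).2.1) h2
  have h3 := SymmSemigroup.IsGen.hasSum (fun i => h.isGen (hf i))
    (by simpa only [Lp.norm_toLp] using h1) (by simpa only [Lp.norm_toLp] using h2)
  have m1 := (Lp.memLp (∑' i, (hf i).1.toLp (f i))).ae_eq e1
  have m2 := (Lp.memLp (∑' i, (hf i).2.1.toLp (g i))).ae_eq e2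
  rw [h.hasGen_iff m1 m2, ← coeFn_eq_of_toLp m1 e1, ← coeFn_eq_of_toLp m2 e2]
  exact h3

/-- The generator is closed under sums of series that are dominated in `L²`. -/
theorem hasGen_tsum_of_bound {ι : Type*} [Countable ι] {a : ι → ℝ} {φ ψ b : ι → Ω → ℝ} {C : ℝ}
    (ha : Summable a) (hφ : ∀ i, P.HasGen μ (φ i) (ψ i)) (hC : ∀ i x, |φ i x| ≤ C)
    (hb : ∀ i, MemLp (b i) 2 μ) (hψ : ∀ i, ∀ᵐ x ∂μ, |ψ i x| ≤ b i x)
    (hs : Summable fun i => |a i| * (eLpNorm (b i) 2 μ).toReal) :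
    P.HasGen μ (fun x => ∑' i, a i * φ i x) (fun x => ∑' i, a i * ψ i x) := by
  refine h.hasGen_tsum (fun i => h.hasGen_const_smul (a i) (hφ i)) ?_ ?_
  · refine Summable.congr ?_ fun i => (toReal_eLpNorm_const_mul (a i) (φ i)).symm
    refine Summable.of_nonneg_of_le (fun i => by positivity) (fun i => ?_) (ha.abs.mul_right |C|)
    gcongr
    have h1 : eLpNorm (φ i) 2 μ ≤ ENNReal.ofReal |C| := by
      refine (eLpNorm_le_of_ae_bound (C := |C|) (Eventually.of_forall fun x => ?_)).trans ?_
      · exact (hC i x).trans (le_abs_self C)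
      · simp
    exact (ENNReal.toReal_mono ENNReal.ofReal_ne_top h1).trans (by simp)
  · refine Summable.congr ?_ fun i => (toReal_eLpNorm_const_mul (a i) (ψ i)).symm
    refine Summable.of_nonneg_of_le (fun i => by positivity) (fun i => ?_) hs
    gcongr
    · exact (hb i).2.ne
    · exact eLpNorm_mono_ae (by
        filter_upwards [hψ i] with x hx using hx.trans (le_abs_self _))

omit h [IsProbabilityMeasure μ] in
theorem _root_.Hybrid.ae_summable_of_summable_eLpNorm {ι : Type*} [Countable ι] {a : ι → ℝ}
    {b : ι → Ω → ℝ} (hb : ∀ i, MemLp (b i) 2 μ)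
    (hs : Summable fun i => |a i| * (eLpNorm (b i) 2 μ).toReal) :
    ∀ᵐ x ∂μ, Summable fun i => |a i * b i x| := by
  have h1 : ∀ i, eLpNorm (a i • b i) 2 μ = ENNReal.ofReal (|a i| * (eLpNorm (b i) 2 μ).toReal) := by
    intro i
    rw [← toReal_eLpNorm_const_mul]
    exact (ENNReal.ofReal_toReal ((hb i).const_smul (a i)).2.ne).symm
  have h2 : ∑' i, eLpNorm (a i • b i) 2 μ ≠ ⊤ := by
    rw [tsum_congr h1]
    exact hs.tsum_ofReal_ne_top
  have h3 := summable_norm_of_tsum_eLpNorm_ne_top (p := 2) (by norm_num)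
    (fun i => ((hb i).const_smul (a i)).1) h2
  filter_upwards [h3] with x hx using hx

/-- The carré du champ is nonnegative. -/
theorem carreDiag_nonneg {f : Ω → ℝ} (hf : P.InDomain μ f) (hff : P.InDomain μ (f * f)) :
    ∀ᵐ x ∂μ, 0 ≤ P.carreDiag μ f x := by
  -- `L²` convergence implies convergence in measure, hence almost everywhere along a sequence of
  -- times. The second sequence below is extracted from the first, so that the quotients of `f` and
  -- of `f²` converge along the same times.
  have tim : ∀ {f g : Ω → ℝ}, P.HasGen μ f g →
      TendstoInMeasure μ (fun (t : ℝ≥0) x => (t : ℝ)⁻¹ * (P.act t f x - f x)) (𝓝[>] 0) g := by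
    intro f g hfg
    refine tendstoInMeasure_of_tendsto_eLpNorm (p := 2) (by norm_num) (fun t => ?_)
      hfg.2.1.1 hfg.2.2
    exact (((h.memLp_act t hfg.1).sub hfg.1).const_smul ((t : ℝ)⁻¹)).1
  have T1 := tim hf.hasGen
  have T2 := tim hff.hasGen
  obtain ⟨t, ht, hlim1⟩ := T1.exists_seq_tendsto_ae'
  obtain ⟨n, hn, hlim2⟩ := (T2.comp ht).exists_seq_tendsto_ae
  have hpos : ∀ᶠ m in atTop, ∀ᵐ x ∂μ,
      0 ≤ ((t m : ℝ)⁻¹ * (P.act (t m) (f * f) x - (f * f) x))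
        - 2 * f x * ((t m : ℝ)⁻¹ * (P.act (t m) f x - f x)) := by
    -- Before the limit, the combination is `t⁻¹ ∫ (f(y) - f(x))² P_t(x, dy)`.
    filter_upwards [ht self_mem_nhdsWithin] with m _
    filter_upwards [ae_integrable_of_invariant (h.invariant (t m)) (hf.memLp.integrable (by norm_num)),
      ae_integrable_of_invariant (h.invariant (t m)) (hff.memLp.integrable (by norm_num))]
      with x h1 h2
    have h3 : 0 ≤ ∫ y, (f y - f x) ^ 2 ∂(P.kernel (t m) x) := integral_nonneg fun y => sq_nonneg _
    have h4 : ∫ y, (f y - f x) ^ 2 ∂(P.kernel (t m) x)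
        = P.act (t m) (f * f) x - 2 * f x * P.act (t m) f x + f x * f x := by
      have : ∀ y, (f y - f x) ^ 2 = (f * f) y - 2 * f x * f y + f x * f x := fun y => by
        simp only [Pi.mul_apply]; ring
      simp_rw [this]
      have h5 : Integrable (fun y => 2 * f x * f y) (P.kernel (t m) x) := h1.const_mul _
      have h6 : Integrable (fun y => (f * f) y - 2 * f x * f y) (P.kernel (t m) x) := h2.sub h5
      rw [integral_add h6 (integrable_const _), integral_sub h2 h5, integral_const_mul]
      simp [act]
    rw [h4] at h3
    have h5 : 0 ≤ (t m : ℝ)⁻¹ := by positivity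
    have := mul_nonneg h5 h3
    simp only [Pi.mul_apply] at *
    linarith
  rw [eventually_atTop] at hpos
  obtain ⟨N, hN⟩ := hpos
  have hN' : ∀ᵐ x ∂μ, ∀ m ≥ N, 0 ≤ ((t m : ℝ)⁻¹ * (P.act (t m) (f * f) x - (f * f) x))
        - 2 * f x * ((t m : ℝ)⁻¹ * (P.act (t m) f x - f x)) :=
    ae_all_iff.2 fun m => by
      by_cases hm : N ≤ m
      · filter_upwards [hN m hm] with x hx _ using hx
      · exact Eventually.of_forall fun x hm' => absurd hm' hm
  filter_upwards [hlim1, hlim2, hN'] with x h1 h2 h3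
  have h4 := (h2.sub ((h1.comp hn.tendsto_atTop).const_mul (2 * f x)))
  have h5 : 0 ≤ P.gen μ (f * f) x - 2 * f x * P.gen μ f x := by
    refine ge_of_tendsto h4 ?_
    filter_upwards [hn.tendsto_atTop.eventually_ge_atTop N] with m hm
    exact h3 _ hm
  simp only [carreDiag, carre]
  linarith

end IsReversible

end MarkovSemigroup

theorem memLp_mul_of_bounded {Ω : Type*} [MeasurableSpace Ω] {μ : Measure Ω} {f g : Ω → ℝ} {C : ℝ}
    (hf : AEStronglyMeasurable f μ) (hC : ∀ x, |f x| ≤ C) (hg : MemLp g 2 μ) :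
    MemLp (fun x => f x * g x) 2 μ :=
  MemLp.of_le_mul (c := C) hg (hf.mul hg.1) (Eventually.of_forall fun x => by
    rw [norm_mul]
    gcongr
    exact hC x)

/-! ### Bilinear calculus of the carré du champ. -/

namespace MarkovSemigroup

variable {Ω : Type*} [MeasurableSpace Ω] {P : MarkovSemigroup Ω} {μ : Measure Ω}

theorem carre_comm (f g : Ω → ℝ) : P.carre μ f g = P.carre μ g f := by
  ext x
  rw [carre, carre, mul_comm f g]
  ring

theorem gen_mul (f g : Ω → ℝ) (x : Ω) :
    P.gen μ (f * g) x = f x * P.gen μ g x + g x * P.gen μ f x + 2 * P.carre μ f g x := by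
  rw [carre]
  ring

variable [IsProbabilityMeasure μ]

theorem IsReversible.carre_sub_right (h : P.IsReversible μ) {f g g' : Ω → ℝ}
    (hg : P.InDomain μ g) (hg' : P.InDomain μ g') (hfg : P.InDomain μ (f * g))
    (hfg' : P.InDomain μ (f * g')) :
    ∀ᵐ x ∂μ, P.carre μ f (g - g') x = P.carre μ f g x - P.carre μ f g' x := by
  have h1 := h.gen_eq (h.hasGen_sub hg.hasGen hg'.hasGen)
  have h2 := h.gen_eq (h.hasGen_sub hfg.hasGen hfg'.hasGen)
  rw [← mul_sub] at h2
  filter_upwards [h1, h2] with x h1 h2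
  rw [carre, carre, carre, h1, h2]
  simp only [Pi.sub_apply]
  ring

theorem IsReversible.carre_add_right (h : P.IsReversible μ) {f g g' : Ω → ℝ}
    (hg : P.InDomain μ g) (hg' : P.InDomain μ g') (hfg : P.InDomain μ (f * g))
    (hfg' : P.InDomain μ (f * g')) :
    ∀ᵐ x ∂μ, P.carre μ f (g + g') x = P.carre μ f g x + P.carre μ f g' x := by
  have h1 := h.gen_eq (h.hasGen_add hg.hasGen hg'.hasGen)
  have h2 := h.gen_eq (h.hasGen_add hfg.hasGen hfg'.hasGen)
  rw [← mul_add] at h2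
  filter_upwards [h1, h2] with x h1 h2
  rw [carre, carre, carre, h1, h2]
  simp only [Pi.add_apply]
  ring

namespace IsDiffusion

variable {𝒜 : Subalgebra ℝ (Ω → ℝ)} (hd : P.IsDiffusion μ 𝒜) (h : P.IsReversible μ)
include hd

omit [IsProbabilityMeasure μ] in
theorem memLp_mul {f g : Ω → ℝ} (hf : f ∈ 𝒜) (hg : MemLp g 2 μ) :
    MemLp (fun x => f x * g x) 2 μ := by
  obtain ⟨C, hC⟩ := hd.bounded f hf
  exact memLp_mul_of_bounded (hd.measurable f hf).aestronglyMeasurable hC hg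

omit [IsProbabilityMeasure μ] in
theorem memLp_carre {f g : Ω → ℝ} (hf : f ∈ 𝒜) (hg : g ∈ 𝒜) : MemLp (P.carre μ f g) 2 μ := by
  have h1 := (hd.domain _ (𝒜.mul_mem hf hg)).memLp_gen
  have h2 := hd.memLp_mul hf (hd.domain _ hg).memLp_gen
  have h3 := hd.memLp_mul hg (hd.domain _ hf).memLp_gen
  have := ((h1.sub h2).sub h3).const_mul (2⁻¹)
  refine this.ae_eq (Eventually.of_forall fun x => ?_)
  simp only [carre, Pi.sub_apply]
  ring

include h

theorem carreDiag_nonneg {f : Ω → ℝ} (hf : f ∈ 𝒜) : ∀ᵐ x ∂μ, 0 ≤ P.carreDiag μ f x :=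
  h.carreDiag_nonneg (hd.domain f hf) (hd.domain _ (𝒜.mul_mem hf hf))

theorem gen_sub {f g : Ω → ℝ} (hf : f ∈ 𝒜) (hg : g ∈ 𝒜) :
    ∀ᵐ x ∂μ, P.gen μ (f - g) x = P.gen μ f x - P.gen μ g x :=
  h.gen_eq (h.hasGen_sub (hd.domain f hf).hasGen (hd.domain g hg).hasGen)

theorem carre_sub_right {f g g' : Ω → ℝ} (hf : f ∈ 𝒜) (hg : g ∈ 𝒜) (hg' : g' ∈ 𝒜) :
    ∀ᵐ x ∂μ, P.carre μ f (g - g') x = P.carre μ f g x - P.carre μ f g' x :=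
  h.carre_sub_right (hd.domain _ hg) (hd.domain _ hg') (hd.domain _ (𝒜.mul_mem hf hg))
    (hd.domain _ (𝒜.mul_mem hf hg'))

theorem carre_add_right {f g g' : Ω → ℝ} (hf : f ∈ 𝒜) (hg : g ∈ 𝒜) (hg' : g' ∈ 𝒜) :
    ∀ᵐ x ∂μ, P.carre μ f (g + g') x = P.carre μ f g x + P.carre μ f g' x :=
  h.carre_add_right (hd.domain _ hg) (hd.domain _ hg') (hd.domain _ (𝒜.mul_mem hf hg))
    (hd.domain _ (𝒜.mul_mem hf hg'))

theorem carreDiag_sub {f g : Ω → ℝ} (hf : f ∈ 𝒜) (hg : g ∈ 𝒜) :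
    ∀ᵐ x ∂μ, P.carreDiag μ (f - g) x
      = P.carreDiag μ f x - 2 * P.carre μ f g x + P.carreDiag μ g x := by
  filter_upwards [hd.carre_sub_right h (𝒜.sub_mem hf hg) hf hg, hd.carre_sub_right h hf hf hg,
    hd.carre_sub_right h hg hf hg] with x h1 h2 h3
  rw [carreDiag, h1, carre_comm _ f, carre_comm _ g, h2, h3, carre_comm g f, carreDiag, carreDiag]
  ring

theorem carreDiag_add {f g : Ω → ℝ} (hf : f ∈ 𝒜) (hg : g ∈ 𝒜) :
    ∀ᵐ x ∂μ, P.carreDiag μ (f + g) x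
      = P.carreDiag μ f x + 2 * P.carre μ f g x + P.carreDiag μ g x := by
  filter_upwards [hd.carre_add_right h (𝒜.add_mem hf hg) hf hg, hd.carre_add_right h hf hf hg,
    hd.carre_add_right h hg hf hg] with x h1 h2 h3
  rw [carreDiag, h1, carre_comm _ f, carre_comm _ g, h2, h3, carre_comm g f, carreDiag, carreDiag]
  ring

/-- Nonnegativity of `Γ(f + g)` and `Γ(f - g)`; this form of the Cauchy–Schwarz inequality suffices
for the linear majorants used for the series. -/
theorem abs_carre_le {f g : Ω → ℝ} (hf : f ∈ 𝒜) (hg : g ∈ 𝒜) :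
    ∀ᵐ x ∂μ, 2 * |P.carre μ f g x| ≤ P.carreDiag μ f x + P.carreDiag μ g x := by
  filter_upwards [hd.carreDiag_sub h hf hg, hd.carreDiag_add h hf hg,
    hd.carreDiag_nonneg h (𝒜.sub_mem hf hg), hd.carreDiag_nonneg h (𝒜.add_mem hf hg)]
    with x h1 h2 h3 h4
  rw [h1] at h3
  rw [h2] at h4
  have : |P.carre μ f g x| ≤ (P.carreDiag μ f x + P.carreDiag μ g x) / 2 :=
    abs_le.2 ⟨by linarith, by linarith⟩
  linarith

theorem carreDiag_sub_le {f g : Ω → ℝ} (hf : f ∈ 𝒜) (hg : g ∈ 𝒜) :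
    ∀ᵐ x ∂μ, P.carreDiag μ (f - g) x ≤ 2 * P.carreDiag μ f x + 2 * P.carreDiag μ g x := by
  filter_upwards [hd.carreDiag_sub h hf hg, hd.abs_carre_le h hf hg] with x h1 h2
  have := neg_abs_le (P.carre μ f g x)
  linarith

end IsDiffusion

end MarkovSemigroup

/-! ### The function `Υ` and bounds for sums against the rates. -/

section Upsilon

theorem contDiff_upsilon : ContDiff ℝ ∞ upsilon := by
  unfold upsilon
  exact (Real.contDiff_exp.sub contDiff_const).sub contDiff_id

theorem deriv_upsilon : deriv upsilon = fun r => Real.exp r - 1 := by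
  ext r
  have : HasDerivAt upsilon (Real.exp r - 0 - 1) r :=
    ((Real.hasDerivAt_exp r).sub (hasDerivAt_const r 1)).sub (hasDerivAt_id r)
  rw [this.deriv]
  ring

theorem deriv_deriv_upsilon : deriv (deriv upsilon) = Real.exp := by
  rw [deriv_upsilon]
  ext r
  simp

theorem upsilon_nonneg (r : ℝ) : 0 ≤ upsilon r := by
  have := Real.add_one_le_exp r
  unfold upsilon
  linarith

@[simp]
theorem upsilon_zero : upsilon 0 = 0 := by simp [upsilon]

theorem abs_upsilon_le {r C : ℝ} (h : |r| ≤ C) : |upsilon r| ≤ Real.exp C + C := by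
  rw [abs_of_nonneg (upsilon_nonneg r)]
  have := Real.exp_le_exp.2 ((le_abs_self r).trans h)
  have := neg_abs_le r
  unfold upsilon
  linarith

theorem abs_exp_sub_one_le {r C : ℝ} (h : |r| ≤ C) : |Real.exp r - 1| ≤ Real.exp C := by
  have h1 := Real.exp_le_exp.2 ((le_abs_self r).trans h)
  have h2 := Real.exp_pos r
  have h3 : 1 ≤ Real.exp C := Real.one_le_exp ((abs_nonneg r).trans h)
  exact abs_le.2 ⟨by linarith, by linarith⟩

end Upsilon

section Rates

variable {X : Type*}

theorem summable_of_summable_ne {f : X → ℝ} (i : X) (h : Summable fun j : {j // j ≠ i} => f j) :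
    Summable f := by
  have h1 : Summable (Set.indicator {j | j ≠ i} f) := summable_subtype_iff_indicator.1 h
  refine h1.congr_cofinite ?_
  filter_upwards [(Set.finite_singleton i).compl_mem_cofinite] with j hj
  exact Set.indicator_of_mem (s := {j | j ≠ i}) hj f

variable [MeasurableSpace X] {Q : MarkovSemigroup X} {k : X → X → ℝ} {μ : Measure X}

namespace IsReversibleChain

variable (hk : IsReversibleChain Q k μ)
include hk

theorem summable (i : X) : Summable (k i) := (hk.conservative i).summable

theorem summable_abs (i : X) : Summable fun j => |k i j| := (hk.summable i).abs

theorem diag (i : X) : k i i = -exitRate k i := by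
  classical
  have h1 := (hk.summable i).tsum_eq_add_tsum_ite i
  rw [(hk.conservative i).tsum_eq] at h1
  have h2 : exitRate k i = ∑' j, if j = i then 0 else k i j := by
    refine (tsum_subtype {j | j ≠ i} (k i)).trans (tsum_congr fun j => ?_)
    by_cases h : j = i <;> simp [h]
  linarith

theorem exitRate_nonneg (i : X) : 0 ≤ exitRate k i :=
  tsum_nonneg fun j => hk.nonneg _ _ j.2.symm

/-- The diagonal entry `-M₁(i)` has the same absolute value as the sum of all other entries, whence
the factor `2`. -/
theorem tsum_abs (i : X) : ∑' j, |k i j| = 2 * exitRate k i := by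
  classical
  have h1 := (hk.summable_abs i).tsum_eq_add_tsum_ite i
  have h2 : exitRate k i = ∑' j, if j = i then 0 else |k i j| := by
    refine (tsum_subtype {j | j ≠ i} (k i)).trans (tsum_congr fun j => ?_)
    by_cases h : j = i
    · simp [h]
    · simp [h, abs_of_nonneg (hk.nonneg i j (Ne.symm h))]
  rw [h1, ← h2, hk.diag, abs_neg, abs_of_nonneg (hk.exitRate_nonneg i)]
  ring

theorem abs_eq {i j : X} (h : j ≠ i) : |k i j| = k i j := abs_of_nonneg (hk.nonneg i j h.symm)

theorem summable_abs_mul {φ : X → ℝ} {i : X} (h : Summable fun j : {j // j ≠ i} => k i j * φ j) :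
    Summable fun j => |k i j| * φ j := by
  refine summable_of_summable_ne i (h.congr fun j => ?_)
  rw [hk.abs_eq j.2]

theorem summable_mul_exitRate (i : X) : Summable fun j => |k i j| * exitRate k j :=
  hk.summable_abs_mul (hk.summable_two i)

theorem summable_mul_of_bounded {a : X → ℝ} {C : ℝ} (h : ∀ j, |a j| ≤ C) (i : X) :
    Summable fun j => k i j * a j := by
  refine Summable.of_norm_bounded ((hk.summable_abs i).mul_right C) fun j => ?_
  rw [norm_mul, Real.norm_eq_abs, Real.norm_eq_abs]
  gcongr
  exact h j

theorem abs_tsum_le {a : X → ℝ} {C : ℝ} (h : ∀ j, |a j| ≤ C) (i : X) :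
    |∑' j, k i j * a j| ≤ 2 * exitRate k i * C := by
  rw [← hk.tsum_abs, ← tsum_mul_right, ← Real.norm_eq_abs]
  refine tsum_of_norm_bounded ((hk.summable_abs i).mul_right C).hasSum fun j => ?_
  rw [norm_mul, Real.norm_eq_abs, Real.norm_eq_abs]
  gcongr
  exact h j

end IsReversibleChain

end Rates

theorem toReal_eLpNorm_add_le {Ω : Type*} [MeasurableSpace Ω] {μ : Measure Ω} {f g : Ω → ℝ}
    (hf : MemLp f 2 μ) (hg : MemLp g 2 μ) :
    (eLpNorm (fun x => f x + g x) 2 μ).toReal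
      ≤ (eLpNorm f 2 μ).toReal + (eLpNorm g 2 μ).toReal := by
  rw [← ENNReal.toReal_add hf.2.ne hg.2.ne]
  exact ENNReal.toReal_mono (ENNReal.add_ne_top.2 ⟨hf.2.ne, hg.2.ne⟩)
    (eLpNorm_add_le hf.1 hg.1 (by norm_num))

theorem toReal_eLpNorm_abs {Ω : Type*} [MeasurableSpace Ω] {μ : Measure Ω} (f : Ω → ℝ) :
    (eLpNorm (fun x => |f x|) 2 μ).toReal = (eLpNorm f 2 μ).toReal := by
  congr 1
  exact eLpNorm_norm f

/-- The slice of `u` at the point `j` of the discrete space. -/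
abbrev slice {E X : Type*} (u : E × X → ℝ) (j : X) : E → ℝ := fun x => u (x, j)

/-! ### Exchange of the diffusion generator with sums over the rates. -/

namespace IsRegular

variable {E X : Type*} [MeasurableSpace E] [MeasurableSpace X]
  {P : MarkovSemigroup E} {μ : Measure E} {𝒜 : Subalgebra ℝ (E → ℝ)} {Q : MarkovSemigroup X}
  {k : X → X → ℝ} {ν : Measure X} {u : E × X → ℝ}

/-- A function in `L²(μ)` that controls the generator on functions of the slices of `u`
at `i` and `j`. -/
def majorant (P : MarkovSemigroup E) (μ : Measure E) (u : E × X → ℝ) (i j : X) (x : E) : ℝ :=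
  (|P.gen μ (slice u j) x| + |P.gen μ (slice u i) x|) +
    (|P.carreDiag μ (slice u j) x| + |P.carreDiag μ (slice u i) x|)

omit [MeasurableSpace X] in
theorem majorant_nonneg (i j : X) (x : E) : 0 ≤ majorant P μ u i j x := by
  unfold majorant
  positivity

variable (hu : IsRegular P μ 𝒜 k u) (hd : P.IsDiffusion μ 𝒜)
include hu

omit [MeasurableSpace X] in
theorem diff_mem (i j : X) : slice u j - slice u i ∈ 𝒜 :=
  𝒜.sub_mem (hu.slice_mem j) (hu.slice_mem i)

include hd

omit [MeasurableSpace X] in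
theorem memLp_majorant (i j : X) : MemLp (majorant P μ u i j) 2 μ := by
  have h1 : ∀ j, MemLp (P.gen μ (slice u j)) 2 μ := fun j => (hd.domain _ (hu.slice_mem j)).memLp_gen
  have h2 : ∀ j, MemLp (P.carreDiag μ (slice u j)) 2 μ := fun j =>
    hd.memLp_carre (hu.slice_mem j) (hu.slice_mem j)
  exact ((h1 j).abs.add (h1 i).abs).add ((h2 j).abs.add (h2 i).abs)

omit [MeasurableSpace X] in
theorem eLpNorm_majorant_le (i j : X) : (eLpNorm (majorant P μ u i j) 2 μ).toReal ≤
    ((eLpNorm (P.gen μ (slice u j)) 2 μ).toReal + (eLpNorm (P.gen μ (slice u i)) 2 μ).toReal) +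
    ((eLpNorm (P.carreDiag μ (slice u j)) 2 μ).toReal
      + (eLpNorm (P.carreDiag μ (slice u i)) 2 μ).toReal) := by
  have h1 : ∀ j, MemLp (fun x => |P.gen μ (slice u j) x|) 2 μ := fun j =>
    (hd.domain _ (hu.slice_mem j)).memLp_gen.abs
  have h2 : ∀ j, MemLp (fun x => |P.carreDiag μ (slice u j) x|) 2 μ := fun j =>
    (hd.memLp_carre (hu.slice_mem j) (hu.slice_mem j)).abs
  have e0 := toReal_eLpNorm_add_le ((h1 j).add (h1 i)) ((h2 j).add (h2 i))
  have e1 := toReal_eLpNorm_add_le (h1 j) (h1 i)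
  have e2 := toReal_eLpNorm_add_le (h2 j) (h2 i)
  rw [toReal_eLpNorm_abs, toReal_eLpNorm_abs] at e1 e2
  exact e0.trans (add_le_add e1 e2)

variable (hk : IsReversibleChain Q k ν)
include hk

/-- The parts depending on `j` are summable by regularity of `u`; those depending only on `i` are
constants against summable rates. -/
theorem summable_majorant (i : X) :
    Summable fun j => |k i j| * (eLpNorm (majorant P μ u i j) 2 μ).toReal := by
  have s1 : Summable fun j => |k i j| * (eLpNorm (P.gen μ (slice u j)) 2 μ).toReal :=
    hk.summable_abs_mul (hu.summable_gen i)
  have s2 : Summable fun j => |k i j| * (eLpNorm (P.carreDiag μ (slice u j)) 2 μ).toReal :=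
    hk.summable_abs_mul (hu.summable_carre i)
  have s3 := (hk.summable_abs i).mul_right (eLpNorm (P.gen μ (slice u i)) 2 μ).toReal
  have s4 := (hk.summable_abs i).mul_right (eLpNorm (P.carreDiag μ (slice u i)) 2 μ).toReal
  refine Summable.of_nonneg_of_le (fun j => mul_nonneg (abs_nonneg _) ENNReal.toReal_nonneg)
    (fun j => ?_) ((s1.add s3).add (s2.add s4))
  have := mul_le_mul_of_nonneg_left (hu.eLpNorm_majorant_le hd i j) (abs_nonneg (k i j))
  simp only [mul_add] at this
  exact this

variable [Countable X]

theorem ae_summable_majorant (i : X) :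
    ∀ᵐ x ∂μ, Summable fun j => |k i j| * majorant P μ u i j x := by
  filter_upwards [ae_summable_of_summable_eLpNorm (hu.memLp_majorant hd i)
    (hu.summable_majorant hd hk i)] with x hx
  refine hx.congr fun j => ?_
  rw [abs_mul, abs_of_nonneg (majorant_nonneg i j x)]

theorem ae_summable_carreDiag (i : X) :
    ∀ᵐ x ∂μ, Summable fun j => k i j * P.carreDiag μ (slice u j) x := by
  filter_upwards [hu.ae_summable_majorant hd hk i] with x hx
  refine Summable.of_norm_bounded hx fun j => ?_
  rw [norm_mul, Real.norm_eq_abs, Real.norm_eq_abs]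
  gcongr
  unfold majorant
  have := abs_nonneg (P.gen μ (slice u j) x)
  have := abs_nonneg (P.gen μ (slice u i) x)
  have := abs_nonneg (P.carreDiag μ (slice u i) x)
  linarith

theorem ae_summable_gen (i : X) :
    ∀ᵐ x ∂μ, Summable fun j => k i j * P.gen μ (slice u j) x := by
  filter_upwards [hu.ae_summable_majorant hd hk i] with x hx
  refine Summable.of_norm_bounded hx fun j => ?_
  rw [norm_mul, Real.norm_eq_abs, Real.norm_eq_abs]
  gcongr
  unfold majorant
  have := abs_nonneg (P.carreDiag μ (slice u j) x)
  have := abs_nonneg (P.gen μ (slice u i) x)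
  have := abs_nonneg (P.carreDiag μ (slice u i) x)
  linarith

variable [IsProbabilityMeasure μ] (h : P.IsReversible μ)
include h

/-- The common form of the three exchanges needed below: functions of `u_i` and `u_j` that are
bounded uniformly in `j` and whose generators are dominated by the majorant. -/
theorem hasGen_tsum {φ : X → E → ℝ} {C K : ℝ} (i : X) (hφ : ∀ j, φ j ∈ 𝒜)
    (hC : ∀ j x, |φ j x| ≤ C)
    (hK : ∀ j, ∀ᵐ x ∂μ, |P.gen μ (φ j) x| ≤ K * majorant P μ u i j x) :
    P.HasGen μ (fun x => ∑' j, k i j * φ j x) (fun x => ∑' j, k i j * P.gen μ (φ j) x) ∧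
      ∀ᵐ x ∂μ, Summable fun j => k i j * P.gen μ (φ j) x := by
  constructor
  · refine h.hasGen_tsum_of_bound (b := fun j x => K * majorant P μ u i j x) (hk.summable i)
      (fun j => (hd.domain _ (hφ j)).hasGen) hC
      (fun j => (hu.memLp_majorant hd i j).const_mul K) hK ?_
    refine ((hu.summable_majorant hd hk i).mul_left |K|).congr fun j => ?_
    rw [toReal_eLpNorm_const_mul]
    ring
  · filter_upwards [hu.ae_summable_majorant hd hk i, ae_all_iff.2 hK] with x hx hx'
    refine Summable.of_norm_bounded (hx.mul_left K) fun j => ?_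
    rw [norm_mul, Real.norm_eq_abs, Real.norm_eq_abs]
    calc |k i j| * |P.gen μ (φ j) x| ≤ |k i j| * (K * majorant P μ u i j x) := by
          gcongr
          exact hx' j
      _ = _ := by ring

omit hk [Countable X] [MeasurableSpace X] in
-- Follows from the chain rule, since the difference of two slices takes values in `[-2C, 2C]`. The
-- factor `2` comes from `Γ(f - g) ≤ 2 Γ(f) + 2 Γ(g)`.
theorem abs_gen_comp_le {H : ℝ → ℝ} (hH : ContDiff ℝ ∞ H) {C K : ℝ} (hC : ∀ z, |u z| ≤ C)
    (hH1 : ∀ r, |r| ≤ 2 * C → |deriv H r| ≤ K) (hH2 : ∀ r, |r| ≤ 2 * C → |deriv (deriv H) r| ≤ K)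
    (i j : X) :
    ∀ᵐ x ∂μ, |P.gen μ (H ∘ (slice u j - slice u i)) x| ≤ 2 * K * majorant P μ u i j x := by
  filter_upwards [hd.chain _ (hu.diff_mem i j) H hH,
    hd.gen_sub h (hu.slice_mem j) (hu.slice_mem i),
    hd.carreDiag_sub_le h (hu.slice_mem j) (hu.slice_mem i),
    hd.carreDiag_nonneg h (hu.diff_mem i j)] with x h1 h2 h3 h4
  have hr : |(slice u j - slice u i) x| ≤ 2 * C := by
    have := abs_sub (u (x, j)) (u (x, i))
    have := hC (x, j)
    have := hC (x, i)
    simp only [Pi.sub_apply]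
    linarith
  have k1 := hH1 _ hr
  have k2 := hH2 _ hr
  have hK : 0 ≤ K := (abs_nonneg _).trans k1
  rw [h1, h2]
  refine (abs_add_le _ _).trans ?_
  rw [abs_mul, abs_mul, abs_of_nonneg h4]
  have e1 : |P.gen μ (slice u j) x - P.gen μ (slice u i) x|
      ≤ |P.gen μ (slice u j) x| + |P.gen μ (slice u i) x| := abs_sub _ _
  have e2 := le_abs_self (P.carreDiag μ (slice u j) x)
  have e3 := le_abs_self (P.carreDiag μ (slice u i) x)
  calc _ ≤ K * (|P.gen μ (slice u j) x| + |P.gen μ (slice u i) x|)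
        + K * (2 * |P.carreDiag μ (slice u j) x| + 2 * |P.carreDiag μ (slice u i) x|) := by
        gcongr
        linarith
    _ ≤ _ := by
        unfold majorant
        have := mul_nonneg hK (add_nonneg (abs_nonneg (P.gen μ (slice u j) x))
          (abs_nonneg (P.gen μ (slice u i) x)))
        linarith

theorem hasGen_discPsi (i : X) :
    P.HasGen μ (fun x => discPsi k upsilon (fun j => u (x, j)) i)
      (fun x => ∑' j, k i j * P.gen μ (upsilon ∘ (slice u j - slice u i)) x) ∧
    ∀ᵐ x ∂μ, Summable fun j => k i j * P.gen μ (upsilon ∘ (slice u j - slice u i)) x := by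
  obtain ⟨C, hC⟩ := hu.bounded
  -- On `[-2C, 2C]` both `|Υ'|` and `Υ''` are at most `e^{2C}`, which gives the constant `K`.
  refine hu.hasGen_tsum hd hk h (φ := fun j => upsilon ∘ (slice u j - slice u i))
    (C := Real.exp (2 * C) + 2 * C) (K := 2 * Real.exp (2 * C)) i
    (fun j => hd.comp _ (hu.diff_mem i j) _ contDiff_upsilon) (fun j x => ?_) (fun j => ?_)
  · refine abs_upsilon_le ?_
    have := abs_sub (u (x, j)) (u (x, i))
    have := hC (x, j)
    have := hC (x, i)
    simp only [Pi.sub_apply]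
    linarith
  · refine hu.abs_gen_comp_le hd h contDiff_upsilon hC (fun r hr => ?_) (fun r hr => ?_) i j
    · rw [deriv_upsilon]
      exact abs_exp_sub_one_le hr
    · rw [deriv_deriv_upsilon, Real.abs_exp]
      exact Real.exp_le_exp.2 ((le_abs_self r).trans hr)

theorem hasGen_discGen (i : X) :
    P.HasGen μ (fun x => discGen k (fun j => u (x, j)) i)
      (fun x => ∑' j, k i j * P.gen μ (slice u j - slice u i) x) ∧
    ∀ᵐ x ∂μ, Summable fun j => k i j * P.gen μ (slice u j - slice u i) x := by
  obtain ⟨C, hC⟩ := hu.bounded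
  refine hu.hasGen_tsum hd hk h (φ := fun j => slice u j - slice u i)
    (C := 2 * C) (K := 2 * 1) i (fun j => hu.diff_mem i j) (fun j x => ?_) (fun j => ?_)
  · have := abs_sub (u (x, j)) (u (x, i))
    have := hC (x, j)
    have := hC (x, i)
    simp only [Pi.sub_apply]
    linarith
  · refine hu.abs_gen_comp_le hd h contDiff_id hC (fun r hr => ?_) (fun r hr => ?_) i j
    · simp
    · simp

theorem hasGen_mul_discGen (i : X) :
    P.HasGen μ (slice u i * fun x => discGen k (fun j => u (x, j)) i)
      (fun x => ∑' j, k i j * P.gen μ (slice u i * (slice u j - slice u i)) x) ∧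
    ∀ᵐ x ∂μ, Summable fun j => k i j * P.gen μ (slice u i * (slice u j - slice u i)) x := by
  obtain ⟨C, hC⟩ := hu.bounded
  -- With `w = u_j - u_i`, `L(u_i w) = u_i L w + w L u_i + 2 Γ(u_i, w)`. The first two terms
  -- contribute at most `C |L u_j| + 3C |L u_i|`, the last at most `2 Γ(u_j) + 3 Γ(u_i)`; hence `3C
  -- + 3`.
  have key := hu.hasGen_tsum hd hk h (φ := fun j => slice u i * (slice u j - slice u i))
    (C := C * (2 * C)) (K := 3 * C + 3) i
    (fun j => 𝒜.mul_mem (hu.slice_mem i) (hu.diff_mem i j)) (fun j x => ?_) (fun j => ?_)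
  · refine ⟨?_, key.2⟩
    convert key.1 using 2 with x
    simp only [Pi.mul_apply, Pi.sub_apply, discGen]
    rw [← tsum_mul_left]
    exact tsum_congr fun j => by ring
  · have h1 := abs_sub (u (x, j)) (u (x, i))
    have h2 := hC (x, j)
    have h3 := hC (x, i)
    have h4 : 0 ≤ C := (abs_nonneg _).trans h3
    simp only [Pi.mul_apply, Pi.sub_apply, abs_mul]
    gcongr
    linarith
  · filter_upwards [hd.gen_sub h (hu.slice_mem j) (hu.slice_mem i),
      hd.abs_carre_le h (hu.slice_mem i) (hu.diff_mem i j),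
      hd.carreDiag_sub_le h (hu.slice_mem j) (hu.slice_mem i),
      hd.carreDiag_nonneg h (hu.slice_mem i)] with x h1 h2 h3 h4
    rw [MarkovSemigroup.gen_mul, h1]
    have c2 := hC (x, j)
    have c3 := hC (x, i)
    have c1 : |(slice u j - slice u i) x| ≤ 2 * C := by
      have := abs_sub (u (x, j)) (u (x, i))
      simp only [Pi.sub_apply]
      linarith
    have hC0 : 0 ≤ C := (abs_nonneg _).trans c3
    have e1 : |P.gen μ (slice u j) x - P.gen μ (slice u i) x|
        ≤ |P.gen μ (slice u j) x| + |P.gen μ (slice u i) x| := abs_sub _ _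
    have e2 := le_abs_self (P.carreDiag μ (slice u j) x)
    have e3 := le_abs_self (P.carreDiag μ (slice u i) x)
    have e4 := abs_nonneg (P.gen μ (slice u j) x)
    have e5 := abs_nonneg (P.gen μ (slice u i) x)
    have e6 := abs_nonneg (P.carreDiag μ (slice u j) x)
    have e7 := abs_nonneg (P.carreDiag μ (slice u i) x)
    refine (abs_add_three _ _ _).trans ?_
    rw [abs_mul, abs_mul, abs_mul, abs_two]
    calc _ ≤ C * (|P.gen μ (slice u j) x| + |P.gen μ (slice u i) x|)
          + 2 * C * |P.gen μ (slice u i) x|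
          + (2 * |P.carreDiag μ (slice u j) x| + 3 * |P.carreDiag μ (slice u i) x|) := by
          gcongr
          linarith
      _ ≤ (3 * C + 3) * majorant P μ u i j x := by
          unfold majorant
          have := mul_nonneg hC0 e4
          have := mul_nonneg hC0 e6
          have := mul_nonneg hC0 e7
          nlinarith

/-- `u(·,i)` is in the domain after application of `Γ ⊕ Ψ_Υ`. -/
theorem inDomain_hybridGamma (i : X) : P.InDomain μ (slice (hybridGamma P μ k u) i) :=
  (h.hasGen_add (hu.slice_two i).carre_mem.hasGen (hu.hasGen_discPsi hd hk h i).1).inDomain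

theorem inDomain_hybridGen (i : X) : P.InDomain μ (slice (hybridGen P μ k u) i) :=
  (h.hasGen_add (hu.slice_two i).gen_mem.hasGen (hu.hasGen_discGen hd hk h i).1).inDomain

theorem inDomain_mul_hybridGen (i : X) :
    P.InDomain μ (slice u i * slice (hybridGen P μ k u) i) := by
  have e : slice u i * slice (hybridGen P μ k u) i = slice u i * P.gen μ (slice u i)
      + slice u i * fun x => discGen k (fun j => u (x, j)) i := by
    rw [← mul_add]
    rfl
  rw [e]
  exact (h.hasGen_add (hu.slice_two i).mul_gen_mem.hasGen
    (hu.hasGen_mul_discGen hd hk h i).1).inDomain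

theorem gen_hybridGamma (i : X) : ∀ᵐ x ∂μ, P.gen μ (slice (hybridGamma P μ k u) i) x
    = P.gen μ (P.carreDiag μ (slice u i)) x
      + ∑' j, k i j * P.gen μ (upsilon ∘ (slice u j - slice u i)) x :=
  h.gen_eq (h.hasGen_add (hu.slice_two i).carre_mem.hasGen (hu.hasGen_discPsi hd hk h i).1)

/-- `Γ(u_i, ·)` is built from the generator of a function and of its product with `u_i`, and the
exchange with the sum is available for both. The third ingredient, `∑_j k(i,j) w_j L u_i`, has a
bounded `w_j`. -/
theorem carre_hybridGen (i : X) : ∀ᵐ x ∂μ, P.carre μ (slice u i) (slice (hybridGen P μ k u) i) x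
    = P.carre μ (slice u i) (P.gen μ (slice u i)) x
      + ∑' j, k i j * P.carre μ (slice u i) (slice u j - slice u i) x := by
  have d1 := hu.hasGen_discGen hd hk h i
  have d2 := hu.hasGen_mul_discGen hd hk h i
  filter_upwards [h.carre_add_right (hu.slice_two i).gen_mem d1.1.inDomain
    (hu.slice_two i).mul_gen_mem d2.1.inDomain, h.gen_eq d1.1, h.gen_eq d2.1, d1.2, d2.2]
    with x h1 h2 h3 s1 s2
  have hs : Summable fun j => k i j * (slice u j - slice u i) x := by
    obtain ⟨C, hC⟩ := hu.bounded
    refine hk.summable_mul_of_bounded (C := C + C) (fun j => ?_) i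
    exact (abs_sub _ _).trans (add_le_add (hC _) (hC _))
  refine h1.trans ?_
  congr 1
  have e : ∀ j, k i j * P.carre μ (slice u i) (slice u j - slice u i) x
      = (k i j * P.gen μ (slice u i * (slice u j - slice u i)) x
        - slice u i x * (k i j * P.gen μ (slice u j - slice u i) x)
        - P.gen μ (slice u i) x * (k i j * (slice u j - slice u i) x)) * 2⁻¹ := by
    intro j
    rw [MarkovSemigroup.carre]
    ring
  rw [tsum_congr e, tsum_mul_right, Summable.tsum_sub (s2.sub (s1.mul_left _)) (hs.mul_left _),
    Summable.tsum_sub s2 (s1.mul_left _), tsum_mul_left, tsum_mul_left, MarkovSemigroup.carre, h2, h3,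
    discGen, div_eq_mul_inv]
  simp only [Pi.sub_apply]
  ring

end IsRegular

/-! ### Pointwise comparison of the iterated operators. -/

section ProductMeasure

variable {E X : Type*} [MeasurableSpace E] [MeasurableSpace X] [Countable X]
  {μ : Measure E} {ν : Measure X} [SFinite μ] [SFinite ν] {p : E × X → Prop}

omit [SFinite μ] in
theorem ae_prod_of_forall_slice (h : ∀ i, ∀ᵐ x ∂μ, p (x, i)) : ∀ᵐ z ∂(μ.prod ν), p z := by
  have h1 : {z | ¬ p z} ⊆ ⋃ i : X, {x | ¬ p (x, i)} ×ˢ (Set.univ : Set X) := by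
    rintro ⟨x, i⟩ hz
    exact Set.mem_iUnion.2 ⟨i, hz, Set.mem_univ _⟩
  refine measure_mono_null h1 (measure_iUnion_null fun i => ?_)
  rw [Measure.prod_prod, show μ {x | ¬ p (x, i)} = 0 from h i, zero_mul]

omit [Countable X] [SFinite μ] in
theorem ae_slice_of_ae_prod (h : ∀ᵐ z ∂(μ.prod ν), p z) {i : X} (hi : ν {i} ≠ 0) :
    ∀ᵐ x ∂μ, p (x, i) := by
  have h1 : {x | ¬ p (x, i)} ×ˢ {i} ⊆ {z | ¬ p z} := by
    rintro ⟨x, j⟩ ⟨hx, hj⟩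
    rw [Set.mem_singleton_iff] at hj
    subst hj
    exact hx
  have h2 : (μ.prod ν) ({x | ¬ p (x, i)} ×ˢ {i}) = 0 := measure_mono_null h1 h
  rw [Measure.prod_prod] at h2
  exact (mul_eq_zero.1 h2).resolve_right hi

end ProductMeasure

section Unfold

variable {E X : Type*} [MeasurableSpace E] (P : MarkovSemigroup E) (μ : Measure E)
  (k : X → X → ℝ) (u : E × X → ℝ) (x : E) (i : X)

theorem hybridGen_apply : hybridGen P μ k u (x, i)
    = P.gen μ (slice u i) x + discGen k (fun j => u (x, j)) i := rfl

theorem hybridGamma_apply : hybridGamma P μ k u (x, i)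
    = P.carreDiag μ (slice u i) x + discPsi k upsilon (fun j => u (x, j)) i := rfl

theorem sumOfTwos_apply : sumOfTwos P μ k u (x, i)
    = (P.gen μ (P.carreDiag μ (slice u i)) x
        - 2 * P.carre μ (slice u i) (P.gen μ (slice u i)) x) / 2
      + (discGen k (discPsi k upsilon fun j => u (x, j)) i
        - discB k (deriv upsilon) (fun j => u (x, j)) (discGen k fun j => u (x, j)) i) / 2 := rfl

theorem hybridTwo_apply : hybridTwo P μ k u (x, i)
    = (P.gen μ (slice (hybridGamma P μ k u) i) x + discGen k (fun j => hybridGamma P μ k u (x, j)) i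
        - 2 * P.carre μ (slice u i) (slice (hybridGen P μ k u) i) x
        - discB k (deriv upsilon) (fun j => u (x, j)) (fun j => hybridGen P μ k u (x, j)) i) / 2 :=
  rfl

end Unfold

namespace IsReversibleChain

variable {X : Type*} [MeasurableSpace X] {Q : MarkovSemigroup X} {k : X → X → ℝ} {ν : Measure X}
  (hk : IsReversibleChain Q k ν)
include hk

/-- `Ψ_Υ(u)` and `L_d u` are bounded only by multiples of `M₁`, so applying the chain's operators to
them uses the finiteness of `∑_j k(i,j) M₁(j)`. -/
theorem summable_mul_of_exitRate_bound {a : X → ℝ} {C : ℝ} (h : ∀ j, |a j| ≤ 2 * exitRate k j * C)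
    (i : X) : Summable fun j => k i j * a j := by
  refine Summable.of_norm_bounded ((hk.summable_mul_exitRate i).mul_left (2 * C)) fun j => ?_
  rw [norm_mul, Real.norm_eq_abs, Real.norm_eq_abs]
  calc |k i j| * |a j| ≤ |k i j| * (2 * exitRate k j * C) := by gcongr; exact h j
    _ = _ := by ring

theorem abs_discPsi_le {a : X → ℝ} {C : ℝ} (h : ∀ j, |a j| ≤ C) (i : X) :
    |discPsi k upsilon a i| ≤ 2 * exitRate k i * (Real.exp (C + C) + (C + C)) :=
  hk.abs_tsum_le (fun j => abs_upsilon_le ((abs_sub _ _).trans (add_le_add (h j) (h i)))) i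

theorem abs_discGen_le {a : X → ℝ} {C : ℝ} (h : ∀ j, |a j| ≤ C) (i : X) :
    |discGen k a i| ≤ 2 * exitRate k i * (C + C) :=
  hk.abs_tsum_le (fun j => (abs_sub _ _).trans (add_le_add (h j) (h i))) i

theorem discGen_add {a b : X → ℝ} {i : X} (ha : Summable fun j => k i j * a j)
    (hb : Summable fun j => k i j * b j) :
    discGen k (fun j => a j + b j) i = discGen k a i + discGen k b i := by
  have h1 : ∀ {a : X → ℝ}, Summable (fun j => k i j * a j) →
      Summable fun j => k i j * (a j - a i) := fun {a} h =>
    (h.sub ((hk.summable i).mul_right (a i))).congr fun j => by ring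
  rw [discGen, discGen, discGen, ← Summable.tsum_add (h1 ha) (h1 hb)]
  exact tsum_congr fun j => by ring

theorem summable_discB {u a : X → ℝ} {H : ℝ → ℝ} {C : ℝ} (hH : ∀ i j, |H (u j - u i)| ≤ C) {i : X}
    (ha : Summable fun j => k i j * a j) :
    Summable fun j => k i j * H (u j - u i) * (a j - a i) := by
  refine Summable.of_norm_bounded
    ((ha.abs.mul_right C).add ((hk.summable_abs i).mul_right (C * |a i|))) fun j => ?_
  rw [norm_mul, norm_mul, Real.norm_eq_abs, Real.norm_eq_abs, Real.norm_eq_abs, abs_mul]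
  have h1 := hH i j
  have h2 := abs_sub (a j) (a i)
  calc |k i j| * |H (u j - u i)| * |a j - a i| ≤ |k i j| * C * (|a j| + |a i|) := by
        gcongr
        exact mul_nonneg (abs_nonneg _) ((abs_nonneg _).trans h1)
    _ = _ := by ring

theorem discB_add {u a b : X → ℝ} {H : ℝ → ℝ} {C : ℝ} (hH : ∀ i j, |H (u j - u i)| ≤ C) {i : X}
    (ha : Summable fun j => k i j * a j) (hb : Summable fun j => k i j * b j) :
    discB k H u (fun j => a j + b j) i = discB k H u a i + discB k H u b i := by
  rw [discB, discB, discB, ← Summable.tsum_add (hk.summable_discB hH ha) (hk.summable_discB hH hb)]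
  exact tsum_congr fun j => by ring

end IsReversibleChain

namespace IsRegular

variable {E X : Type*} [MeasurableSpace E] [MeasurableSpace X] [Countable X]
  {P : MarkovSemigroup E} {μ : Measure E} {𝒜 : Subalgebra ℝ (E → ℝ)} {Q : MarkovSemigroup X}
  {k : X → X → ℝ} {ν : Measure X} {u : E × X → ℝ} [IsProbabilityMeasure μ]
  (hu : IsRegular P μ 𝒜 k u) (hd : P.IsDiffusion μ 𝒜) (hk : IsReversibleChain Q k ν)
  (h : P.IsReversible μ)
include hu hd hk h

/-- The pure terms of both sides agree. What remains is a series of mixed terms, which the chain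
rule turns into `∑_j k(i,j) (e^{w_j} + 1) Γ(w_j)` with `w_j = u_j - u_i`. -/
theorem sumOfTwos_le_hybridTwo_slice (i : X) :
    ∀ᵐ x ∂μ, sumOfTwos P μ k u (x, i) ≤ hybridTwo P μ k u (x, i) := by
  obtain ⟨C, hC⟩ := hu.bounded
  have hw : ∀ x i j, |u (x, j) - u (x, i)| ≤ C + C := fun x i j =>
    (abs_sub _ _).trans (add_le_add (hC _) (hC _))
  filter_upwards [hu.gen_hybridGamma hd hk h i, hu.carre_hybridGen hd hk h i,
    (hu.hasGen_discPsi hd hk h i).2, hu.ae_summable_carreDiag hd hk i, hu.ae_summable_gen hd hk i,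
    ae_all_iff.2 fun j => hd.chain _ (hu.diff_mem i j) upsilon contDiff_upsilon,
    ae_all_iff.2 fun j => hd.gen_sub h (hu.slice_mem j) (hu.slice_mem i),
    ae_all_iff.2 fun j => hd.carreDiag_sub h (hu.slice_mem j) (hu.slice_mem i),
    ae_all_iff.2 fun j => hd.carre_sub_right h (hu.slice_mem i) (hu.slice_mem j) (hu.slice_mem i),
    ae_all_iff.2 fun j => hd.carreDiag_nonneg h (hu.diff_mem i j),
    ae_all_iff.2 fun j => hd.carreDiag_sub_le h (hu.slice_mem j) (hu.slice_mem i)]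
    with x g1 g2 s1 s2 s3 c1 c2 c3 c4 c5 c6
  have hΨ : Summable fun j => k i j * discPsi k upsilon (fun l => u (x, l)) j :=
    hk.summable_mul_of_exitRate_bound (fun j => hk.abs_discPsi_le (fun l => hC (x, l)) j) i
  have hD : Summable fun j => k i j * discGen k (fun l => u (x, l)) j :=
    hk.summable_mul_of_exitRate_bound (fun j => hk.abs_discGen_le (fun l => hC (x, l)) j) i
  have hΥ : ∀ i j, |deriv upsilon ((fun l => u (x, l)) j - (fun l => u (x, l)) i)|
      ≤ Real.exp (C + C) := fun i j => by
    rw [deriv_upsilon]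
    exact abs_exp_sub_one_le (hw x i j)
  have sB := hk.summable_discB hΥ s3
  have sΓ : Summable fun j => k i j * (P.carreDiag μ (slice u j) x - P.carreDiag μ (slice u i) x) :=
    (s2.sub ((hk.summable i).mul_right (P.carreDiag μ (slice u i) x))).congr fun j => by ring
  have sw : Summable fun j => k i j * P.carreDiag μ (slice u j - slice u i) x := by
    refine Summable.of_norm_bounded ((s2.abs.mul_left 2).add
      ((hk.summable_abs i).mul_right (2 * |P.carreDiag μ (slice u i) x|))) fun j => ?_
    rw [norm_mul, Real.norm_eq_abs, Real.norm_eq_abs, abs_of_nonneg (c5 j), abs_mul]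
    have e2 := le_abs_self (P.carreDiag μ (slice u j) x)
    have e3 := le_abs_self (P.carreDiag μ (slice u i) x)
    calc |k i j| * P.carreDiag μ (slice u j - slice u i) x
        ≤ |k i j| * (2 * |P.carreDiag μ (slice u j) x| + 2 * |P.carreDiag μ (slice u i) x|) := by
          gcongr
          linarith [c6 j]
      _ = _ := by ring
  -- Polarisation: `2 Γ(u_i, w) = Γ(u_j) - Γ(u_i) - Γ(w)` for `w = u_j - u_i`.
  have s4 : Summable fun j => k i j * P.carre μ (slice u i) (slice u j - slice u i) x := by
    refine ((sΓ.sub sw).mul_right 2⁻¹).congr fun j => ?_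
    rw [c4 j, c3 j, MarkovSemigroup.carre_comm (slice u j), MarkovSemigroup.carreDiag]
    simp only [MarkovSemigroup.carreDiag]
    ring
  -- Twice the difference of the two sides. All four series converge, so they can be merged and the
  -- sign read off termwise.
  have key : 0 ≤ (∑' j, k i j * P.gen μ (upsilon ∘ (slice u j - slice u i)) x)
      + discGen k (fun j => P.carreDiag μ (slice u j) x) i
      - 2 * (∑' j, k i j * P.carre μ (slice u i) (slice u j - slice u i) x)
      - discB k (deriv upsilon) (fun l => u (x, l)) (fun j => P.gen μ (slice u j) x) i := by
    rw [discGen, discB, ← tsum_mul_left, ← Summable.tsum_add s1 sΓ,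
      ← Summable.tsum_sub (s1.add sΓ) (s4.mul_left 2),
      ← Summable.tsum_sub ((s1.add sΓ).sub (s4.mul_left 2)) sB]
    refine tsum_nonneg fun j => ?_
    have e : k i j * P.gen μ (upsilon ∘ (slice u j - slice u i)) x
        + k i j * (P.carreDiag μ (slice u j) x - P.carreDiag μ (slice u i) x)
        - 2 * (k i j * P.carre μ (slice u i) (slice u j - slice u i) x)
        - k i j * deriv upsilon (u (x, j) - u (x, i))
          * (P.gen μ (slice u j) x - P.gen μ (slice u i) x)
        = k i j * ((Real.exp (u (x, j) - u (x, i)) + 1)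
          * P.carreDiag μ (slice u j - slice u i) x) := by
      rw [c1 j, c2 j, c4 j, c3 j, deriv_deriv_upsilon, MarkovSemigroup.carre_comm (slice u j)]
      simp only [MarkovSemigroup.carreDiag, Pi.sub_apply]
      ring
    rw [e]
    -- The diagonal rate is negative, but there `w = 0` and the term vanishes.
    rcases eq_or_ne j i with rfl | hj
    · have : P.carreDiag μ (slice u j - slice u j) x = 0 := by
        rw [c3 j]
        simp only [MarkovSemigroup.carreDiag]
        ring
      rw [this]
      simp
    · exact mul_nonneg (hk.nonneg i j hj.symm) (mul_nonneg (by positivity) (c5 j))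
  rw [sumOfTwos_apply, hybridTwo_apply, g1, g2]
  simp only [hybridGamma_apply, hybridGen_apply]
  rw [hk.discGen_add s2 hΨ, hk.discB_add hΥ s3 hD]
  linarith

theorem sumOfTwos_le_hybridTwo [SFinite ν] :
    ∀ᵐ z ∂(μ.prod ν), sumOfTwos P μ k u z ≤ hybridTwo P μ k u z :=
  ae_prod_of_forall_slice (hu.sumOfTwos_le_hybridTwo_slice hd hk h)

/-- The curvature conditions of both components bound `(Γ ⊕ Ψ_Υ)₂` from below. -/
theorem mul_hybridGamma_le_hybridTwo [SFinite ν] {κc κd : ℝ} (hκc : P.CD μ 𝒜 κc)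
    (hκd : CDUpsilon k κd) :
    ∀ᵐ z ∂(μ.prod ν), min κc κd * hybridGamma P μ k u z ≤ hybridTwo P μ k u z := by
  obtain ⟨C, hC⟩ := hu.bounded
  refine ae_prod_of_forall_slice fun i => ?_
  filter_upwards [hu.sumOfTwos_le_hybridTwo_slice hd hk h i, hκc _ (hu.slice_mem i) (hu.slice_two i),
    hd.carreDiag_nonneg h (hu.slice_mem i)] with x h1 h2 h3
  refine le_trans ?_ h1
  have h4 := hκd (fun j => u (x, j)) ⟨C, fun j => hC _⟩ i
  have h5 : 0 ≤ discPsi k upsilon (fun j => u (x, j)) i := by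
    refine tsum_nonneg fun j => ?_
    rcases eq_or_ne j i with rfl | hj
    · simp
    · exact mul_nonneg (hk.nonneg i j hj.symm) (upsilon_nonneg _)
  rw [hybridGamma_apply, mul_add]
  exact add_le_add ((mul_le_mul_of_nonneg_right (min_le_left _ _) h3).trans h2)
    ((mul_le_mul_of_nonneg_right (min_le_right _ _) h5).trans h4)

theorem hybridGamma_nonneg [SFinite ν] : ∀ᵐ z ∂(μ.prod ν), 0 ≤ hybridGamma P μ k u z := by
  refine ae_prod_of_forall_slice fun i => ?_
  filter_upwards [hd.carreDiag_nonneg h (hu.slice_mem i)] with x h3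
  rw [hybridGamma_apply]
  refine add_nonneg h3 (tsum_nonneg fun j => ?_)
  rcases eq_or_ne j i with rfl | hj
  · simp
  · exact mul_nonneg (hk.nonneg i j hj.symm) (upsilon_nonneg _)

end IsRegular

/-! ### The generator of the product process. -/

section Slices

variable {E X : Type*} [MeasurableSpace E] [MeasurableSpace X]
  {μ : Measure E} {ν : Measure X} [SFinite μ] [SFinite ν]

omit [SFinite μ] in
-- Each point of the chain is an atom of positive mass, so a slice carries at most `1/ν{i}` times
-- the product measure. Slices therefore inherit integrability for every `i`, not only for almost
-- every one.
theorem map_slice_le (i : X) (hi : ν {i} ≠ 0) (hi' : ν {i} ≠ ⊤) :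
    μ.map (fun x => (x, i)) ≤ (ν {i})⁻¹ • μ.prod ν := by
  have hm : Measurable fun x : E => (x, i) := measurable_prodMk_right
  refine Measure.le_iff.2 fun S hS => ?_
  rw [Measure.map_apply hm hS, Measure.smul_apply, smul_eq_mul]
  have h1 : ((fun x : E => (x, i)) ⁻¹' S) ×ˢ {i} ⊆ S := by
    rintro ⟨x, j⟩ ⟨hx, hj⟩
    rw [Set.mem_singleton_iff] at hj
    subst hj
    exact hx
  calc μ ((fun x : E => (x, i)) ⁻¹' S)
      = (ν {i})⁻¹ * (μ ((fun x : E => (x, i)) ⁻¹' S) * ν {i}) := by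
        rw [mul_comm (μ _), ← mul_assoc, ENNReal.inv_mul_cancel hi hi', one_mul]
    _ ≤ _ := by
        rw [← Measure.prod_prod]
        gcongr

omit [SFinite μ] in
theorem memLp_slice {f : E × X → ℝ} {p : ℝ≥0∞} (hf : MemLp f p (μ.prod ν)) {i : X}
    (hi : ν {i} ≠ 0) (hi' : ν {i} ≠ ⊤) : MemLp (slice f i) p μ := by
  have hm : Measurable fun x : E => (x, i) := measurable_prodMk_right
  have h1 := hf.of_measure_le_smul (ENNReal.inv_ne_top.2 hi) (map_slice_le (μ := μ) i hi hi')
  exact (memLp_map_measure_iff h1.1 hm.aemeasurable).1 h1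

omit [SFinite μ] in
theorem integrable_slice {f : E × X → ℝ} (hf : Integrable f (μ.prod ν)) {i : X}
    (hi : ν {i} ≠ 0) (hi' : ν {i} ≠ ⊤) : Integrable (slice f i) μ :=
  memLp_one_iff_integrable.1 (memLp_slice (memLp_one_iff_integrable.2 hf) hi hi')

theorem setIntegral_prod_singleton [MeasurableSingletonClass X] {f : E × X → ℝ}
    (hf : Integrable f (μ.prod ν)) (A : Set E) (i : X) : ∫ z in A ×ˢ {i}, f z ∂(μ.prod ν) = ν.real {i} * ∫ x in A, f (x, i) ∂μ := by
  rw [setIntegral_prod f hf.integrableOn]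
  simp_rw [integral_singleton]
  rw [← integral_const_mul]
  rfl

end Slices

theorem MarkovSemigroup.HasGen.tendsto_setIntegral {Ω : Type*} [MeasurableSpace Ω]
    {P : MarkovSemigroup Ω} {μ : Measure Ω} [IsProbabilityMeasure μ] (h : P.IsReversible μ)
    {f g : Ω → ℝ} (hf : P.HasGen μ f g) (A : Set Ω) :
    Tendsto (fun t : ℝ≥0 => ∫ x in A, (t : ℝ)⁻¹ * (P.act t f x - f x) ∂μ) (𝓝[>] 0)
      (𝓝 (∫ x in A, g x ∂μ)) := by
  have h1 : ∀ t : ℝ≥0, MemLp (fun x => (t : ℝ)⁻¹ * (P.act t f x - f x)) 2 μ := fun t =>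
    ((h.memLp_act t hf.1).sub hf.1).const_mul _
  refine tendsto_setIntegral_of_L1' g hf.2.1.1
    (Eventually.of_forall fun t => (h1 t).integrable (by norm_num)) ?_ A
  refine tendsto_of_tendsto_of_tendsto_of_le_of_le tendsto_const_nhds hf.2.2 (fun _ => bot_le)
    fun t => ?_
  exact eLpNorm_le_eLpNorm_of_exponent_le (by norm_num) ((h1 t).sub hf.2.1).1

theorem MarkovSemigroup.HasGen.tendsto_setIntegral_act {Ω : Type*} [MeasurableSpace Ω]
    {P : MarkovSemigroup Ω} {μ : Measure Ω} [IsProbabilityMeasure μ] (h : P.IsReversible μ)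
    {f g : Ω → ℝ} (hf : P.HasGen μ f g) (A : Set Ω) :
    Tendsto (fun t : ℝ≥0 => ∫ x in A, P.act t f x ∂μ) (𝓝[>] 0) (𝓝 (∫ x in A, f x ∂μ)) := by
  have h0 : Tendsto (fun t : ℝ≥0 => (t : ℝ)) (𝓝[>] 0) (𝓝 0) :=
    (NNReal.continuous_coe.tendsto' 0 0 rfl).mono_left nhdsWithin_le_nhds
  have h1 := (h0.mul (hf.tendsto_setIntegral h A)).add_const (∫ x in A, f x ∂μ)
  rw [zero_mul, zero_add] at h1
  refine h1.congr' ?_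
  filter_upwards [self_mem_nhdsWithin] with t ht
  have ht' : (t : ℝ) ≠ 0 := by
    have : (0 : ℝ≥0) < t := ht
    positivity
  have i1 : Integrable f μ := hf.1.integrable (by norm_num)
  have i2 : Integrable (P.act t f) μ := (h.memLp_act t hf.1).integrable (by norm_num)
  rw [integral_const_mul, integral_sub i2.integrableOn i1.integrableOn, ← mul_assoc,
    mul_inv_cancel₀ ht', one_mul, sub_add_cancel]

namespace IsReversibleChain

variable {X : Type*} [MeasurableSpace X] [Countable X] [DiscreteMeasurableSpace X]
  {Q : MarkovSemigroup X} {k : X → X → ℝ} {ν : Measure X} (hk : IsReversibleChain Q k ν)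

/-- The difference quotients of the transition probabilities. -/
def rateQuotient (Q : MarkovSemigroup X) (t : ℝ≥0) (i j : X) : ℝ :=
  (t : ℝ)⁻¹ * ((Q.kernel t i).real {j} - (Q.kernel 0 i).real {j})

theorem integral_kernel_eq_tsum (Q : MarkovSemigroup X) (t : ℝ≥0) (i : X) {b : X → ℝ} {C : ℝ}
    (hb : ∀ j, |b j| ≤ C) : HasSum (fun j => (Q.kernel t i).real {j} * b j)
      (∫ j, b j ∂(Q.kernel t i)) := by
  have hi : Integrable b (Q.kernel t i) :=
    Integrable.of_bound (by fun_prop) C (Eventually.of_forall hb)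
  have h1 := hasSum_integral_iUnion (μ := Q.kernel t i) (f := b) (s := fun j : X => {j})
    (fun j => MeasurableSet.of_discrete) (fun a b hab => Set.disjoint_singleton.2 hab)
    hi.integrableOn
  rw [Set.iUnion_of_singleton, setIntegral_univ] at h1
  simpa only [integral_singleton, smul_eq_mul] using h1

theorem hasSum_rateQuotient (Q : MarkovSemigroup X) (t : ℝ≥0) (i : X) {b : X → ℝ} {C : ℝ}
    (hb : ∀ j, |b j| ≤ C) : HasSum (fun j => rateQuotient Q t i j * b j)
      ((t : ℝ)⁻¹ * (∫ j, b j ∂(Q.kernel t i) - b i)) := by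
  have h1 := integral_kernel_eq_tsum Q t i hb
  have h2 := integral_kernel_eq_tsum Q 0 i hb
  have h3 : ∫ j, b j ∂(Q.kernel 0 i) = b i := by
    rw [Q.zero, Kernel.id_apply, integral_dirac]
  rw [h3] at h2
  refine ((h1.sub h2).mul_left (t : ℝ)⁻¹).congr_fun ?_
  intro j
  rw [rateQuotient]
  ring

theorem rateQuotient_nonneg (t : ℝ≥0) {i j : X} (hij : j ≠ i) : 0 ≤ rateQuotient Q t i j := by
  have : (Q.kernel 0 i).real {j} = 0 := by
    rw [Q.zero, Kernel.id_apply, measureReal_def, Measure.dirac_apply]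
    simp [hij.symm]
  rw [rateQuotient, this, sub_zero]
  positivity

include hk

theorem tendsto_tsum_abs_rateQuotient_sub (i : X) :
    Tendsto (fun t : ℝ≥0 => ∑' j, |rateQuotient Q t i j - k i j|) (𝓝[>] 0) (𝓝 0) := by
  classical
  have hq : ∀ t, HasSum (rateQuotient Q t i) 0 := fun t => by
    simpa using hasSum_rateQuotient Q t i (b := fun _ => 1) (C := 1) (by simp)
  have h1 : ∀ t, ∑' j, |rateQuotient Q t i j - k i j|
      = 2 * ∑' j, max (k i j - rateQuotient Q t i j) 0 := by
    intro t
    have h2 := (hq t).sub (hk.conservative i)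
    have h3 : Summable fun j => max (k i j - rateQuotient Q t i j) 0 := by
      refine Summable.of_nonneg_of_le (fun j => le_max_right _ _) (fun j => ?_) h2.summable.abs
      refine max_le ?_ (abs_nonneg _)
      rw [abs_sub_comm]
      exact le_abs_self _
    have h4 := h2.add (h3.hasSum.mul_left 2)
    rw [sub_zero, zero_add] at h4
    rw [← h4.tsum_eq]
    refine tsum_congr fun j => ?_
    rcases le_total (k i j) (rateQuotient Q t i j) with h | h
    · rw [max_eq_right (by linarith), abs_of_nonneg (by linarith)]
      ring
    · rw [max_eq_left (by linarith), abs_of_nonpos (by linarith)]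
      ring
  simp_rw [h1]
  have h2 : Tendsto (fun t : ℝ≥0 => ∑' j, max (k i j - rateQuotient Q t i j) 0) (𝓝[>] 0)
      (𝓝 (∑' _ : X, (0 : ℝ))) := by
    refine tendsto_tsum_of_dominated_convergence
      -- Off the diagonal `q ≥ 0`, so the positive part of `k - q` is at most `k`; at `j = i` the
      -- sign is lost, and the extra `1` covers the difference for small `t`.
      (bound := fun j => |k i j| + (if j = i then 1 else 0)) ?_ ?_ ?_
    · exact (hk.summable_abs i).add (summable_of_hasFiniteSupport
        ((Set.finite_singleton i).subset fun j hj => by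
          by_contra h
          simp at h
          simp [h] at hj))
    · intro j
      have h3 := ((tendsto_const_nhds (x := k i j)).sub (hk.rates i j)).max
        (tendsto_const_nhds (x := (0 : ℝ)))
      rw [sub_self, max_self] at h3
      exact h3
    · have h3 := (tendsto_const_nhds (x := k i i)).sub (hk.rates i i)
      rw [sub_self] at h3
      filter_upwards [h3.eventually (ge_mem_nhds zero_lt_one)] with t ht j
      rw [Real.norm_of_nonneg (le_max_right _ _)]
      refine max_le ?_ (by positivity)
      by_cases hj : j = i
      · subst hj
        rw [if_pos rfl]
        have := abs_nonneg (k j j)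
        have ht' : k j j - rateQuotient Q t j j ≤ 1 := ht
        linarith
      · rw [if_neg hj, add_zero]
        have := rateQuotient_nonneg (Q := Q) t hj
        have := le_abs_self (k i j)
        linarith
  rw [tsum_zero] at h2
  simpa using h2.const_mul 2

/-- Split `q b_t = (q - k) b_t + k b_t`: the first part vanishes by `ℓ¹` convergence of the
quotients, the second converges by domination. -/
theorem tendsto_tsum_rateQuotient {b : ℝ≥0 → X → ℝ} {b₀ : X → ℝ} {C : ℝ}
    (hb : ∀ t j, |b t j| ≤ C) (hlim : ∀ j, Tendsto (fun t => b t j) (𝓝[>] 0) (𝓝 (b₀ j))) (i : X) :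
    Tendsto (fun t : ℝ≥0 => ∑' j, rateQuotient Q t i j * b t j) (𝓝[>] 0)
      (𝓝 (∑' j, k i j * b₀ j)) := by
  have h1 : Tendsto (fun t : ℝ≥0 => ∑' j, k i j * b t j) (𝓝[>] 0) (𝓝 (∑' j, k i j * b₀ j)) := by
    refine tendsto_tsum_of_dominated_convergence ((hk.summable_abs i).mul_right C)
      (fun j => (hlim j).const_mul _) (Eventually.of_forall fun t j => ?_)
    rw [norm_mul, Real.norm_eq_abs, Real.norm_eq_abs]
    gcongr
    exact hb t j
  have hs : ∀ t, Summable fun j => rateQuotient Q t i j - k i j := fun t => by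
    have := (hasSum_rateQuotient Q t i (b := fun _ => 1) (C := 1) (by simp)).summable
    simp only [mul_one] at this
    exact this.sub (hk.summable i)
  have hs' : ∀ t, Summable fun j => (rateQuotient Q t i j - k i j) * b t j := fun t => by
    refine Summable.of_norm_bounded ((hs t).abs.mul_right C) fun j => ?_
    rw [norm_mul, Real.norm_eq_abs, Real.norm_eq_abs]
    gcongr
    exact hb t j
  have h2 : Tendsto (fun t : ℝ≥0 => ∑' j, (rateQuotient Q t i j - k i j) * b t j) (𝓝[>] 0)
      (𝓝 0) := by
    have h3 := (hk.tendsto_tsum_abs_rateQuotient_sub i).mul_const C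
    rw [zero_mul] at h3
    refine squeeze_zero_norm (fun t => ?_) h3
    rw [← tsum_mul_right]
    refine tsum_of_norm_bounded ((hs t).abs.mul_right C).hasSum fun j => ?_
    rw [norm_mul, Real.norm_eq_abs, Real.norm_eq_abs]
    gcongr
    exact hb t j
  have h3 := h2.add h1
  rw [zero_add] at h3
  refine h3.congr fun t => ?_
  rw [← Summable.tsum_add (hs' t) (hk.summable_mul_of_bounded (hb t) i)]
  exact tsum_congr fun j => by ring

omit [Countable X] [DiscreteMeasurableSpace X] in
theorem discGen_eq_tsum {a : X → ℝ} {i : X} (ha : Summable fun j => k i j * a j) :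
    discGen k a i = ∑' j, k i j * a j := by
  have h1 : ∑' j, k i j * a i = 0 := by
    rw [tsum_mul_right, (hk.conservative i).tsum_eq, zero_mul]
  rw [discGen, ← sub_zero (∑' j, k i j * a j), ← h1,
    ← Summable.tsum_sub ha ((hk.summable i).mul_right _)]
  exact tsum_congr fun j => by ring

omit [Countable X] [DiscreteMeasurableSpace X] in
theorem measure_singleton_ne_zero (i : X) : ν {i} ≠ 0 := fun h => by
  have := hk.pos i
  rw [measureReal_def, h] at this
  simp at this

end IsReversibleChain

section ProductGenerator

variable {E X : Type*} [MeasurableSpace E] [MeasurableSpace X] [Countable X]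
  [DiscreteMeasurableSpace X] {P : MarkovSemigroup E} {Q : MarkovSemigroup X}

theorem MarkovSemigroup.abs_act_le {Ω : Type*} [MeasurableSpace Ω] (P : MarkovSemigroup Ω)
    {f : Ω → ℝ} {C : ℝ} (hC : ∀ x, |f x| ≤ C) (t : ℝ≥0) (x : Ω) : |P.act t f x| ≤ C := by
  have := norm_integral_le_of_norm_le_const (μ := P.kernel t x) (f := f) (C := C)
    (Eventually.of_forall hC)
  simpa [MarkovSemigroup.act] using this

theorem MarkovSemigroup.measurable_act {Ω : Type*} [MeasurableSpace Ω] (P : MarkovSemigroup Ω)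
    {f : Ω → ℝ} (hf : Measurable f) (t : ℝ≥0) : Measurable (P.act t f) :=
  (hf.stronglyMeasurable.integral_kernel (κ := P.kernel t)).measurable

omit [Countable X] [DiscreteMeasurableSpace X] in
theorem act_prod_apply {g : E × X → ℝ} (hg : Measurable g) {C : ℝ} (hC : ∀ z, |g z| ≤ C) (t : ℝ≥0)
    (x : E) (i : X) : (P.prod Q).act t g (x, i) = ∫ j, P.act t (slice g j) x ∂(Q.kernel t i) := by
  change ∫ z, g z ∂((P.kernel t ∥ₖ Q.kernel t) (x, i)) = _
  rw [Kernel.parallelComp_apply, integral_prod_symm]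
  · rfl
  · exact Integrable.of_bound hg.aestronglyMeasurable C (Eventually.of_forall hC)

variable {μ : Measure E} {ν : Measure X} [IsProbabilityMeasure μ] [IsProbabilityMeasure ν]
  {k : X → X → ℝ}

/-- On bounded functions with slices in the domain of the generator of the first component,
the generator of the product process is the sum of the generators of the components. -/
theorem gen_prod_slice (h : P.IsReversible μ) (hk : IsReversibleChain Q k ν) {g G : E × X → ℝ}
    (hg : Measurable g) {C : ℝ} (hC : ∀ z, |g z| ≤ C) (hdom : (P.prod Q).HasGen (μ.prod ν) g G)
    (hslice : ∀ j, P.InDomain μ (slice g j)) (i : X) :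
    ∀ᵐ x ∂μ, G (x, i) = hybridGen P μ k g (x, i) := by
  have hprod := h.prod hk.reversible
  have hi := hk.measure_singleton_ne_zero i
  have hgm : ∀ j, Measurable (slice g j) := fun j => hg.comp measurable_prodMk_right
  have hsl : ∀ x, Summable fun j => k i j * g (x, j) := fun x =>
    hk.summable_mul_of_bounded (fun j => hC (x, j)) i
  have hGi : Integrable (slice G i) μ :=
    integrable_slice (hdom.2.1.integrable (by norm_num)) hi (measure_ne_top _ _)
  have hgenInt : Integrable (P.gen μ (slice g i)) μ := (hslice i).memLp_gen.integrable (by norm_num)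
  have hterm : ∀ j, Integrable (fun x => k i j * g (x, j)) μ := fun j =>
    (Integrable.of_bound (hgm j).aestronglyMeasurable C
      (Eventually.of_forall fun x => hC (x, j))).const_mul _
  have hnormsum : ∀ A : Set E, Summable fun j => ∫ x in A, ‖k i j * g (x, j)‖ ∂μ := by
    intro A
    refine Summable.of_nonneg_of_le (fun j => integral_nonneg fun x => norm_nonneg _) (fun j => ?_)
      ((hk.summable_abs i).mul_right C)
    have h1 : ∀ x, ‖k i j * g (x, j)‖ ≤ |k i j| * C := fun x => by
      rw [norm_mul, Real.norm_eq_abs, Real.norm_eq_abs]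
      gcongr
      exact hC _
    have hC0 : 0 ≤ |k i j| * C := by
      obtain ⟨x⟩ := nonempty_of_isProbabilityMeasure μ
      exact (norm_nonneg _).trans (h1 x)
    calc ∫ x in A, ‖k i j * g (x, j)‖ ∂μ ≤ ∫ x in A, |k i j| * C ∂μ :=
          integral_mono (hterm j).norm.integrableOn (integrable_const _) h1
      _ ≤ _ := by
          rw [setIntegral_const, smul_eq_mul]
          exact mul_le_of_le_one_left hC0 measureReal_le_one
  have hdisc : Integrable (fun x => ∑' j, k i j * g (x, j)) μ := by
    refine Integrable.of_bound ?_ (2 * exitRate k i * C)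
      (Eventually.of_forall fun x => hk.abs_tsum_le (fun j => hC (x, j)) i)
    exact (Measurable.tsum fun j => (hgm j).const_mul _).aestronglyMeasurable
  have e : (fun x => hybridGen P μ k g (x, i))
      = fun x => P.gen μ (slice g i) x + ∑' j, k i j * g (x, j) := by
    ext x
    rw [hybridGen_apply, hk.discGen_eq_tsum (hsl x)]
  have key : slice G i =ᵐ[μ] fun x => P.gen μ (slice g i) x + ∑' j, k i j * g (x, j) := by
    -- The identity is tested weakly, on sets `A × {i}`: integrals over `A` pass to the limit even
    -- where pointwise quotients do not.
    refine Integrable.ae_eq_of_forall_setIntegral_eq _ _ hGi (hgenInt.add hdisc) fun A hA _ => ?_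
    have L1 := hdom.tendsto_setIntegral hprod (A ×ˢ {i})
    rw [setIntegral_prod_singleton (hdom.2.1.integrable (by norm_num))] at L1
    have hactm : ∀ t j, Measurable (P.act t (slice g j)) := fun t j => P.measurable_act (hgm j) t
    have hactC : ∀ t j x, |P.act t (slice g j) x| ≤ C := fun t j x =>
      P.abs_act_le (fun x => hC (x, j)) t x
    have hbC : ∀ t j, |∫ x in A, P.act t (slice g j) x ∂μ| ≤ C := by
      intro t j
      have := norm_setIntegral_le_of_norm_le_const (μ := μ) (s := A) (C := C)
        (f := P.act t (slice g j)) (measure_lt_top _ _) (fun x _ => hactC t j x)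
      refine this.trans (mul_le_of_le_one_right ?_ measureReal_le_one)
      obtain ⟨x⟩ := nonempty_of_isProbabilityMeasure μ
      exact (abs_nonneg _).trans (hC (x, j))
    have L2 := hk.tendsto_tsum_rateQuotient (b := fun t j => ∫ x in A, P.act t (slice g j) x ∂μ) hbC
      (fun j => (hslice j).hasGen.tendsto_setIntegral_act h A) i
    have L3 := (L2.add ((hslice i).hasGen.tendsto_setIntegral h A)).const_mul (ν.real {i})
    -- Decomposition of the increment by the move of the chain: `P_t g(x,i) = ∑_j Q_t(i,j) P^c_t
    -- g_j(x)`. Subtracting the `t = 0` row isolates the chain quotients acting on `P^c_t g_j`, and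
    -- leaves the diffusion quotient of `g_i`.
    have heq : ∀ t : ℝ≥0, ∫ z in A ×ˢ {i}, (t : ℝ)⁻¹ * ((P.prod Q).act t g z - g z) ∂(μ.prod ν)
        = ν.real {i} * ((∑' j, IsReversibleChain.rateQuotient Q t i j
            * ∫ x in A, P.act t (slice g j) x ∂μ)
          + ∫ x in A, (t : ℝ)⁻¹ * (P.act t (slice g i) x - slice g i x) ∂μ) := by
      intro t
      have i1 : ∀ j, Integrable (P.act t (slice g j)) μ := fun j =>
        Integrable.of_bound (hactm t j).aestronglyMeasurable C (Eventually.of_forall (hactC t j))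
      have i2 : Integrable (slice g i) μ :=
        Integrable.of_bound (hgm i).aestronglyMeasurable C (Eventually.of_forall fun x => hC (x, i))
      have i3 : Integrable (fun x => (P.prod Q).act t g (x, i)) μ :=
        Integrable.of_bound (((P.prod Q).measurable_act hg t).comp
          measurable_prodMk_right).aestronglyMeasurable C
          (Eventually.of_forall fun x => (P.prod Q).abs_act_le hC t _)
      have i4 : Integrable (fun z => (t : ℝ)⁻¹ * ((P.prod Q).act t g z - g z)) (μ.prod ν) :=
        (((hprod.memLp_act t hdom.1).sub hdom.1).const_mul _).integrable (by norm_num)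
      rw [setIntegral_prod_singleton i4, (IsReversibleChain.hasSum_rateQuotient Q t i (hbC t)).tsum_eq,
        integral_const_mul, integral_const_mul, integral_sub i3.integrableOn i2.integrableOn,
        integral_sub (i1 i).integrableOn i2.integrableOn]
      have hswap : ∫ x in A, (P.prod Q).act t g (x, i) ∂μ
          = ∫ j, ∫ x in A, P.act t (slice g j) x ∂μ ∂(Q.kernel t i) := by
        simp_rw [act_prod_apply hg hC]
        refine integral_integral_swap (f := fun x j => P.act t (slice g j) x) ?_
        refine Integrable.of_bound ?_ C (Eventually.of_forall fun z => hactC t z.2 z.1)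
        exact (measurable_from_prod_countable_left fun j => hactm t j).aestronglyMeasurable
      rw [hswap]
      ring
    simp_rw [heq] at L1
    have h2 := mul_left_cancel₀ (hk.pos i).ne' (tendsto_nhds_unique L1 L3)
    have h3 := (hasSum_integral_of_summable_integral_norm (μ := μ.restrict A)
      (fun j => (hterm j).integrableOn) (hnormsum A)).tsum_eq
    rw [integral_add hgenInt.integrableOn hdisc.integrableOn, ← h3]
    simp_rw [integral_const_mul]
    rw [add_comm]
    exact h2
  filter_upwards [key] with x hx
  exact hx.trans (congrFun e x).symm

end ProductGenerator

/-! ### Differentiation of entropy integrals along curves in `L²`. -/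

section LogEstimates

variable {a b c : ℝ}

theorem abs_log_sub_log_le (hc : 0 < c) (ha : c ≤ a) (hb : c ≤ b) :
    |Real.log b - Real.log a| ≤ c⁻¹ * |b - a| := by
  have key : ∀ {a b : ℝ}, c ≤ a → c ≤ b → Real.log b - Real.log a ≤ c⁻¹ * |b - a| := by
    intro a b ha hb
    have ha0 : 0 < a := hc.trans_le ha
    rw [← Real.log_div (hc.trans_le hb).ne' ha0.ne']
    calc Real.log (b / a) ≤ b / a - 1 := Real.log_le_sub_one_of_pos (div_pos (hc.trans_le hb) ha0)
      _ = a⁻¹ * (b - a) := by field_simp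
      _ ≤ a⁻¹ * |b - a| := mul_le_mul_of_nonneg_left (le_abs_self _) (by positivity)
      _ ≤ c⁻¹ * |b - a| := by gcongr
  have h1 := key hb ha
  rw [abs_sub_comm] at h1
  exact abs_le.2 ⟨by linarith, key ha hb⟩

/-- Applying `log r ≤ r - 1` to `b/a` and to `a/b` encloses `log b - log a` between `(b - a)/b` and
`(b - a)/a`. -/
theorem abs_log_sub_log_sub_le (hc : 0 < c) (ha : c ≤ a) (hb : c ≤ b) :
    |Real.log b - Real.log a - (b - a) / a| ≤ (c⁻¹) ^ 2 * (b - a) ^ 2 := by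
  have ha0 : 0 < a := hc.trans_le ha
  have hb0 : 0 < b := hc.trans_le hb
  have h1 : Real.log b - Real.log a ≤ (b - a) / a := by
    rw [← Real.log_div hb0.ne' ha0.ne', sub_div, div_self ha0.ne']
    exact Real.log_le_sub_one_of_pos (div_pos hb0 ha0)
  have h2 : Real.log a - Real.log b ≤ (a - b) / b := by
    rw [← Real.log_div ha0.ne' hb0.ne', sub_div, div_self hb0.ne']
    exact Real.log_le_sub_one_of_pos (div_pos ha0 hb0)
  have h3 : (b - a) / a - (b - a) / b = a⁻¹ * b⁻¹ * (b - a) ^ 2 := by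
    field_simp
  have h4 : a⁻¹ * b⁻¹ * (b - a) ^ 2 ≤ (c⁻¹) ^ 2 * (b - a) ^ 2 := by
    rw [sq c⁻¹]
    gcongr
  have h5 : (a - b) / b = -((b - a) / b) := by
    rw [← neg_div]
    ring
  rw [abs_le]
  constructor <;> linarith

theorem abs_mul_log_sub_le (hc : 0 < c) (ha : c ≤ a) (hb : c ≤ b) :
    |b * Real.log b - a * Real.log a - (Real.log a + 1) * (b - a)| ≤ c⁻¹ * (b - a) ^ 2 := by
  have ha0 : 0 < a := hc.trans_le ha
  have hb0 : 0 < b := hc.trans_le hb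
  have h1 : Real.log b - Real.log a ≤ b / a - 1 := by
    rw [← Real.log_div hb0.ne' ha0.ne']
    exact Real.log_le_sub_one_of_pos (div_pos hb0 ha0)
  have h2 : Real.log a - Real.log b ≤ a / b - 1 := by
    rw [← Real.log_div ha0.ne' hb0.ne']
    exact Real.log_le_sub_one_of_pos (div_pos ha0 hb0)
  have h3 : b * Real.log b - a * Real.log a - (Real.log a + 1) * (b - a)
      = b * (Real.log b - Real.log a) - (b - a) := by ring
  have h4 : b * (b / a - 1) - (b - a) = a⁻¹ * (b - a) ^ 2 := by
    field_simp
  have h5 : b * (a / b - 1) = a - b := by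
    field_simp
  have h6 : a⁻¹ * (b - a) ^ 2 ≤ c⁻¹ * (b - a) ^ 2 := by gcongr
  have h7 := mul_le_mul_of_nonneg_left h1 hb0.le
  have h8 := mul_le_mul_of_nonneg_left h2 hb0.le
  have h9 : 0 ≤ a⁻¹ * (b - a) ^ 2 := by positivity
  rw [h3, abs_le]
  constructor <;> linarith

theorem abs_log_le_of_mem {C : ℝ} (hc : 0 < c) (ha : c ≤ a) (haC : a ≤ C) :
    |Real.log a| ≤ |Real.log c| + |Real.log C| := by
  have h1 := Real.log_le_log hc ha
  have h2 := Real.log_le_log (hc.trans_le ha) haC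
  have := neg_abs_le (Real.log c)
  have := le_abs_self (Real.log C)
  have := abs_nonneg (Real.log c)
  have := abs_nonneg (Real.log C)
  exact abs_le.2 ⟨by linarith, by linarith⟩

end LogEstimates

/-- A remainder that is `o(‖γ s - γ t‖)` has derivative `0`. The quadratic constant `M` may depend
on `ε`, which leaves room for an approximation argument at each `ε`. -/
theorem hasDerivWithinAt_zero_of_bound {V : Type*} [NormedAddCommGroup V] [NormedSpace ℝ V]
    {γ : ℝ → V} {w : V} {S : Set ℝ} {t : ℝ} (hγ : HasDerivWithinAt γ w S t) {R : ℝ → ℝ}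
    (hR : ∀ ε > 0, ∃ M, 0 ≤ M ∧ ∀ s, |R s - R t| ≤ ε * ‖γ s - γ t‖ + M * ‖γ s - γ t‖ ^ 2) :
    HasDerivWithinAt R 0 S t := by
  rw [hasDerivWithinAt_iff_isLittleO, Asymptotics.isLittleO_iff]
  intro η hη
  obtain ⟨K, hK, hKb⟩ := hγ.hasFDerivWithinAt.isBigO_sub.exists_pos
  rw [Asymptotics.IsBigOWith] at hKb
  obtain ⟨M, hM, hMR⟩ := hR (η / (2 * K)) (by positivity)
  have hcont : Tendsto (fun s => M * K * ‖γ s - γ t‖) (𝓝[S] t) (𝓝 0) := by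
    have h1 : Tendsto (fun s => γ s - γ t) (𝓝[S] t) (𝓝 (γ t - γ t)) :=
      Tendsto.sub hγ.continuousWithinAt tendsto_const_nhds
    rw [sub_self] at h1
    simpa using (h1.norm).const_mul (M * K)
  filter_upwards [hKb, hcont.eventually (ge_mem_nhds (show 0 < η / 2 by positivity))] with s h1 h2
  rw [smul_zero, sub_zero]
  have h3 := hMR s
  rw [Real.norm_eq_abs]
  have h0 := norm_nonneg (γ s - γ t)
  calc |R s - R t| ≤ η / (2 * K) * ‖γ s - γ t‖ + M * ‖γ s - γ t‖ ^ 2 := h3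
    _ ≤ η / (2 * K) * (K * ‖s - t‖) + M * ‖γ s - γ t‖ * (K * ‖s - t‖) := by
        rw [sq, ← mul_assoc]
        gcongr
    _ = η / 2 * ‖s - t‖ + M * K * ‖γ s - γ t‖ * ‖s - t‖ := by field_simp
    _ ≤ η / 2 * ‖s - t‖ + η / 2 * ‖s - t‖ := by gcongr
    _ = η * ‖s - t‖ := by ring

section L2

variable {Ω : Type*} [MeasurableSpace Ω] {μ : Measure Ω}

theorem inner_toLp {f g : Ω → ℝ} (hf : MemLp f 2 μ) (hg : MemLp g 2 μ) :
    inner ℝ (hf.toLp f) (hg.toLp g) = ∫ x, f x * g x ∂μ := by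
  rw [L2.inner_def]
  refine integral_congr_ae ?_
  filter_upwards [hf.coeFn_toLp, hg.coeFn_toLp] with x h1 h2
  rw [h1, h2]
  exact mul_comm _ _

theorem integral_mul_le_norm {f g : Ω → ℝ} (hf : MemLp f 2 μ) (hg : MemLp g 2 μ) :
    ∫ x, |f x * g x| ∂μ ≤ ‖hf.toLp f‖ * ‖hg.toLp g‖ := by
  have hf' : MemLp (fun x => |f x|) 2 μ := hf.abs
  have hg' : MemLp (fun x => |g x|) 2 μ := hg.abs
  have h1 := inner_toLp hf' hg'
  have h2 := real_inner_le_norm (hf'.toLp _) (hg'.toLp _)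
  rw [h1, Lp.norm_toLp, Lp.norm_toLp] at h2
  simp_rw [abs_mul]
  rw [Lp.norm_toLp, Lp.norm_toLp]
  have e1 : eLpNorm (fun x => |f x|) 2 μ = eLpNorm f 2 μ := eLpNorm_norm f
  have e2 : eLpNorm (fun x => |g x|) 2 μ = eLpNorm g 2 μ := eLpNorm_norm g
  rwa [e1, e2] at h2

theorem integral_sub_sq {f g : Ω → ℝ} (hf : MemLp f 2 μ) (hg : MemLp g 2 μ) :
    ∫ x, (f x - g x) ^ 2 ∂μ = ‖hf.toLp f - hg.toLp g‖ ^ 2 := by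
  rw [← MemLp.toLp_sub, ← real_inner_self_eq_norm_sq, inner_toLp]
  simp_rw [sq]
  rfl

variable [IsProbabilityMeasure μ] {F : ℝ → Ω → ℝ} {W : Ω → ℝ} {S : Set ℝ} {t c C : ℝ}
  (hm : ∀ s, MemLp (F s) 2 μ) (hW : MemLp W 2 μ)
  (hder : HasDerivWithinAt (fun s => (hm s).toLp (F s)) (hW.toLp W) S t)
  (hc : 0 < c) (hcF : ∀ s x, c ≤ F s x) (hFC : ∀ s x, F s x ≤ C)

include hm hc hcF hFC in
theorem memLp_log (s : ℝ) : MemLp (fun x => Real.log (F s x)) 2 μ :=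
  MemLp.of_bound (Real.measurable_log.comp_aemeasurable (hm s).1.aemeasurable).aestronglyMeasurable
    (|Real.log c| + |Real.log C|) (Eventually.of_forall fun x =>
      abs_log_le_of_mem hc (hcF s x) (hFC s x))

include hder in
omit [IsProbabilityMeasure μ] in
theorem hasDerivWithinAt_integral_mul {V : Ω → ℝ} (hV : MemLp V 2 μ) :
    HasDerivWithinAt (fun s => ∫ x, V x * F s x ∂μ) (∫ x, V x * W x ∂μ) S t := by
  have h1 := ((innerSL ℝ (hV.toLp V)).hasFDerivAt.comp_hasDerivWithinAt t hder)
  have h2 : (fun s => ∫ x, V x * F s x ∂μ)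
      = (innerSL ℝ (hV.toLp V)) ∘ fun s => (hm s).toLp (F s) := by
    ext s
    simp [inner_toLp]
  rw [h2, ← inner_toLp hV hW]
  exact h1

include hder hc hcF hFC in
-- For values bounded below by `c`, the remainder of `r log r` at first order is at most `c⁻¹ (F_s -
-- F_t)²`, whose integral is quadratic in the `L²` distance.
theorem hasDerivWithinAt_integral_mul_log_self :
    HasDerivWithinAt (fun s => ∫ x, F s x * Real.log (F s x) ∂μ)
      (∫ x, (Real.log (F t x) + 1) * W x ∂μ) S t := by
  have hV : MemLp (fun x => Real.log (F t x) + 1) 2 μ :=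
    (memLp_log hm hc hcF hFC t).add (memLp_const 1)
  have h1 := hasDerivWithinAt_integral_mul hm hW hder hV
  have hi : ∀ s, Integrable (fun x => F s x * Real.log (F s x)) μ := fun s =>
    (hm s).integrable_mul (memLp_log hm hc hcF hFC s)
  have hi' : ∀ s, Integrable (fun x => (Real.log (F t x) + 1) * F s x) μ := fun s =>
    hV.integrable_mul (hm s)
  have h2 : HasDerivWithinAt (fun s => ∫ x, F s x * Real.log (F s x) ∂μ
      - ∫ x, (Real.log (F t x) + 1) * F s x ∂μ) 0 S t := by
    refine hasDerivWithinAt_zero_of_bound hder fun ε hε => ⟨c⁻¹, by positivity, fun s => ?_⟩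
    have hj : ∀ s, Integrable (fun x => F s x * Real.log (F s x)
        - (Real.log (F t x) + 1) * F s x) μ := fun s => (hi s).sub (hi' s)
    rw [← integral_sub (hi s) (hi' s), ← integral_sub (hi t) (hi' t),
      ← integral_sub (hj s) (hj t), ← integral_sub_sq (hm s) (hm t),
      ← integral_const_mul]
    refine le_trans ?_ (le_add_of_nonneg_left (by positivity))
    rw [← Real.norm_eq_abs]
    refine norm_integral_le_of_norm_le ((((hm s).sub (hm t)).integrable_sq).const_mul _)
      (Eventually.of_forall fun x => ?_)
    have := abs_mul_log_sub_le hc (hcF t x) (hcF s x)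
    rw [Real.norm_eq_abs]
    refine le_trans (le_of_eq ?_) this
    congr 1
    ring
  have h3 := h2.add h1
  rw [zero_add] at h3
  refine h3.congr_of_eventuallyEq (Eventually.of_forall fun s => ?_) ?_ <;> simp

include hder hc hcF hFC in
-- The quadratic remainder of the logarithm cannot be paired directly with a weight `V` that is only
-- in `L²`. Hence `V` is split into a bounded simple function, which takes the quadratic bound, and
-- a part small in `L²`, which takes the Lipschitz bound.
theorem hasDerivWithinAt_integral_mul_log {V : Ω → ℝ} (hV : MemLp V 2 μ) :
    HasDerivWithinAt (fun s => ∫ x, V x * Real.log (F s x) ∂μ)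
      (∫ x, V x / F t x * W x ∂μ) S t := by
  have hFm : ∀ s, AEMeasurable (F s) μ := fun s => (hm s).1.aemeasurable
  have hVF : MemLp (fun x => V x / F t x) 2 μ := by
    refine MemLp.of_le_mul (c := c⁻¹) hV (hV.1.aemeasurable.div (hFm t)).aestronglyMeasurable
      (Eventually.of_forall fun x => ?_)
    rw [norm_div, div_eq_mul_inv, mul_comm, Real.norm_of_nonneg (hc.le.trans (hcF t x))]
    gcongr
    exact hcF t x
  have h1 := hasDerivWithinAt_integral_mul hm hW hder hVF
  have hi : ∀ {V : Ω → ℝ}, MemLp V 2 μ → ∀ s, Integrable (fun x => V x * Real.log (F s x)) μ :=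
    fun hV s => hV.integrable_mul (memLp_log hm hc hcF hFC s)
  have hi' : ∀ s, Integrable (fun x => V x / F t x * F s x) μ := fun s => hVF.integrable_mul (hm s)
  have hρ : ∀ s, MemLp (fun x => Real.log (F s x) - Real.log (F t x) - (F s x - F t x) / F t x) 2 μ := by
    intro s
    refine MemLp.of_le_mul (c := 2 * c⁻¹) ((hm s).sub (hm t))
      (((memLp_log hm hc hcF hFC s).1.sub (memLp_log hm hc hcF hFC t).1).sub
        (((hFm s).sub (hFm t)).div (hFm t)).aestronglyMeasurable) (Eventually.of_forall fun x => ?_)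
    have e1 := abs_log_sub_log_le hc (hcF t x) (hcF s x)
    have e2 : |(F s x - F t x) / F t x| ≤ c⁻¹ * |F s x - F t x| := by
      rw [abs_div, div_eq_mul_inv, mul_comm, abs_of_nonneg (hc.le.trans (hcF t x))]
      gcongr
      exact hcF t x
    simp only [Pi.sub_apply, Real.norm_eq_abs]
    refine (abs_sub _ _).trans ?_
    linarith
  have hρn : ∀ s, ‖(hρ s).toLp _‖ ≤ 2 * c⁻¹ * ‖(hm s).toLp (F s) - (hm t).toLp (F t)‖ := by
    intro s
    rw [← MemLp.toLp_sub]
    refine Lp.norm_le_mul_norm_of_ae_le_mul ?_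
    filter_upwards [(hρ s).coeFn_toLp, ((hm s).sub (hm t)).coeFn_toLp] with x h1 h2
    rw [h1, h2]
    have e1 := abs_log_sub_log_le hc (hcF t x) (hcF s x)
    have e2 : |(F s x - F t x) / F t x| ≤ c⁻¹ * |F s x - F t x| := by
      rw [abs_div, div_eq_mul_inv, mul_comm, abs_of_nonneg (hc.le.trans (hcF t x))]
      gcongr
      exact hcF t x
    simp only [Pi.sub_apply, Real.norm_eq_abs]
    refine (abs_sub _ _).trans ?_
    linarith
  have h2 : HasDerivWithinAt (fun s => ∫ x, V x * Real.log (F s x) ∂μ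
      - ∫ x, V x / F t x * F s x ∂μ) 0 S t := by
    refine hasDerivWithinAt_zero_of_bound hder fun ε hε => ?_
    -- The `L²` norm of the remainder is at most `2 c⁻¹ ‖F_s - F_t‖`, so an error `ε c / 2` in `V`
    -- produces `ε ‖F_s - F_t‖`.
    obtain ⟨U, hU, hUm⟩ := hV.exists_simpleFunc_eLpNorm_sub_lt (by norm_num)
      (ε := ENNReal.ofReal (ε * c / 2)) (by simp; positivity)
    obtain ⟨B, hB⟩ := U.exists_forall_norm_le
    have hVU : ‖(hV.sub hUm).toLp _‖ ≤ ε * c / 2 := by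
      rw [Lp.norm_toLp]
      exact ENNReal.toReal_le_of_le_ofReal (by positivity) hU.le
    refine ⟨|B| * (c⁻¹) ^ 2, by positivity, fun s => ?_⟩
    have e0 : (∫ x, V x * Real.log (F s x) ∂μ - ∫ x, V x / F t x * F s x ∂μ)
        - (∫ x, V x * Real.log (F t x) ∂μ - ∫ x, V x / F t x * F t x ∂μ)
        = ∫ x, (V - U) x * (Real.log (F s x) - Real.log (F t x) - (F s x - F t x) / F t x) ∂μ
          + ∫ x, U x * (Real.log (F s x) - Real.log (F t x) - (F s x - F t x) / F t x) ∂μ := by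
      have hj : ∀ s, Integrable (fun x => V x * Real.log (F s x) - V x / F t x * F s x) μ :=
        fun s => (hi hV s).sub (hi' s)
      have hj1 : Integrable (fun x => (V - U) x *
          (Real.log (F s x) - Real.log (F t x) - (F s x - F t x) / F t x)) μ :=
        (hV.sub hUm).integrable_mul (hρ s)
      have hj2 : Integrable (fun x => U x *
          (Real.log (F s x) - Real.log (F t x) - (F s x - F t x) / F t x)) μ :=
        hUm.integrable_mul (hρ s)
      rw [← integral_sub (hi hV s) (hi' s), ← integral_sub (hi hV t) (hi' t),
        ← integral_sub (hj s) (hj t), ← integral_add hj1 hj2]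
      refine integral_congr_ae (Eventually.of_forall fun x => ?_)
      have : F t x ≠ 0 := (hc.trans_le (hcF t x)).ne'
      simp only [Pi.sub_apply]
      field_simp
      ring
    rw [e0]
    refine (abs_add_le _ _).trans (add_le_add ?_ ?_)
    · have e1 := integral_mul_le_norm (hV.sub hUm) (hρ s)
      refine (abs_integral_le_integral_abs).trans (e1.trans ?_)
      calc _ ≤ ε * c / 2 * (2 * c⁻¹ * ‖(hm s).toLp (F s) - (hm t).toLp (F t)‖) := by
            gcongr
            exact hρn s
        _ = _ := by field_simp
    · rw [← integral_sub_sq (hm s) (hm t), ← integral_const_mul, ← Real.norm_eq_abs]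
      refine norm_integral_le_of_norm_le ((((hm s).sub (hm t)).integrable_sq).const_mul _)
        (Eventually.of_forall fun x => ?_)
      rw [norm_mul, mul_assoc]
      have e1 := abs_log_sub_log_sub_le hc (hcF t x) (hcF s x)
      exact mul_le_mul ((hB x).trans (le_abs_self B)) e1 (norm_nonneg _) (abs_nonneg _)
  have h3 := h2.add h1
  rw [zero_add] at h3
  refine h3.congr_of_eventuallyEq (Eventually.of_forall fun s => ?_) ?_ <;> simp

include hder hc hcF hFC in
-- The product rule: only the mixed increment `(G_s - G_t)(log F_s - log F_t)` is new, and its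
-- integral is quadratic in the increment of the pair `(F, G)`.
theorem hasDerivWithinAt_integral_curve_mul_log {G : ℝ → Ω → ℝ} {Z : Ω → ℝ}
    (hGm : ∀ s, MemLp (G s) 2 μ) (hZ : MemLp Z 2 μ)
    (hGder : HasDerivWithinAt (fun s => (hGm s).toLp (G s)) (hZ.toLp Z) S t) :
    HasDerivWithinAt (fun s => ∫ x, G s x * Real.log (F s x) ∂μ)
      ((∫ x, Real.log (F t x) * Z x ∂μ) + ∫ x, G t x / F t x * W x ∂μ) S t := by
  have hl := memLp_log hm hc hcF hFC
  have h1 := hasDerivWithinAt_integral_mul hGm hZ hGder (hl t)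
  have h2 := hasDerivWithinAt_integral_mul_log hm hW hder hc hcF hFC (hGm t)
  have h3 : HasDerivWithinAt (fun s => ∫ x, (G s x - G t x) *
      (Real.log (F s x) - Real.log (F t x)) ∂μ) 0 S t := by
    refine hasDerivWithinAt_zero_of_bound (hder.prodMk hGder) fun ε hε =>
      ⟨c⁻¹, by positivity, fun s => ?_⟩
    simp only [sub_self, zero_mul, integral_zero, sub_zero]
    refine le_trans ?_ (le_add_of_nonneg_left (by positivity))
    have e1 := integral_mul_le_norm ((hGm s).sub (hGm t)) ((hl s).sub (hl t))
    refine (abs_integral_le_integral_abs).trans (e1.trans ?_)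
    have e2 : ‖((hl s).sub (hl t)).toLp _‖ ≤ c⁻¹ * ‖(hm s).toLp (F s) - (hm t).toLp (F t)‖ := by
      rw [← MemLp.toLp_sub]
      refine Lp.norm_le_mul_norm_of_ae_le_mul ?_
      filter_upwards [((hl s).sub (hl t)).coeFn_toLp, ((hm s).sub (hm t)).coeFn_toLp] with x h1 h2
      rw [h1, h2]
      exact abs_log_sub_log_le hc (hcF t x) (hcF s x)
    have e3 := norm_fst_le (((hm s).toLp (F s) - (hm t).toLp (F t)),
      ((hGm s).toLp (G s) - (hGm t).toLp (G t)))
    have e4 := norm_snd_le (((hm s).toLp (F s) - (hm t).toLp (F t)),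
      ((hGm s).toLp (G s) - (hGm t).toLp (G t)))
    simp only at e3 e4
    rw [MemLp.toLp_sub (hGm s) (hGm t)]
    rw [Prod.mk_sub_mk]
    refine (mul_le_mul e4 (e2.trans (mul_le_mul_of_nonneg_left e3 (by positivity)))
      (norm_nonneg _) (norm_nonneg _)).trans (le_of_eq ?_)
    ring
  have h4 := (h3.add h1).add h2
  rw [zero_add] at h4
  have h5 := h4.sub (hasDerivWithinAt_const t S (∫ x, G t x * Real.log (F t x) ∂μ))
  rw [sub_zero] at h5
  have e : ∀ s, ∫ x, G s x * Real.log (F s x) ∂μ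
      = ∫ x, (G s x - G t x) * (Real.log (F s x) - Real.log (F t x)) ∂μ
        + ∫ x, Real.log (F t x) * G s x ∂μ + ∫ x, G t x * Real.log (F s x) ∂μ
        - ∫ x, G t x * Real.log (F t x) ∂μ := by
    intro s
    have i1 : Integrable (fun x => (G s x - G t x) * (Real.log (F s x) - Real.log (F t x))) μ :=
      ((hGm s).sub (hGm t)).integrable_mul ((hl s).sub (hl t))
    have i2 : Integrable (fun x => Real.log (F t x) * G s x) μ := (hl t).integrable_mul (hGm s)
    have i3 : Integrable (fun x => G t x * Real.log (F s x)) μ := (hGm t).integrable_mul (hl s)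
    have i4 : Integrable (fun x => G t x * Real.log (F t x)) μ := (hGm t).integrable_mul (hl t)
    have i5 : Integrable (fun x => (G s x - G t x) * (Real.log (F s x) - Real.log (F t x))
        + Real.log (F t x) * G s x) μ := i1.add i2
    have i6 : Integrable (fun x => (G s x - G t x) * (Real.log (F s x) - Real.log (F t x))
        + Real.log (F t x) * G s x + G t x * Real.log (F s x)) μ := i5.add i3
    rw [← integral_add i1 i2, ← integral_add i5 i3, ← integral_sub i6 i4]
    refine integral_congr_ae (Eventually.of_forall fun x => ?_)
    ring
  exact h5.congr_of_eventuallyEq (Eventually.of_forall e) (e t)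

end L2

/-! ### Symmetry of the generator of the chain on the product space. -/

section CountableMeasure

variable {X : Type*} [MeasurableSpace X] [Countable X] [DiscreteMeasurableSpace X] {ν : Measure X}

theorem hasSum_integral_countable {f : X → ℝ} (hf : Integrable f ν) :
    HasSum (fun i => ν.real {i} * f i) (∫ i, f i ∂ν) := by
  have h1 := hasSum_integral_iUnion (μ := ν) (f := f) (s := fun j : X => {j})
    (fun j => MeasurableSet.of_discrete) (fun a b hab => Set.disjoint_singleton.2 hab)
    hf.integrableOn
  rw [Set.iUnion_of_singleton, setIntegral_univ] at h1
  simpa only [integral_singleton, smul_eq_mul] using h1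

theorem integrable_of_summable_countable [IsFiniteMeasure ν] {f : X → ℝ}
    (hf : Summable fun i => ν.real {i} * |f i|) : Integrable f ν := by
  rw [← Measure.sum_smul_dirac ν]
  exact integrable_sum_dirac (fun i => measure_ne_top _ _) hf

end CountableMeasure

theorem integrable_tsum_of_summable_norm {Ω ι : Type*} [MeasurableSpace Ω] [Countable ι]
    {μ : Measure Ω} {f : ι → Ω → ℝ} (hf : ∀ i, Integrable (f i) μ)
    (hs : Summable fun i => ∫ x, ‖f i x‖ ∂μ) :
    (∀ᵐ x ∂μ, Summable fun i => f i x) ∧ Integrable (fun x => ∑' i, f i x) μ := by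
  have h1 : Summable fun i => ‖(memLp_one_iff_integrable.2 (hf i)).toLp (f i)‖ := by
    refine hs.congr fun i => ?_
    rw [Lp.norm_toLp, eLpNorm_one_eq_lintegral_enorm, integral_norm_eq_lintegral_enorm (hf i).1]
  have h2 := Lp.hasSum_coeFn_tsum (tsum_enorm_ne_top_iff_summable_norm.2 h1)
  have h3 : ∀ᵐ x ∂μ, HasSum (fun i => f i x)
      ((∑' i, (memLp_one_iff_integrable.2 (hf i)).toLp (f i) : Lp ℝ 1 μ) x) := by
    filter_upwards [h2, ae_all_iff.2 fun i => (memLp_one_iff_integrable.2 (hf i)).coeFn_toLp]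
      with x hx hx'
    simpa only [hx'] using hx
  refine ⟨?_, ?_⟩
  · filter_upwards [h3] with x hx using hx.summable
  · refine (L1.integrable_coeFn _).congr (f := (∑' i, (memLp_one_iff_integrable.2 (hf i)).toLp (f i) :
      Lp ℝ 1 μ)) ?_
    filter_upwards [h3] with x hx using hx.tsum_eq.symm

section Symmetry

variable {E X : Type*} [MeasurableSpace E] [MeasurableSpace X] [Countable X]
  [DiscreteMeasurableSpace X] {Q : MarkovSemigroup X} {μ : Measure E} {ν : Measure X}
  [IsProbabilityMeasure μ] [IsProbabilityMeasure ν] {k : X → X → ℝ}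

omit [IsProbabilityMeasure μ] [IsProbabilityMeasure ν] in
theorem aestronglyMeasurable_of_slices {f : E × X → ℝ}
    (hf : ∀ i, AEStronglyMeasurable (slice f i) μ) : AEStronglyMeasurable f (μ.prod ν) := by
  refine ⟨fun z => (hf z.2).mk _ z.1, ?_, ?_⟩
  · exact (measurable_from_prod_countable_left (f := fun z : E × X => (hf z.2).mk _ z.1)
      fun i => (hf i).stronglyMeasurable_mk.measurable).stronglyMeasurable
  · exact ae_prod_of_forall_slice fun i => (hf i).ae_eq_mk

omit [DiscreteMeasurableSpace X] [IsProbabilityMeasure ν] in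
theorem integral_prod_congr_slices {f g : E × X → ℝ} (hf : Integrable f (μ.prod ν))
    (hg : Integrable g (μ.prod ν)) (h : ∀ i, ∫ x, f (x, i) ∂μ = ∫ x, g (x, i) ∂μ) :
    ∫ z, f z ∂(μ.prod ν) = ∫ z, g z ∂(μ.prod ν) := by
  rw [integral_prod_symm _ hf, integral_prod_symm _ hg]
  simp_rw [h]

omit [IsProbabilityMeasure ν] in
theorem hasSum_integral_slices {f : E × X → ℝ} (hf : Integrable f (μ.prod ν)) :
    HasSum (fun i => ν.real {i} * ∫ x, f (x, i) ∂μ) (∫ z, f z ∂(μ.prod ν)) := by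
  rw [integral_prod_symm _ hf]
  exact hasSum_integral_countable hf.integral_prod_right

namespace IsReversibleChain

variable (hk : IsReversibleChain Q k ν)
include hk

omit [Countable X] [DiscreteMeasurableSpace X] [IsProbabilityMeasure ν] in
-- Detailed balance turns the weighted column into a row.
theorem hasSum_column (j : X) : HasSum (fun i => ν.real {i} * |k i j|)
    (ν.real {j} * (2 * exitRate k j)) := by
  have h1 : ∀ i, ν.real {i} * |k i j| = ν.real {j} * |k j i| := fun i => by
    rw [← abs_of_pos (hk.pos i), ← abs_mul, hk.detailedBalance, abs_mul, abs_of_pos (hk.pos j)]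
  simp_rw [h1]
  rw [← hk.tsum_abs]
  exact (hk.summable_abs j).hasSum.mul_left _

theorem integrable_column (j : X) : Integrable (fun i => |k i j|) ν := by
  refine integrable_of_summable_countable ?_
  simpa only [abs_abs] using (hk.hasSum_column j).summable

theorem integral_column (j : X) : ∫ i, |k i j| ∂ν = ν.real {j} * (2 * exitRate k j) :=
  (hasSum_integral_countable (hk.integrable_column j)).unique (hk.hasSum_column j)

variable {b φ : E × X → ℝ} {B : ℝ} (hb : Measurable b) (hB : ∀ z, |b z| ≤ B)
  (hφ : Integrable φ (μ.prod ν)) (hφM : Integrable (fun z => exitRate k z.2 * φ z) (μ.prod ν))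
include hb hB hφ

/-- Integrating out the starting point of the jump gives a column sum, hence the weight `M₁(j)`.
Summed over `j`, the bound becomes `2B ∫ M₁ |φ|`, which is why integrability against the exit rate
is demanded. -/
theorem integrable_flux (j : X) :
    Integrable (fun z : E × X => k z.2 j * b z * φ (z.1, j)) (μ.prod ν) ∧
    ∫ z : E × X, ‖k z.2 j * b z * φ (z.1, j)‖ ∂(μ.prod ν)
      ≤ 2 * B * (ν.real {j} * ∫ x, |exitRate k j * φ (x, j)| ∂μ) := by
  have h1 : Integrable (slice φ j) μ := integrable_slice hφ (hk.measure_singleton_ne_zero j) (measure_ne_top _ _)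
  have h2 : Integrable (fun z : E × X => |φ (z.1, j)| * |k z.2 j|) (μ.prod ν) :=
    h1.abs.mul_prod (hk.integrable_column j)
  have hm : AEStronglyMeasurable (fun z : E × X => k z.2 j * b z * φ (z.1, j)) (μ.prod ν) := by
    refine aestronglyMeasurable_of_slices fun i => ?_
    exact ((hb.comp measurable_prodMk_right).const_mul (k i j)).aestronglyMeasurable.mul h1.1
  have h3 : ∀ z : E × X, ‖k z.2 j * b z * φ (z.1, j)‖ ≤ B * (|φ (z.1, j)| * |k z.2 j|) := by
    intro z
    rw [norm_mul, norm_mul, Real.norm_eq_abs, Real.norm_eq_abs, Real.norm_eq_abs]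
    calc |k z.2 j| * |b z| * |φ (z.1, j)| ≤ |k z.2 j| * B * |φ (z.1, j)| := by
          gcongr
          exact hB z
      _ = _ := by ring
  have h4 : Integrable (fun z : E × X => k z.2 j * b z * φ (z.1, j)) (μ.prod ν) :=
    (h2.const_mul B).mono' hm (Eventually.of_forall h3)
  refine ⟨h4, (integral_mono h4.norm (h2.const_mul B) h3).trans (le_of_eq ?_)⟩
  rw [integral_const_mul, integral_prod_mul (fun x => |φ (x, j)|) (fun i => |k i j|),
    hk.integral_column]
  simp_rw [abs_mul, abs_of_nonneg (hk.exitRate_nonneg j)]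
  rw [integral_const_mul]
  ring

include hφM

theorem summable_flux :
    Summable fun j => ∫ z : E × X, ‖k z.2 j * b z * φ (z.1, j)‖ ∂(μ.prod ν) := by
  refine Summable.of_nonneg_of_le (fun j => integral_nonneg fun z => norm_nonneg _)
    (fun j => (hk.integrable_flux hb hB hφ j).2) ?_
  exact (hasSum_integral_slices hφM.abs).summable.mul_left (2 * B)

omit hb hB in
theorem ae_summable_mul :
    ∀ᵐ z ∂(μ.prod ν), Summable fun j => k z.2 j * φ (z.1, j) := by
  have h1 := (integrable_tsum_of_summable_norm
    (fun j => (hk.integrable_flux (b := fun _ => 1) (B := 1) measurable_const (by simp) hφ j).1)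
    (hk.summable_flux (b := fun _ => 1) (B := 1) measurable_const (by simp) hφ hφM)).1
  filter_upwards [h1] with z hz
  simpa using hz

/-- The generator of the chain is symmetric, with respect to a bounded function and a function
which is integrable against the exit rate. -/
theorem integral_mul_discGen_comm :
    Integrable (fun z : E × X => b z * discGen k (fun j => φ (z.1, j)) z.2) (μ.prod ν) ∧
    Integrable (fun z : E × X => discGen k (fun j => b (z.1, j)) z.2 * φ z) (μ.prod ν) ∧
    ∫ z : E × X, b z * discGen k (fun j => φ (z.1, j)) z.2 ∂(μ.prod ν)
      = ∫ z : E × X, discGen k (fun j => b (z.1, j)) z.2 * φ z ∂(μ.prod ν) := by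
  have hflux := fun j => (hk.integrable_flux hb hB hφ j).1
  have hsum := hk.summable_flux hb hB hφ hφM
  have hslice := fun j => integrable_slice hφ (hk.measure_singleton_ne_zero j) (measure_ne_top _ _)
  have e1 : ∀ᵐ z ∂(μ.prod ν), ∑' j, k z.2 j * b z * φ (z.1, j)
      = b z * discGen k (fun j => φ (z.1, j)) z.2 := by
    filter_upwards [hk.ae_summable_mul hφ hφM] with z hz
    rw [hk.discGen_eq_tsum hz, ← tsum_mul_left]
    exact tsum_congr fun j => by ring
  have e2 : ∀ z : E × X, discGen k (fun j => b (z.1, j)) z.2 = ∑' i, k z.2 i * b (z.1, i) := fun z =>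
    hk.discGen_eq_tsum (hk.summable_mul_of_bounded (fun j => hB _) z.2)
  have I1 := (integrable_tsum_of_summable_norm hflux hsum).2.congr e1
  have hbs : ∀ i, Measurable (slice b i) := fun i => hb.comp measurable_prodMk_right
  have I2 : Integrable (fun z : E × X => discGen k (fun j => b (z.1, j)) z.2 * φ z) (μ.prod ν) := by
    refine (hφM.norm.const_mul (2 * B)).mono' ?_ (Eventually.of_forall fun z => ?_)
    · refine AEStronglyMeasurable.mul ?_ hφ.1
      simp_rw [e2]
      refine Measurable.aestronglyMeasurable ?_
      exact measurable_from_prod_countable_left fun j =>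
        Measurable.tsum fun i => (hbs i).const_mul (k j i)
    · rw [e2, norm_mul, norm_mul, Real.norm_of_nonneg (hk.exitRate_nonneg _)]
      have := hk.abs_tsum_le (a := fun i => b (z.1, i)) (fun j => hB _) z.2
      rw [Real.norm_eq_abs]
      calc _ ≤ 2 * exitRate k z.2 * B * ‖φ z‖ := by gcongr
        _ = _ := by ring
  refine ⟨I1, I2, ?_⟩
  rw [← integral_congr_ae e1]
  have h1 := hasSum_integral_of_summable_integral_norm hflux hsum
  have h2 := hasSum_integral_slices I2
  -- All jumps into `j` are collected; detailed balance makes them jumps out of `j`, so `L_d` now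
  -- acts on `b`.
  have e3 : ∀ j, ∫ z : E × X, k z.2 j * b z * φ (z.1, j) ∂(μ.prod ν)
      = ν.real {j} * ∫ x, discGen k (fun l => b (x, l)) j * φ (x, j) ∂μ := by
    intro j
    have hle : ∀ i x, ‖k j i * b (x, i) * φ (x, j)‖ ≤ |k j i| * B * |φ (x, j)| := by
      intro i x
      rw [norm_mul, norm_mul, Real.norm_eq_abs, Real.norm_eq_abs, Real.norm_eq_abs]
      gcongr
      exact hB _
    have hint : ∀ i, Integrable (fun x => k j i * b (x, i) * φ (x, j)) μ := fun i =>
      ((hslice j).abs.const_mul (|k j i| * B)).mono'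
        (((hbs i).const_mul (k j i)).aestronglyMeasurable.mul (hslice j).1)
        (Eventually.of_forall (hle i))
    have h4 : HasSum (fun i => ∫ x, k j i * b (x, i) * φ (x, j) ∂μ)
        (∫ x, ∑' i, k j i * b (x, i) * φ (x, j) ∂μ) := by
      refine hasSum_integral_of_summable_integral_norm hint ?_
      refine Summable.of_nonneg_of_le (fun i => integral_nonneg fun x => norm_nonneg _) (fun i =>
        integral_mono (hint i).norm ((hslice j).abs.const_mul (|k j i| * B)) (hle i)) ?_
      simp_rw [integral_const_mul, mul_assoc]
      exact (hk.summable_abs j).mul_right _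
    have e4 : ∀ x, ∑' i, k j i * b (x, i) * φ (x, j)
        = discGen k (fun l => b (x, l)) j * φ (x, j) := fun x => by
      rw [e2 (x, j), tsum_mul_right]
    have e5 : ∀ i, ν.real {i} * ∫ x, k i j * b (x, i) * φ (x, j) ∂μ
        = ν.real {j} * ∫ x, k j i * b (x, i) * φ (x, j) ∂μ := fun i => by
      simp_rw [mul_assoc, integral_const_mul, ← mul_assoc]
      rw [hk.detailedBalance]
    have h5 := h4.mul_left (ν.real {j})
    simp_rw [e4, ← e5] at h5
    exact (hasSum_integral_slices (hflux j)).unique h5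
  simp_rw [e3] at h1
  exact h1.unique h2

end IsReversibleChain

end Symmetry

/-! ### Integration by parts against exponentials. -/

section ContinuousPart

variable {E : Type*} [MeasurableSpace E] {P : MarkovSemigroup E} {μ : Measure E}
  [IsProbabilityMeasure μ] {𝒜 : Subalgebra ℝ (E → ℝ)}

/-- Integration by parts against `e^g` for the diffusion. -/
theorem integral_exp_mul_gen_sub_carre (hd : P.IsDiffusion μ 𝒜) (h : P.IsReversible μ)
    {g θ n : E → ℝ} (hg : g ∈ 𝒜) (hθ : P.InDomain μ θ) (hn : P.InDomain μ n)
    (hgn : P.InDomain μ (g * n)) :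
    Integrable (fun x => Real.exp (g x) * (P.gen μ θ x - 2 * P.carre μ g n x)) μ ∧
    ∫ x, Real.exp (g x) * (P.gen μ θ x - 2 * P.carre μ g n x) ∂μ
      = ∫ x, Real.exp (g x) * (P.gen μ g x + P.carreDiag μ g x) * (θ x + 2 * n x) ∂μ := by
  -- Expanding `2 e^g Γ(g,n) = e^g L(gn) - g e^g L n - e^g n L g` requires moving `L` onto `e^g` and
  -- `g e^g`. Both lie in the algebra, so `e^g n` need not be in the domain.
  have hH : ContDiff ℝ ∞ fun r : ℝ => r * Real.exp r := contDiff_id.mul Real.contDiff_exp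
  have hd1 : deriv (fun r : ℝ => r * Real.exp r) = fun r => (1 + r) * Real.exp r := by
    ext r
    have : HasDerivAt (fun r : ℝ => r * Real.exp r) (1 * Real.exp r + r * Real.exp r) r :=
      (hasDerivAt_id r).mul (Real.hasDerivAt_exp r)
    rw [this.deriv]
    ring
  have hd2 : deriv (deriv fun r : ℝ => r * Real.exp r) = fun r => (2 + r) * Real.exp r := by
    rw [hd1]
    ext r
    have : HasDerivAt (fun r : ℝ => (1 + r) * Real.exp r) (1 * Real.exp r + (1 + r) * Real.exp r) r :=
      ((hasDerivAt_id r).const_add 1).mul (Real.hasDerivAt_exp r)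
    rw [this.deriv]
    ring
  have mF : Real.exp ∘ g ∈ 𝒜 := hd.comp _ hg _ Real.contDiff_exp
  have mFg : (fun r : ℝ => r * Real.exp r) ∘ g ∈ 𝒜 := hd.comp _ hg _ hH
  have c1 := hd.chain _ hg _ Real.contDiff_exp
  have c2 := hd.chain _ hg _ hH
  have D1 := hd.domain _ mF
  have D2 := hd.domain _ mFg
  have s1 := h.integral_gen_mul_comm D1.hasGen hθ.hasGen
  have s2 := h.integral_gen_mul_comm D1.hasGen hgn.hasGen
  have s3 := h.integral_gen_mul_comm D2.hasGen hn.hasGen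
  have s4 : ∀ x, Real.exp (g x) * (P.gen μ θ x - 2 * P.carre μ g n x)
      = ((Real.exp ∘ g) x * P.gen μ θ x - (Real.exp ∘ g) x * P.gen μ (g * n) x)
        + (((fun r : ℝ => r * Real.exp r) ∘ g) x * P.gen μ n x
          + (Real.exp ∘ g) x * P.gen μ g x * n x) := by
    intro x
    rw [MarkovSemigroup.carre]
    simp only [Function.comp_apply]
    ring
  have mg := (hd.domain _ hg).memLp_gen
  have i1 : Integrable (fun x => (Real.exp ∘ g) x * P.gen μ θ x) μ :=
    D1.memLp.integrable_mul hθ.memLp_gen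
  have i2 : Integrable (fun x => (Real.exp ∘ g) x * P.gen μ (g * n) x) μ :=
    D1.memLp.integrable_mul hgn.memLp_gen
  have i3 : Integrable (fun x => ((fun r : ℝ => r * Real.exp r) ∘ g) x * P.gen μ n x) μ :=
    D2.memLp.integrable_mul hn.memLp_gen
  have i4 : Integrable (fun x => (Real.exp ∘ g) x * P.gen μ g x * n x) μ :=
    (hd.memLp_mul mF mg).integrable_mul hn.memLp
  have j1 : Integrable (fun x => P.gen μ (Real.exp ∘ g) x * θ x) μ :=
    D1.memLp_gen.integrable_mul hθ.memLp
  have j2 : Integrable (fun x => P.gen μ (Real.exp ∘ g) x * (g * n) x) μ :=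
    D1.memLp_gen.integrable_mul hgn.memLp
  have j3 : Integrable (fun x => P.gen μ ((fun r : ℝ => r * Real.exp r) ∘ g) x * n x) μ :=
    D2.memLp_gen.integrable_mul hn.memLp
  have i12 : Integrable (fun x => (Real.exp ∘ g) x * P.gen μ θ x
      - (Real.exp ∘ g) x * P.gen μ (g * n) x) μ := i1.sub i2
  have i34 : Integrable (fun x => ((fun r : ℝ => r * Real.exp r) ∘ g) x * P.gen μ n x
          + (Real.exp ∘ g) x * P.gen μ g x * n x) μ := i3.add i4
  have j12 : Integrable (fun x => P.gen μ (Real.exp ∘ g) x * θ x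
      - P.gen μ (Real.exp ∘ g) x * (g * n) x) μ := j1.sub j2
  have j34 : Integrable (fun x => P.gen μ ((fun r : ℝ => r * Real.exp r) ∘ g) x * n x
          + (Real.exp ∘ g) x * P.gen μ g x * n x) μ := j3.add i4
  constructor
  · simp_rw [s4]
    exact i12.add i34
  simp_rw [s4]
  rw [integral_add i12 i34, integral_sub i1 i2, integral_add i3 i4, ← s1, ← s2, ← s3,
    ← integral_sub j1 j2, ← integral_add j3 i4, ← integral_add j12 j34]
  refine integral_congr_ae ?_
  filter_upwards [c1, c2] with x c1 c2
  rw [c1, c2, hd2, hd1]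
  simp only [Real.deriv_exp, Pi.mul_apply, Function.comp_apply]
  ring

end ContinuousPart

namespace IsReversibleChain

variable {X : Type*} [MeasurableSpace X] {Q : MarkovSemigroup X} {k : X → X → ℝ} {ν : Measure X}
  (hk : IsReversibleChain Q k ν) {a : X → ℝ} {C : ℝ} (hC : ∀ j, |a j| ≤ C)
include hk hC

/-- From `e^r - 1 = r + Υ(r)`. This replaces the chain rule `L e^g = e^g (L g + Γ(g))` of the
diffusion and makes `Ψ_Υ` the counterpart of `Γ`. -/
theorem discGen_exp (i : X) : discGen k (fun j => Real.exp (a j)) i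
    = Real.exp (a i) * (discGen k a i + discPsi k upsilon a i) := by
  have hdiff : ∀ j, |a j - a i| ≤ C + C := fun j => (abs_sub _ _).trans (add_le_add (hC j) (hC i))
  have s1 : Summable fun j => k i j * (a j - a i) := hk.summable_mul_of_bounded hdiff i
  have s2 : Summable fun j => k i j * upsilon (a j - a i) :=
    hk.summable_mul_of_bounded (fun j => abs_upsilon_le (hdiff j)) i
  rw [discGen, discPsi, discGen, ← s1.tsum_add s2, ← tsum_mul_left]
  refine tsum_congr fun j => ?_
  have : Real.exp (a j) = Real.exp (a i) * Real.exp (a j - a i) := by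
    rw [← Real.exp_add]
    congr 1
    ring
  rw [this, upsilon]
  ring

/-- The integration by parts formula for the chain against `e^a`, in pointwise form. -/
theorem exp_mul_discGen_sub_discB {n : X → ℝ} {i : X} (θ : X → ℝ)
    (hn : Summable fun j => k i j * n j) :
    Real.exp (a i) * (discGen k θ i - discB k (deriv upsilon) a n i)
      = Real.exp (a i) * discGen k θ i - discGen k (fun j => Real.exp (a j) * n j) i
        + Real.exp (a i) * discGen k n i + discGen k (fun j => Real.exp (a j)) i * n i := by
  have hE : ∀ j, |Real.exp (a j)| ≤ Real.exp C := fun j => by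
    rw [Real.abs_exp]
    exact Real.exp_le_exp.2 ((le_abs_self _).trans (hC j))
  have sE : Summable fun j => k i j * Real.exp (a j) := hk.summable_mul_of_bounded hE i
  have sEn : Summable fun j => k i j * (Real.exp (a j) * n j) := by
    refine Summable.of_norm_bounded (hn.norm.mul_left (Real.exp C)) fun j => ?_
    rw [norm_mul, norm_mul, norm_mul, Real.norm_eq_abs (Real.exp _)]
    calc ‖k i j‖ * (|Real.exp (a j)| * ‖n j‖) ≤ ‖k i j‖ * (Real.exp C * ‖n j‖) := by
          gcongr
          exact hE j
      _ = _ := by ring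
  have hB : Real.exp (a i) * discB k (deriv upsilon) a n i
      = ∑' j, k i j * (Real.exp (a j) * n j) - Real.exp (a i) * ∑' j, k i j * n j
        - n i * ∑' j, k i j * Real.exp (a j) := by
    -- Since `e^{a_i} Υ'(a_j - a_i) = e^{a_j} - e^{a_i}`, the product with `n_j - n_i` has four
    -- terms; the one constant in `j` sums to zero.
    have s0 : HasSum (fun j => k i j * (Real.exp (a i) * n i)) 0 := by
      simpa using (hk.conservative i).mul_right (Real.exp (a i) * n i)
    have h1 := ((sEn.hasSum.sub (hn.hasSum.mul_left (Real.exp (a i)))).sub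
      (sE.hasSum.mul_left (n i))).add s0
    rw [add_zero] at h1
    rw [← h1.tsum_eq, discB, ← tsum_mul_left]
    refine tsum_congr fun j => ?_
    have : Real.exp (a j) = Real.exp (a i) * Real.exp (a j - a i) := by
      rw [← Real.exp_add]
      congr 1
      ring
    rw [deriv_upsilon, this]
    ring
  rw [mul_sub, hB, hk.discGen_eq_tsum hn, hk.discGen_eq_tsum sE, hk.discGen_eq_tsum sEn]
  ring

end IsReversibleChain

section Integral

variable {E X : Type*} [MeasurableSpace E] [MeasurableSpace X] [Countable X]
  [DiscreteMeasurableSpace X] {P : MarkovSemigroup E} {μ : Measure E} [IsProbabilityMeasure μ]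
  {𝒜 : Subalgebra ℝ (E → ℝ)} {Q : MarkovSemigroup X} {k : X → X → ℝ} {ν : Measure X}
  [IsProbabilityMeasure ν] {u : E × X → ℝ}

theorem integrable_bounded_mul {Ω : Type*} [MeasurableSpace Ω] {μ : Measure Ω} {b f : Ω → ℝ}
    {C : ℝ} (hb : Measurable b) (hC : ∀ x, |b x| ≤ C) (hf : Integrable f μ) :
    Integrable (fun x => b x * f x) μ :=
  hf.bdd_mul hb.aestronglyMeasurable (Eventually.of_forall hC)

/-- The diffusion part and the chain part are integrated by parts separately. Each leaves `2N + Θ`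
multiplied by its own generator of `e^u`, and these generators add up to `e^u (N + Θ)`. -/
theorem IsRegular.integral_exp_mul_hybridTwo (hu : IsRegular P μ 𝒜 k u) (hd : P.IsDiffusion μ 𝒜)
    (hk : IsReversibleChain Q k ν) (h : P.IsReversible μ) (hm : Measurable u)
    (hgen : MemLp (fun z : E × X => P.gen μ (slice u z.2) z.1) 2 (μ.prod ν))
    (hcarre : MemLp (fun z : E × X => P.carreDiag μ (slice u z.2) z.1) 2 (μ.prod ν))
    (hN : MemLp (hybridGen P μ k u) 2 (μ.prod ν)) (hΘ : MemLp (hybridGamma P μ k u) 2 (μ.prod ν))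
    (hMN : Integrable (fun z => exitRate k z.2 * hybridGen P μ k u z) (μ.prod ν))
    (hMΘ : Integrable (fun z => exitRate k z.2 * hybridGamma P μ k u z) (μ.prod ν))
    (htwo : Integrable (hybridTwo P μ k u) (μ.prod ν)) :
    Integrable (fun z => Real.exp (u z) * hybridTwo P μ k u z) (μ.prod ν) ∧
    2 * ∫ z, Real.exp (u z) * hybridTwo P μ k u z ∂(μ.prod ν)
      = ∫ z, Real.exp (u z) * (hybridGen P μ k u z + hybridGamma P μ k u z) *
        (2 * hybridGen P μ k u z + hybridGamma P μ k u z) ∂(μ.prod ν) := by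
  obtain ⟨C, hC⟩ := hu.bounded
  set N := hybridGen P μ k u with hNdef
  set Θ := hybridGamma P μ k u with hΘdef
  set F : E × X → ℝ := fun z => Real.exp (u z) with hF
  have hFm : Measurable F := Real.measurable_exp.comp hm
  have hFb : ∀ z, |F z| ≤ Real.exp C := fun z => by
    rw [hF, Real.abs_exp]
    exact Real.exp_le_exp.2 ((le_abs_self _).trans (hC z))
  have hNi : Integrable N (μ.prod ν) := hN.integrable (by norm_num)
  have hΘi : Integrable Θ (μ.prod ν) := hΘ.integrable (by norm_num)
  have hFN : Integrable (fun z => F z * N z) (μ.prod ν) := integrable_bounded_mul hFm hFb hNi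
  have hMFN : Integrable (fun z => exitRate k z.2 * (F z * N z)) (μ.prod ν) := by
    refine (integrable_bounded_mul hFm hFb hMN).congr (Eventually.of_forall fun z => ?_)
    ring
  obtain ⟨a1, a2, a3⟩ := hk.integral_mul_discGen_comm hFm hFb hΘi hMΘ
  obtain ⟨b1, b2, b3⟩ := hk.integral_mul_discGen_comm hFm hFb hNi hMN
  -- Symmetry against the constant `1` shows that `L_d (F N)` is integrable with integral zero.
  obtain ⟨c1, c2, c3⟩ := hk.integral_mul_discGen_comm (b := fun _ => 1) (B := 1) measurable_const
    (by simp) hFN hMFN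
  have c0 : ∀ i, discGen k (fun _ => (1 : ℝ)) i = 0 := fun i => by simp [discGen]
  simp only [c0, zero_mul, integral_zero, one_mul] at c1 c3
  set D : E × X → ℝ := fun z => F z * discGen k (fun j => Θ (z.1, j)) z.2
    - discGen k (fun j => F (z.1, j) * N (z.1, j)) z.2 + F z * discGen k (fun j => N (z.1, j)) z.2
    + discGen k (fun j => F (z.1, j)) z.2 * N z with hD
  have hDi : Integrable D (μ.prod ν) := ((a1.sub c1).add b1).add b2
  have hDint : ∫ z, D z ∂(μ.prod ν)
      = ∫ z, discGen k (fun j => F (z.1, j)) z.2 * (Θ z + 2 * N z) ∂(μ.prod ν) := by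
    have e1 := integral_add ((a1.sub c1).add b1) b2
    have e2 := integral_add (a1.sub c1) b1
    have e3 := integral_sub a1 c1
    have e4 := integral_add (a2.add b2) b2
    have e5 := integral_add a2 b2
    simp only [Pi.add_apply, Pi.sub_apply] at e1 e2 e3 e4 e5
    rw [hD, e1, e2, e3, c3, a3, b3, sub_zero, ← e5, ← e4]
    refine integral_congr_ae (Eventually.of_forall fun z => ?_)
    ring
  have hDI : Integrable (fun z => discGen k (fun j => F (z.1, j)) z.2 * (Θ z + 2 * N z))
      (μ.prod ν) := by
    refine ((a2.add b2).add b2).congr (Eventually.of_forall fun z => ?_)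
    simp only [Pi.add_apply]
    ring
  set K : E × X → ℝ := fun z => F z * (P.gen μ (slice Θ z.2) z.1
    - 2 * P.carre μ (slice u z.2) (slice N z.2) z.1) with hK
  have hFtwo : Integrable (fun z => F z * hybridTwo P μ k u z) (μ.prod ν) :=
    integrable_bounded_mul hFm hFb htwo
  have hsplit : ∀ᵐ z ∂(μ.prod ν), 2 * (F z * hybridTwo P μ k u z) = K z + D z := by
    filter_upwards [hk.ae_summable_mul hNi hMN] with z h2
    have h3 := hk.exp_mul_discGen_sub_discB (a := fun j => u (z.1, j)) (fun j => hC _)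
      (fun j => Θ (z.1, j)) h2
    have h4 := hybridTwo_apply P μ k u z.1 z.2
    rw [Prod.mk.eta] at h4
    rw [h4, hK, hD]
    simp only [hF] at h3 ⊢
    rw [← h3]
    ring
  -- Integrability of the diffusion part on each slice does not give it on the product; it is
  -- obtained as the difference of `2 F (Γ ⊕ Ψ_Υ)₂(u)` and the chain part.
  have hKi : Integrable K (μ.prod ν) := by
    refine ((hFtwo.const_mul 2).sub hDi).congr ?_
    filter_upwards [hsplit] with z hz
    simp only [Pi.sub_apply]
    rw [hz]
    ring
  set e : E × X → ℝ := fun z => F z * (P.gen μ (slice u z.2) z.1 + P.carreDiag μ (slice u z.2) z.1)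
  have he : MemLp e 2 (μ.prod ν) :=
    memLp_mul_of_bounded hFm.aestronglyMeasurable hFb (hgen.add hcarre)
  have heI : Integrable (fun z => e z * (Θ z + 2 * N z)) (μ.prod ν) :=
    he.integrable_mul (hΘ.add (hN.const_mul 2))
  have hKint : ∫ z, K z ∂(μ.prod ν) = ∫ z, e z * (Θ z + 2 * N z) ∂(μ.prod ν) :=
    integral_prod_congr_slices hKi heI fun i =>
      (integral_exp_mul_gen_sub_carre hd h (hu.slice_mem i) (hu.inDomain_hybridGamma hd hk h i)
        (hu.inDomain_hybridGen hd hk h i) (hu.inDomain_mul_hybridGen hd hk h i)).2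
  refine ⟨hFtwo, ?_⟩
  rw [← integral_const_mul, integral_congr_ae hsplit, integral_add hKi hDi, hKint, hDint,
    ← integral_add heI hDI]
  refine integral_congr_ae (Eventually.of_forall fun z => ?_)
  have h1 := hk.discGen_exp (a := fun j => u (z.1, j)) (fun j => hC _) z.2
  have h2 : N z = P.gen μ (slice u z.2) z.1 + discGen k (fun j => u (z.1, j)) z.2 := rfl
  have h3 : Θ z = P.carreDiag μ (slice u z.2) z.1 + discPsi k upsilon (fun j => u (z.1, j)) z.2 := rfl
  simp only [e, hF, h1]
  rw [h2, h3]
  ring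

end Integral

/-! ### Derivatives of the entropy along the flow. -/

theorem MarkovSemigroup.act_mem_Icc {Ω : Type*} [MeasurableSpace Ω] (P : MarkovSemigroup Ω)
    {f : Ω → ℝ} (hf : Measurable f) {c C : ℝ} (hcC : ∀ z, f z ∈ Set.Icc c C) (t : ℝ≥0) (z : Ω) :
    P.act t f z ∈ Set.Icc c C := by
  have hi : Integrable f (P.kernel t z) := Integrable.of_mem_Icc c C hf.aemeasurable
    (Eventually.of_forall hcC)
  constructor
  · have := integral_mono (μ := P.kernel t z) (integrable_const c) hi fun x => (hcC x).1
    simpa [MarkovSemigroup.act] using this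
  · have := integral_mono (μ := P.kernel t z) hi (integrable_const C) fun x => (hcC x).2
    simpa [MarkovSemigroup.act] using this

namespace MarkovSemigroup

variable {Ω : Type*} [MeasurableSpace Ω] {P : MarkovSemigroup Ω} {μ : Measure Ω}
  [IsProbabilityMeasure μ]

theorem IsReversible.hasDerivWithinAt_toLp_act (h : P.IsReversible μ) {f g : Ω → ℝ}
    (hfg : P.HasGen μ f g) {t : ℝ} (ht : 0 ≤ t) :
    HasDerivWithinAt (fun s : ℝ => (h.memLp_act s.toNNReal hfg.1).toLp _)
      ((h.memLp_act t.toNNReal hfg.2.1).toLp _) (Set.Ici 0) t := by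
  have := (h.isGen hfg).hasDerivWithinAt_orbit ht
  rw [SymmSemigroup.orbit, h.toSymm_toLp] at this
  refine this.congr (fun s _ => ?_) ?_ <;> rw [SymmSemigroup.orbit, h.toSymm_toLp]

theorem IsReversible.integral_act (h : P.IsReversible μ) (t : ℝ≥0) {f : Ω → ℝ}
    (hf : MemLp f 2 μ) : ∫ x, P.act t f x ∂μ = ∫ x, f x ∂μ := by
  have h1 := h.toSymm.symm t (hf.toLp f) ((memLp_const (1 : ℝ)).toLp _)
  rw [h.toSymm_toLp, h.toSymm_toLp, inner_toLp, inner_toLp] at h1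
  simpa [act] using h1

end MarkovSemigroup

namespace IsRegularDensity

variable {E X : Type*} [MeasurableSpace E] [MeasurableSpace X] [Countable X]
  [DiscreteMeasurableSpace X] {P : MarkovSemigroup E} {μ : Measure E} [IsProbabilityMeasure μ]
  {𝒜 : Subalgebra ℝ (E → ℝ)} {Q : MarkovSemigroup X} {k : X → X → ℝ} {ν : Measure X}
  [IsProbabilityMeasure ν] {f : E × X → ℝ}
  (hf : IsRegularDensity P μ 𝒜 Q k ν f)
include hf

omit [Countable X] [DiscreteMeasurableSpace X] [IsProbabilityMeasure μ] [IsProbabilityMeasure ν] in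
theorem flow_bounds : ∃ c C : ℝ, 0 < c ∧ ∀ t z, (P.prod Q).act t f z ∈ Set.Icc c C := by
  obtain ⟨c, C, hc, hcC⟩ := hf.bounds
  exact ⟨c, C, hc, fun t z => (P.prod Q).act_mem_Icc hf.measurable hcC t z⟩

omit [Countable X] [DiscreteMeasurableSpace X] [IsProbabilityMeasure μ] [IsProbabilityMeasure ν] in
theorem exp_logFlow (t : ℝ≥0) (z : E × X) :
    Real.exp (logFlow P Q t f z) = (P.prod Q).act t f z := by
  obtain ⟨c, C, hc, h⟩ := hf.flow_bounds
  exact Real.exp_log (hc.trans_le (h t z).1)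

omit [Countable X] [DiscreteMeasurableSpace X] [IsProbabilityMeasure μ] [IsProbabilityMeasure ν] in
theorem measurable_logFlow (t : ℝ≥0) : Measurable (logFlow P Q t f) :=
  Real.measurable_log.comp (MarkovSemigroup.measurable_act _ hf.measurable t)

variable (hd : P.IsDiffusion μ 𝒜) (hk : IsReversibleChain Q k ν) (h : P.IsReversible μ)
include hd hk h

theorem gen_logFlow (t : ℝ≥0) :
    (P.prod Q).gen (μ.prod ν) (logFlow P Q t f) =ᵐ[μ.prod ν] hybridGen P μ k (logFlow P Q t f) := by
  obtain ⟨C, hC⟩ := (hf.log_regular t).bounded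
  exact ae_prod_of_forall_slice fun i => gen_prod_slice h hk
    (hf.measurable_logFlow t) hC (hf.log_domain t).hasGen
    (fun j => hd.domain _ ((hf.log_regular t).slice_mem j)) i

theorem hasGen_logFlow (t : ℝ≥0) : (P.prod Q).HasGen (μ.prod ν) (logFlow P Q t f)
    (hybridGen P μ k (logFlow P Q t f)) :=
  (h.prod hk.reversible).hasGen_congr (hf.log_domain t).hasGen .rfl (hf.gen_logFlow hd hk h t)

/-- `P_t L f = L P_t f`, and `P_t f` is the exponential of `g = log P_t f`; the rules for
exponentials in the two variables combine to `L e^g = e^g (L g + (Γ ⊕ Ψ_Υ)(g))`. -/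
theorem act_gen (t : ℝ≥0) : (P.prod Q).act t ((P.prod Q).gen (μ.prod ν) f) =ᵐ[μ.prod ν]
    fun z => (P.prod Q).act t f z * (hybridGen P μ k (logFlow P Q t f) z
      + hybridGamma P μ k (logFlow P Q t f) z) := by
  obtain ⟨C, hC⟩ := (hf.log_regular t).bounded
  obtain ⟨c', C', hc', hcC'⟩ := hf.flow_bounds
  have e : ∀ i, slice ((P.prod Q).act t f) i = Real.exp ∘ slice (logFlow P Q t f) i := fun i => by
    ext x
    exact (hf.exp_logFlow t (x, i)).symm
  refine ae_prod_of_forall_slice fun i => ?_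
  have hb : ∀ z, |(P.prod Q).act t f z| ≤ C' := fun z => by
    rw [abs_of_pos (hc'.trans_le (hcC' t z).1)]
    exact (hcC' t z).2
  have h1 := gen_prod_slice h hk (MarkovSemigroup.measurable_act _ hf.measurable t) hb
    ((h.prod hk.reversible).hasGen_act hf.domain.hasGen t) (fun j => by
      rw [e]
      exact hd.domain _ (hd.comp _ ((hf.log_regular t).slice_mem j) _ Real.contDiff_exp)) i
  filter_upwards [h1, hd.chain _ ((hf.log_regular t).slice_mem i) _ Real.contDiff_exp] with x h1 h2
  have h3 := hk.discGen_exp (a := fun j => logFlow P Q t f (x, j)) (fun j => hC _) i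
  simp only [hf.exp_logFlow] at h3
  rw [h1, hybridGen_apply, e, h2, h3, hybridGen_apply, hybridGamma_apply]
  simp only [Real.deriv_exp, hf.exp_logFlow]
  ring

/-- Solving `L F = F (L g + Θ)` for `Θ` exhibits it as a difference of two `L²` functions, since `F`
is bounded away from zero. -/
theorem memLp_hybridGamma (t : ℝ≥0) :
    MemLp (hybridGamma P μ k (logFlow P Q t f)) 2 (μ.prod ν) := by
  obtain ⟨c, C, hc, hcC⟩ := hf.flow_bounds
  have h1 := (h.prod hk.reversible).memLp_act t hf.domain.memLp_gen
  have h2 := memLp_mul_of_bounded (f := fun z => ((P.prod Q).act t f z)⁻¹) (C := c⁻¹)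
    (MarkovSemigroup.measurable_act _ hf.measurable t).inv.aestronglyMeasurable (fun z => by
      rw [abs_of_pos (inv_pos.2 (hc.trans_le (hcC t z).1))]
      have := (hcC t z).1
      gcongr) h1
  refine (h2.sub (hf.hasGen_logFlow hd hk h t).2.1).ae_eq ?_
  filter_upwards [hf.act_gen hd hk h t] with z hz
  have := (hc.trans_le (hcC t z).1).ne'
  simp only [Pi.sub_apply]
  rw [hz]
  field_simp
  ring

theorem integrable_flow_mul_hybridGamma (t : ℝ≥0) :
    Integrable (fun z => (P.prod Q).act t f z * hybridGamma P μ k (logFlow P Q t f) z)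
      (μ.prod ν) :=
  ((h.prod hk.reversible).memLp_act t hf.domain.memLp).integrable_mul
    (hf.memLp_hybridGamma hd hk h t)

/-- The entropy production, `∫ (L P_t f) log P_t f dμ = -ℐ(P_t f)`. -/
theorem integral_act_gen_mul_log (t : ℝ≥0) :
    ∫ z, (P.prod Q).act t ((P.prod Q).gen (μ.prod ν) f) z * logFlow P Q t f z ∂(μ.prod ν)
      = -fisher P μ k ν ((P.prod Q).act t f) := by
  have hr := h.prod hk.reversible
  have hF := hr.hasGen_act hf.domain.hasGen t
  have hg := hf.hasGen_logFlow hd hk h t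
  have h1 := hr.integral_gen_mul_comm hF hg
  have h0 := hr.integral_gen_eq_zero hF
  have i1 : Integrable (fun z => (P.prod Q).act t f z * hybridGen P μ k (logFlow P Q t f) z)
      (μ.prod ν) := hF.1.integrable_mul hg.2.1
  rw [integral_congr_ae (hf.act_gen hd hk h t)] at h0
  simp_rw [mul_add] at h0
  rw [integral_add i1 (hf.integrable_flow_mul_hybridGamma hd hk h t)] at h0
  rw [h1, fisher]
  exact eq_neg_of_add_eq_zero_left h0

theorem hasDerivWithinAt_flowEntropy {t : ℝ} (ht : 0 ≤ t) :
    HasDerivWithinAt (flowEntropy P μ Q ν f) (-fisher P μ k ν ((P.prod Q).act t.toNNReal f))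
      (Set.Ici 0) t := by
  obtain ⟨c, C, hc, hcC⟩ := hf.flow_bounds
  have hr := h.prod hk.reversible
  have hF := hr.hasGen_act hf.domain.hasGen t.toNNReal
  have h1 := hasDerivWithinAt_integral_mul_log_self (fun s : ℝ => hr.memLp_act s.toNNReal hf.domain.memLp)
    (hr.memLp_act t.toNNReal hf.domain.memLp_gen) (hr.hasDerivWithinAt_toLp_act hf.domain.hasGen ht)
    hc (fun s z => (hcC _ z).1) (fun s z => (hcC _ z).2)
  refine h1.congr_deriv ?_
  symm
  -- The derivative of `r log r` is `log r + 1`; the `1` contributes `∫ L P_t f dμ = 0`.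
  rw [← hf.integral_act_gen_mul_log hd hk h, ← add_zero (∫ z, _ ∂_), ← hr.integral_gen_eq_zero hF,
    ← integral_add _ (hF.2.1.integrable (by norm_num))]
  · refine integral_congr_ae (Eventually.of_forall fun z => ?_)
    simp only [logFlow]
    ring
  · exact hF.2.1.integrable_mul (hf.log_domain _).memLp

theorem derivWithin_flowEntropy {t : ℝ} (ht : 0 ≤ t) :
    derivWithin (flowEntropy P μ Q ν f) (Set.Ici 0) t
      = -fisher P μ k ν ((P.prod Q).act t.toNNReal f) :=
  (hf.hasDerivWithinAt_flowEntropy hd hk h ht).derivWithin (uniqueDiffOn_Ici 0 t ht)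

theorem integral_flow_mul_hybridTwo (t : ℝ≥0) :
    Integrable (fun z => (P.prod Q).act t f z * hybridTwo P μ k (logFlow P Q t f) z)
      (μ.prod ν) ∧
    2 * ∫ z, (P.prod Q).act t f z * hybridTwo P μ k (logFlow P Q t f) z ∂(μ.prod ν)
      = ∫ z, (P.prod Q).act t f z * (hybridGen P μ k (logFlow P Q t f) z
          + hybridGamma P μ k (logFlow P Q t f) z) * (2 * hybridGen P μ k (logFlow P Q t f) z
          + hybridGamma P μ k (logFlow P Q t f) z) ∂(μ.prod ν) := by
  have h1 := (hf.log_regular t).integral_exp_mul_hybridTwo hd hk h (hf.measurable_logFlow t)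
    (hf.memLp_gen t) (hf.memLp_carre t) (hf.hasGen_logFlow hd hk h t).2.1
    (hf.memLp_hybridGamma hd hk h t) (hf.integrable_gen t) (hf.integrable_gamma t)
    (hf.integrable_two t)
  simpa only [hf.exp_logFlow] using h1

/-- The first derivative is `∫ (L F) log F`. The product rule gives `∫ log F · L²F + ∫ (L F)²/F`;
symmetry turns the first integral into `∫ L(log F) L F`, and `L F = F (N + Θ)` leads to `∫ F (N +
Θ)(2N + Θ)`. -/
theorem hasDerivWithinAt_derivWithin_flowEntropy {t : ℝ} (ht : 0 ≤ t) :
    HasDerivWithinAt (derivWithin (flowEntropy P μ Q ν f) (Set.Ici 0))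
      (2 * ∫ z, (P.prod Q).act t.toNNReal f z *
        hybridTwo P μ k (logFlow P Q t.toNNReal f) z ∂(μ.prod ν)) (Set.Ici 0) t := by
  obtain ⟨c, C, hc, hcC⟩ := hf.flow_bounds
  have hr := h.prod hk.reversible
  have hG := hr.hasGen_act hf.domain_sq.hasGen t.toNNReal
  have hg := hf.hasGen_logFlow hd hk h t.toNNReal
  have h1 := hasDerivWithinAt_integral_curve_mul_log
    (fun s : ℝ => hr.memLp_act s.toNNReal hf.domain.memLp)
    (hr.memLp_act t.toNNReal hf.domain.memLp_gen) (hr.hasDerivWithinAt_toLp_act hf.domain.hasGen ht)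
    hc (fun s z => (hcC _ z).1) (fun s z => (hcC _ z).2)
    (fun s : ℝ => hr.memLp_act s.toNNReal hf.domain.memLp_gen)
    (hr.memLp_act t.toNNReal hf.domain_sq.memLp_gen)
    (hr.hasDerivWithinAt_toLp_act hf.domain_sq.hasGen ht)
  refine (h1.congr_deriv ?_).congr (fun s hs => ?_) ?_
  · have h2 := hr.integral_gen_mul_comm hg hG
    rw [(hf.integral_flow_mul_hybridTwo hd hk h _).2]
    refine (congrArg (· + _) h2.symm).trans ?_
    rw [← integral_add]
    · refine integral_congr_ae ?_
      filter_upwards [hf.act_gen hd hk h t.toNNReal] with z hz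
      have := (hc.trans_le (hcC t.toNNReal z).1).ne'
      simp only [hz]
      field_simp
      ring
    · exact hg.2.1.integrable_mul hG.1
    · refine (hG.1.integrable_mul (hg.2.1.add (hf.memLp_hybridGamma hd hk h t.toNNReal))).congr ?_
      filter_upwards [hf.act_gen hd hk h t.toNNReal] with z hz
      have := (hc.trans_le (hcC t.toNNReal z).1).ne'
      simp only [Pi.mul_apply, Pi.add_apply, hz]
      field_simp
  · rw [hf.derivWithin_flowEntropy hd hk h hs, ← hf.integral_act_gen_mul_log hd hk h]
    rfl
  · rw [hf.derivWithin_flowEntropy hd hk h ht, ← hf.integral_act_gen_mul_log hd hk h]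
    rfl

/-- The differential inequality for the entropy along the flow. -/
theorem mul_derivWithin_flowEntropy_le {κc κd : ℝ} (hκc : P.CD μ 𝒜 κc) (hκd : CDUpsilon k κd)
    {t : ℝ} (ht : 0 ≤ t) :
    -2 * min κc κd * derivWithin (flowEntropy P μ Q ν f) (Set.Ici 0) t ≤
      derivWithin (derivWithin (flowEntropy P μ Q ν f) (Set.Ici 0)) (Set.Ici 0) t := by
  obtain ⟨c, C, hc, hcC⟩ := hf.flow_bounds
  rw [(hf.hasDerivWithinAt_derivWithin_flowEntropy hd hk h ht).derivWithin
    (uniqueDiffOn_Ici 0 t ht), hf.derivWithin_flowEntropy hd hk h ht, fisher,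
    show ∀ a b : ℝ, -2 * a * -b = 2 * (a * b) from fun a b => by ring, ← integral_const_mul]
  gcongr 2 * ?_
  refine integral_mono_ae ((hf.integrable_flow_mul_hybridGamma hd hk h _).const_mul _)
    (hf.integral_flow_mul_hybridTwo hd hk h _).1 ?_
  filter_upwards [(hf.log_regular t.toNNReal).mul_hybridGamma_le_hybridTwo hd hk h hκc hκd]
    with z hz
  have := mul_le_mul_of_nonneg_left hz (hc.le.trans (hcC t.toNNReal z).1)
  refine le_trans (le_of_eq ?_) this
  exact mul_left_comm _ _ _

end IsRegularDensity

/-! ### Ergodicity and convergence to equilibrium. -/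

section Kernel

variable {Ω : Type*} [MeasurableSpace Ω] {μ : Measure Ω} {κ : Kernel Ω Ω}

/-- A density that does not change along almost every transition can be moved through the kernel. -/
theorem invariant_withDensity (h : κ.Invariant μ) {ψ : Ω → ℝ≥0∞} (hψ : Measurable ψ)
    (he : ∀ᵐ x ∂μ, ∀ᵐ y ∂(κ x), ψ y = ψ x) : κ.Invariant (μ.withDensity ψ) := by
  ext B hB
  rw [Measure.bind_apply hB κ.aemeasurable, lintegral_withDensity_eq_lintegral_mul _ hψ
    (κ.measurable_coe hB), withDensity_apply _ hB, ← lintegral_indicator hB,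
    ← lintegral_lintegral_of_invariant h (hψ.indicator hB).aemeasurable]
  refine lintegral_congr_ae ?_
  filter_upwards [he] with x hx
  have : ∫⁻ y, B.indicator ψ y ∂(κ x) = ∫⁻ y, B.indicator (fun _ => ψ x) y ∂(κ x) := by
    refine lintegral_congr_ae ?_
    filter_upwards [hx] with y hy
    by_cases hyB : y ∈ B <;> simp [hyB, hy]
  rw [this, lintegral_indicator_const hB, Pi.mul_apply]

/-- `∫∫ (φ(y) - φ(x))² κ(x,dy) μ(dx) = 2 ∫ φ² - 2 ∫ φ κφ`, which vanishes when `κφ = φ`. -/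
theorem ae_ae_eq_of_integral_kernel_eq [IsProbabilityMeasure μ] [IsMarkovKernel κ]
    (h : κ.Invariant μ) {φ : Ω → ℝ} (hφ : MemLp φ 2 μ)
    (he : ∀ᵐ x ∂μ, ∫ y, φ y ∂(κ x) = φ x) : ∀ᵐ x ∂μ, ∀ᵐ y ∂(κ x), φ y = φ x := by
  have h1 : MemLp (fun p : Ω × Ω => φ p.1) 2 (μ ⊗ₘ κ) :=
    hφ.comp_measurePreserving measurePreserving_fst_compProd
  have h2 : MemLp (fun p : Ω × Ω => φ p.2) 2 (μ ⊗ₘ κ) :=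
    hφ.comp_measurePreserving (measurePreserving_snd_compProd h)
  have i0 : Integrable (fun p : Ω × Ω => (φ p.2 - φ p.1) ^ 2) (μ ⊗ₘ κ) := (h2.sub h1).integrable_sq
  have i1 : Integrable (fun p : Ω × Ω => φ p.2 ^ 2) (μ ⊗ₘ κ) := h2.integrable_sq
  have i2 : Integrable (fun p : Ω × Ω => φ p.1 ^ 2) (μ ⊗ₘ κ) := h1.integrable_sq
  have i3 : Integrable (fun p : Ω × Ω => φ p.1 * φ p.2) (μ ⊗ₘ κ) := integrable_mul_compProd h hφ hφ
  have e1 : ∫ p : Ω × Ω, φ p.2 ^ 2 ∂(μ ⊗ₘ κ) = ∫ x, φ x ^ 2 ∂μ := by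
    conv_rhs => rw [← (measurePreserving_snd_compProd h).map_eq]
    rw [integral_map measurable_snd.aemeasurable]
    rw [(measurePreserving_snd_compProd h).map_eq]
    exact hφ.1.pow 2
  have e2 : ∫ p : Ω × Ω, φ p.1 ^ 2 ∂(μ ⊗ₘ κ) = ∫ x, φ x ^ 2 ∂μ := by
    conv_rhs => rw [← (measurePreserving_fst_compProd (μ := μ) (κ := κ)).map_eq]
    rw [integral_map measurable_fst.aemeasurable]
    rw [(measurePreserving_fst_compProd (μ := μ) (κ := κ)).map_eq]
    exact hφ.1.pow 2
  have e3 : ∫ p : Ω × Ω, φ p.1 * φ p.2 ∂(μ ⊗ₘ κ) = ∫ x, φ x ^ 2 ∂μ := by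
    rw [integral_mul_compProd h hφ hφ]
    refine integral_congr_ae ?_
    filter_upwards [he] with x hx
    rw [hx, sq]
  have e0 : ∫ p : Ω × Ω, (φ p.2 - φ p.1) ^ 2 ∂(μ ⊗ₘ κ) = 0 := by
    have e4 := integral_sub (i1.add i2) (i3.const_mul 2)
    have e5 := integral_add i1 i2
    simp only [Pi.add_apply] at e4 e5
    rw [e5, integral_const_mul, e1, e2, e3] at e4
    rw [show ∫ x, φ x ^ 2 ∂μ + ∫ x, φ x ^ 2 ∂μ - 2 * ∫ x, φ x ^ 2 ∂μ = 0 by ring] at e4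
    rw [← e4]
    refine integral_congr_ae (Eventually.of_forall fun p => ?_)
    ring
  rw [integral_eq_zero_iff_of_nonneg (fun p => sq_nonneg _) i0] at e0
  filter_upwards [Measure.ae_ae_of_ae_compProd e0] with x hx
  filter_upwards [hx] with y hy
  exact sub_eq_zero.1 (pow_eq_zero_iff two_ne_zero |>.1 hy)

end Kernel

namespace MarkovSemigroup

variable {Ω : Type*} [MeasurableSpace Ω] {P : MarkovSemigroup Ω} {μ : Measure Ω}

/-- Any time `t` is `n + 1` steps of length `t / (n + 1)`, and the steps become arbitrarily short.
-/
theorem invariant_of_eventually (h : ∀ᶠ t in 𝓝[>] 0, (P.kernel t).Invariant μ) (t : ℝ≥0) :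
    (P.kernel t).Invariant μ := by
  have hz : (P.kernel 0).Invariant μ := by
    rw [P.zero, Kernel.Invariant, Measure.id_comp]
  have hmul : ∀ (n : ℕ) (s : ℝ≥0), (P.kernel s).Invariant μ → (P.kernel (n * s)).Invariant μ := by
    intro n s hs
    induction n with
    | zero => simpa using hz
    | succ n ih =>
      rw [Nat.cast_succ, add_mul, one_mul, P.add]
      exact ih.comp hs
  rcases eq_zero_or_pos t with rfl | ht
  · exact hz
  have h1 : Tendsto (fun n : ℕ => t / ((n : ℝ≥0) + 1)) atTop (𝓝[>] 0) := by
    refine tendsto_nhdsWithin_iff.2 ⟨?_, Eventually.of_forall fun n => ?_⟩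
    · have := tendsto_one_div_add_atTop_nhds_zero_nat (𝕜 := ℝ≥0)
      simpa [div_eq_mul_inv] using this.const_mul t
    · exact div_pos ht (by positivity)
  obtain ⟨n, hn⟩ := (h1.eventually h).exists
  have h2 := hmul (n + 1) _ hn
  rwa [Nat.cast_succ, mul_div_cancel₀ t (by positivity)] at h2

/-- A function that is invariant along the semigroup for small times is constant, if the
semigroup has a unique invariant measure. -/
theorem HasUniqueInvariant.ae_eq_const [IsProbabilityMeasure μ] (hu : P.HasUniqueInvariant μ)
    (h : P.IsReversible μ) {φ : Ω → ℝ} (hφ : Measurable φ)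
    (he : ∀ᶠ t in 𝓝[>] 0, ∀ᵐ x ∂μ, ∀ᵐ y ∂(P.kernel t x), φ y = φ x) :
    ∃ a, ∀ᵐ x ∂μ, φ x = a := by
  -- An injective function of `φ` with values in `(π/2, 3π/2)`, so that it can be normalised to a
  -- probability density. Uniqueness makes this density constant, and the tangent recovers `φ`.
  set ψ : Ω → ℝ≥0∞ := fun x => ENNReal.ofReal (Real.arctan (φ x) + Real.pi) with hψ
  have hpos : ∀ x, Real.pi / 2 < Real.arctan (φ x) + Real.pi := fun x => by
    have := Real.neg_pi_div_two_lt_arctan (φ x)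
    linarith
  have hψm : Measurable ψ := ((Real.measurable_arctan.comp hφ).add_const _).ennreal_ofReal
  have hle : ∀ x, ψ x ≤ ENNReal.ofReal (2 * Real.pi) := fun x => by
    refine ENNReal.ofReal_le_ofReal ?_
    have := Real.arctan_lt_pi_div_two (φ x)
    have := Real.pi_pos
    linarith
  have hge : ∀ x, ENNReal.ofReal (Real.pi / 2) ≤ ψ x := fun x =>
    ENNReal.ofReal_le_ofReal (hpos x).le
  set Z := ∫⁻ x, ψ x ∂μ with hZ
  have hZ0 : Z ≠ 0 := by
    have h1 := lintegral_mono (μ := μ) hge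
    simp only [lintegral_const, measure_univ, mul_one] at h1
    exact (lt_of_lt_of_le (by simpa using Real.pi_pos) h1).ne'
  have hZt : Z ≠ ⊤ := by
    have h1 := lintegral_mono (μ := μ) hle
    simp only [lintegral_const, measure_univ, mul_one] at h1
    exact (lt_of_le_of_lt h1 ENNReal.ofReal_lt_top).ne
  have hρm : Measurable fun x => Z⁻¹ * ψ x := hψm.const_mul _
  have hinv : ∀ t, (P.kernel t).Invariant (μ.withDensity fun x => Z⁻¹ * ψ x) := by
    refine P.invariant_of_eventually ?_
    filter_upwards [he] with t ht
    refine invariant_withDensity (h.invariant t) hρm ?_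
    filter_upwards [ht] with x hx
    filter_upwards [hx] with y hy
    simp only [hψ, hy]
  have hint : ∫⁻ x, Z⁻¹ * ψ x ∂μ = 1 := by
    rw [lintegral_const_mul _ hψm, ENNReal.inv_mul_cancel hZ0 hZt]
  have hprob : IsProbabilityMeasure (μ.withDensity fun x => Z⁻¹ * ψ x) :=
    ⟨by rw [withDensity_apply _ MeasurableSet.univ, setLIntegral_univ, hint]⟩
  have h1 := hu _ hprob (withDensity_absolutelyContinuous _ _) hinv
  have h2 : (fun x => Z⁻¹ * ψ x) =ᵐ[μ] 1 := by
    rw [← withDensity_one (μ := μ)] at h1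
    conv_lhs at h1 => rw [withDensity_one]
    exact (withDensity_eq_iff hρm.aemeasurable aemeasurable_one (by rw [hint]; simp)).1 h1
  refine ⟨Real.tan (Z.toReal - Real.pi), ?_⟩
  filter_upwards [h2] with x hx
  have h3 : ψ x = Z := by
    have h4 : Z * (Z⁻¹ * ψ x) = Z := by rw [hx]; simp
    rwa [← mul_assoc, ENNReal.mul_inv_cancel hZ0 hZt, one_mul] at h4
  rw [← h3, hψ, ENNReal.toReal_ofReal (by linarith [hpos x, Real.pi_pos]), add_sub_cancel_right,
    Real.tan_arctan]

end MarkovSemigroup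

section Ergodicity

variable {E X : Type*} [MeasurableSpace E] [MeasurableSpace X] [Countable X]
  [DiscreteMeasurableSpace X] {P : MarkovSemigroup E} {Q : MarkovSemigroup X} {μ : Measure E}
  {ν : Measure X} [IsProbabilityMeasure μ] [IsProbabilityMeasure ν] {k : X → X → ℝ}

omit [Countable X] [IsProbabilityMeasure ν] in
theorem IsReversibleChain.eventually_kernel_ne_zero (hk : IsReversibleChain Q k ν) {i j : X}
    (hij : j = i ∨ 0 < k i j) : ∀ᶠ t in 𝓝[>] 0, Q.kernel t i {j} ≠ 0 := by
  have h0 : (Q.kernel 0 i).real {j} = ({j} : Set X).indicator 1 i := by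
    rw [Q.zero, Kernel.id_apply, Measure.real, Measure.dirac_apply]
    by_cases hl : i = j <;> simp [hl]
  have hr := hk.rates i j
  rw [h0] at hr
  by_cases hji : j = i
  · have ht : Tendsto (fun t : ℝ≥0 => (t : ℝ)) (𝓝[>] 0) (𝓝 0) :=
      (NNReal.continuous_coe.tendsto' 0 0 rfl).mono_left nhdsWithin_le_nhds
    have h1 := ht.mul hr
    rw [zero_mul] at h1
    -- If `Q_t(i,i)` were `0`, then `t` times the difference quotient would equal `-1`, whereas it
    -- tends to `0`.
    filter_upwards [h1.eventually (lt_mem_nhds (show (-1 : ℝ) < 0 by norm_num)),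
      self_mem_nhdsWithin] with t h2 ht0 h3
    have : (t : ℝ) ≠ 0 := by
      have : 0 < t := ht0
      positivity
    rw [mul_inv_cancel_left₀ this, Measure.real, h3] at h2
    simp [hji] at h2
  · filter_upwards [hr.eventually (lt_mem_nhds (hij.resolve_left hji))] with t h2 h3
    rw [Measure.real, h3] at h2
    simp [Ne.symm hji] at h2

/-- Ergodicity of the product process. -/
theorem ae_eq_const_of_invariant (h : P.IsReversible μ) (hu : P.HasUniqueInvariant μ)
    (hk : IsReversibleChain Q k ν) {φ : E × X → ℝ} (hφm : Measurable φ)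
    (hφ : MemLp φ 2 (μ.prod ν)) (he : ∀ t, (P.prod Q).act t φ =ᵐ[μ.prod ν] φ) :
    ∃ a, ∀ᵐ z ∂(μ.prod ν), φ z = a := by
  have hprod := h.prod hk.reversible
  -- `φ` is constant along almost every transition of the product, and a move of the chain with
  -- positive probability can be singled out of the product kernel.
  have key : ∀ {i j : X} {t : ℝ≥0}, Q.kernel t i {j} ≠ 0 →
      ∀ᵐ x ∂μ, ∀ᵐ y ∂(P.kernel t x), φ (y, j) = φ (x, i) := by
    intro i j t hij
    have h1 := ae_ae_eq_of_integral_kernel_eq (hprod.invariant t) hφ (he t)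
    filter_upwards [ae_slice_of_ae_prod h1 (hk.measure_singleton_ne_zero i)] with x hx
    change ∀ᵐ w ∂((P.kernel t ∥ₖ Q.kernel t) (x, i)), φ w = φ (x, i) at hx
    rw [Kernel.parallelComp_apply] at hx
    exact ae_slice_of_ae_prod hx hij
  -- For small `t` the chain stays at `i` with positive probability, so each slice is invariant for
  -- the diffusion.
  have hconst : ∀ i, ∃ a, ∀ᵐ x ∂μ, φ (x, i) = a := fun i =>
    hu.ae_eq_const h (hφm.comp measurable_prodMk_right) <| by
      filter_upwards [hk.eventually_kernel_ne_zero (i := i) (.inl rfl)] with t ht using key ht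
  choose a ha using hconst
  have hstep : ∀ i j, 0 < k i j → a i = a j := by
    intro i j hij
    obtain ⟨t, ht⟩ := (hk.eventually_kernel_ne_zero (.inr hij)).exists
    obtain ⟨x, h1, h2, h3⟩ := ((key ht).and ((ha i).and
      (ae_ae_of_invariant (h.invariant t) (ha j)))).exists
    obtain ⟨y, h4, h5⟩ := (h1.and h3).exists
    rw [← h2, ← h4, h5]
  have hall : ∀ i j, a i = a j := fun i j => by
    induction hk.irreducible i j with
    | refl => rfl
    | tail _ hbc ih => exact ih.trans (hstep _ _ hbc)
  obtain ⟨i⟩ : Nonempty X := nonempty_of_isProbabilityMeasure ν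
  refine ⟨a i, ae_prod_of_forall_slice fun j => ?_⟩
  rw [hall i j]
  exact ha j

/-- Convergence to equilibrium of the product process in `L²`. -/
theorem tendsto_norm_act_sub_one (h : P.IsReversible μ) (hu : P.HasUniqueInvariant μ)
    (hk : IsReversibleChain Q k ν) {f : E × X → ℝ} (hf : MemLp f 2 (μ.prod ν))
    (hf1 : ∫ z, f z ∂(μ.prod ν) = 1) :
    Tendsto (fun t => ∫ z, ((P.prod Q).act t f z - 1) ^ 2 ∂(μ.prod ν)) atTop (𝓝 0) := by
  have hr := h.prod hk.reversible
  obtain ⟨w, hw, hwinv⟩ := hr.toSymm.exists_tendsto_atTop (hf.toLp f)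
  have hwm : MemLp w 2 (μ.prod ν) := Lp.memLp w
  obtain ⟨a, ha⟩ := ae_eq_const_of_invariant h hu hk (Lp.stronglyMeasurable w).measurable hwm
    fun t => by
      have h1 := hwinv t
      conv_lhs at h1 => rw [← Lp.toLp_coeFn w hwm]
      rw [hr.toSymm_toLp] at h1
      exact (MemLp.coeFn_toLp _).symm.trans (by rw [h1])
  -- Pairing with `1` is preserved along the flow, so the constant limit has the mass of `f`.
  have hone : MemLp (fun _ : E × X => (1 : ℝ)) 2 (μ.prod ν) := memLp_const 1
  have h1 : Tendsto (fun t => inner ℝ (hr.toSymm.op t (hf.toLp f)) (hone.toLp _)) atTop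
      (𝓝 (inner ℝ w (hone.toLp _))) := hw.inner tendsto_const_nhds
  have h2 : ∀ t, inner ℝ (hr.toSymm.op t (hf.toLp f)) (hone.toLp _) = (1 : ℝ) := fun t => by
    rw [hr.toSymm_toLp, inner_toLp]
    simp_rw [mul_one]
    rw [hr.integral_act t hf, hf1]
  simp_rw [h2] at h1
  have h3 := tendsto_nhds_unique h1 tendsto_const_nhds
  have hwa : w = (memLp_const a).toLp (fun _ : E × X => a) := by
    rw [← Lp.toLp_coeFn w hwm]
    exact (MemLp.toLp_eq_toLp_iff _ _).2 ha
  rw [hwa, inner_toLp] at h3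
  simp only [mul_one, integral_const, probReal_univ, one_smul] at h3
  have h4 : Tendsto (fun t => ‖hr.toSymm.op t (hf.toLp f) - hone.toLp _‖ ^ 2) atTop (𝓝 0) := by
    have h5 : w = hone.toLp (fun _ : E × X => (1 : ℝ)) := by
      rw [hwa]
      exact (MemLp.toLp_eq_toLp_iff _ _).2 (by rw [h3])
    rw [h5] at hw
    simpa using ((hw.sub_const (hone.toLp _)).norm).pow 2
  refine h4.congr fun t => ?_
  rw [hr.toSymm_toLp, ← integral_sub_sq]

end Ergodicity

/-! ### The modified logarithmic Sobolev inequality. -/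

namespace IsRegularDensity

variable {E X : Type*} [MeasurableSpace E] [MeasurableSpace X] [Countable X]
  [DiscreteMeasurableSpace X] {P : MarkovSemigroup E} {μ : Measure E} [IsProbabilityMeasure μ]
  {𝒜 : Subalgebra ℝ (E → ℝ)} {Q : MarkovSemigroup X} {k : X → X → ℝ} {ν : Measure X}
  [IsProbabilityMeasure ν] {f : E × X → ℝ}
  (hf : IsRegularDensity P μ 𝒜 Q k ν f) (hd : P.IsDiffusion μ 𝒜) (hk : IsReversibleChain Q k ν)
  (h : P.IsReversible μ)
include hf hk h

omit [Countable X] [DiscreteMeasurableSpace X] in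
-- `r log r ≤ r (r - 1) = (r - 1)² + (r - 1)`, and the linear term integrates to zero by
-- conservation of mass.
theorem entropy_act_le (t : ℝ≥0) : entropy μ ν ((P.prod Q).act t f)
    ≤ ∫ z, ((P.prod Q).act t f z - 1) ^ 2 ∂(μ.prod ν) := by
  obtain ⟨c, C, hc, hcC⟩ := hf.flow_bounds
  have hr := h.prod hk.reversible
  have hm := hr.memLp_act t hf.domain.memLp
  have hm1 : MemLp (fun z => (P.prod Q).act t f z - 1) 2 (μ.prod ν) := hm.sub (memLp_const 1)
  have e : ∫ z, ((P.prod Q).act t f z - 1) ∂(μ.prod ν) = 0 := by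
    rw [integral_sub (hm.integrable (by norm_num)) (integrable_const 1),
      hr.integral_act t hf.domain.memLp, hf.integral_eq_one]
    simp
  have i1 : Integrable (fun z => ((P.prod Q).act t f z - 1) ^ 2) (μ.prod ν) := hm1.integrable_sq
  have i2 := hm1.integrable (q := 2) (by norm_num)
  rw [← add_zero (∫ z, ((P.prod Q).act t f z - 1) ^ 2 ∂_), ← e, ← integral_add i1 i2, entropy]
  refine integral_mono (hm.integrable_mul (hf.log_domain t).memLp) (i1.add i2) fun z => ?_
  have hz : 0 < (P.prod Q).act t f z := hc.trans_le (hcC t z).1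
  have := mul_le_mul_of_nonneg_left (Real.log_le_sub_one_of_pos hz) hz.le
  simp only
  linarith

include hd

theorem entropy_le_fisher (hu : P.HasUniqueInvariant μ) {κc κd : ℝ} (hc : 0 < κc) (hd0 : 0 < κd)
    (hκc : P.CD μ 𝒜 κc) (hκd : CDUpsilon k κd) :
    entropy μ ν f ≤ 1 / (2 * min κc κd) * fisher P μ k ν f := by
  set κ := min κc κd with hκ
  have hκ0 : 0 < κ := lt_min hc hd0
  set H := flowEntropy P μ Q ν f with hH
  set H' := derivWithin H (Set.Ici 0) with hH'
  have d1 : ∀ t, 0 ≤ t → HasDerivWithinAt H (H' t) (Set.Ici 0) t := fun t ht =>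
    (hf.hasDerivWithinAt_flowEntropy hd hk h ht).differentiableWithinAt.hasDerivWithinAt
  have d2 : ∀ t, 0 ≤ t → HasDerivWithinAt H' (derivWithin H' (Set.Ici 0) t) (Set.Ici 0) t :=
    fun t ht =>
    (hf.hasDerivWithinAt_derivWithin_flowEntropy hd hk h ht).differentiableWithinAt.hasDerivWithinAt
  have d3 : ∀ t, 0 ≤ t → HasDerivWithinAt (fun t => H t + (2 * κ)⁻¹ * H' t)
      (H' t + (2 * κ)⁻¹ * derivWithin H' (Set.Ici 0) t) (Set.Ici 0) t := fun t ht =>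
    (d1 t ht).add ((d2 t ht).const_mul _)
  -- The differential inequality divided by `2κ`: the derivative `H' + H''/(2κ)` is nonnegative.
  have hmono : MonotoneOn (fun t => H t + (2 * κ)⁻¹ * H' t) (Set.Ici 0) := by
    refine monotoneOn_of_hasDerivWithinAt_nonneg (convex_Ici 0)
      (fun t ht => (d3 t ht).continuousWithinAt)
      (fun t ht => (d3 t (interior_subset ht)).mono interior_subset) fun t ht => ?_
    have h1 := hf.mul_derivWithin_flowEntropy_le hd hk h hκc hκd (interior_subset ht)
    have h2 := mul_le_mul_of_nonneg_left h1 (inv_nonneg.2 (by positivity : 0 ≤ 2 * κ))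
    rw [← hκ, ← hH, ← hH'] at h2
    have h3 : (2 * κ)⁻¹ * (-2 * κ * H' t) = - H' t := by field_simp
    linarith
  have hlim : Tendsto (fun t : ℝ≥0 => ∫ z, ((P.prod Q).act t f z - 1) ^ 2 ∂(μ.prod ν)) atTop (𝓝 0) :=
    tendsto_norm_act_sub_one h hu hk hf.domain.memLp hf.integral_eq_one
  -- The sign `H' ≤ 0` lets the term with `H'(t)` be discarded, so no limit of the Fisher
  -- information is required.
  have hbound : ∀ t : ℝ≥0, H 0 + (2 * κ)⁻¹ * H' 0
      ≤ ∫ z, ((P.prod Q).act t f z - 1) ^ 2 ∂(μ.prod ν) := fun t => by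
    have h1 := hmono (Set.mem_Ici.2 le_rfl) (Set.mem_Ici.2 t.2) t.2
    have h2 : H' t ≤ 0 := by
      obtain ⟨c, C, hc, hcC⟩ := hf.flow_bounds
      rw [hH', hH, hf.derivWithin_flowEntropy hd hk h t.coe_nonneg, neg_nonpos]
      refine integral_nonneg_of_ae ?_
      filter_upwards [(hf.log_regular t).hybridGamma_nonneg hd hk h (ν := ν)] with z hz
      have h3 : 0 ≤ (P.prod Q).act t f z := hc.le.trans (hcC t z).1
      rw [Real.toNNReal_coe]
      exact mul_nonneg h3 hz
    have h3 := hf.entropy_act_le hk h t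
    have h4 : H t = entropy μ ν ((P.prod Q).act t f) := by
      rw [hH, flowEntropy, Real.toNNReal_coe]
    have h5 : (2 * κ)⁻¹ * H' t ≤ 0 := mul_nonpos_of_nonneg_of_nonpos (by positivity) h2
    rw [← h4] at h3
    exact h1.trans ((add_le_of_nonpos_right h5).trans h3)
  have h0 := ge_of_tendsto' hlim hbound
  have e0 : (P.prod Q).act 0 f = f := MarkovSemigroup.act_zero f hf.measurable
  rw [hH', hH, hf.derivWithin_flowEntropy hd hk h le_rfl, flowEntropy, Real.toNNReal_zero, e0] at h0
  rw [one_div]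
  linarith

end IsRegularDensity

end Hybrid

end

/-! ### Assembly of the four statements. -/

theorem theorem6p3 {E X : Type*} [MeasurableSpace E] [Countable X] [MeasurableSpace X]
    [DiscreteMeasurableSpace X]
    -- the diffusion process
    (Pc : MarkovSemigroup E) (μc : Measure E) [IsProbabilityMeasure μc]
    (𝒜 : Subalgebra ℝ (E → ℝ))
    (hrev : Pc.IsReversible μc) (hcont : Pc.IsStronglyContinuous μc)
    (huniq : Pc.HasUniqueInvariant μc) (hdiff : Pc.IsDiffusion μc 𝒜)
    -- the Markov chain
    (Pd : MarkovSemigroup X) (k : X → X → ℝ) (μd : Measure X) [IsProbabilityMeasure μd]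
    (hchain : IsReversibleChain Pd k μd) :
    -- the pointwise comparison of the iterated operators
    (∀ u : E × X → ℝ, IsRegular Pc μc 𝒜 k u →
      ∀ᵐ z ∂(μc.prod μd), sumOfTwos Pc μc k u z ≤ hybridTwo Pc μc k u z) ∧
    -- the first and second derivative of the entropy along the flow
    (∀ f : E × X → ℝ, IsRegularDensity Pc μc 𝒜 Pd k μd f → ∀ t : ℝ, 0 ≤ t →
      Integrable (fun z => (Pc.prod Pd).act t.toNNReal f z *
        hybridGamma Pc μc k (logFlow Pc Pd t.toNNReal f) z) (μc.prod μd) ∧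
      HasDerivWithinAt (flowEntropy Pc μc Pd μd f)
        (-fisher Pc μc k μd ((Pc.prod Pd).act t.toNNReal f)) (Set.Ici 0) t ∧
      Integrable (fun z => (Pc.prod Pd).act t.toNNReal f z *
        hybridTwo Pc μc k (logFlow Pc Pd t.toNNReal f) z) (μc.prod μd) ∧
      HasDerivWithinAt (derivWithin (flowEntropy Pc μc Pd μd f) (Set.Ici 0))
        (2 * ∫ z, (Pc.prod Pd).act t.toNNReal f z *
          hybridTwo Pc μc k (logFlow Pc Pd t.toNNReal f) z ∂(μc.prod μd)) (Set.Ici 0) t) ∧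
    -- the differential inequality
    (∀ κc κd : ℝ, Pc.CD μc 𝒜 κc → CDUpsilon k κd →
      ∀ f : E × X → ℝ, IsRegularDensity Pc μc 𝒜 Pd k μd f → ∀ t : ℝ, 0 ≤ t →
        -2 * min κc κd * derivWithin (flowEntropy Pc μc Pd μd f) (Set.Ici 0) t ≤
          derivWithin (derivWithin (flowEntropy Pc μc Pd μd f) (Set.Ici 0)) (Set.Ici 0) t) ∧
    -- the modified logarithmic Sobolev inequality
    (∀ κc κd : ℝ, 0 < κc → 0 < κd → Pc.CD μc 𝒜 κc → CDUpsilon k κd →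
      ∀ f : E × X → ℝ, IsRegularDensity Pc μc 𝒜 Pd k μd f →
        entropy μc μd f ≤ 1 / (2 * min κc κd) * fisher Pc μc k μd f) := by
  refine ⟨fun u hu => hu.sumOfTwos_le_hybridTwo hdiff hchain hrev, fun f hf t ht => ?_,
    fun κc κd hκc hκd f hf t ht =>
      hf.mul_derivWithin_flowEntropy_le hdiff hchain hrev hκc hκd ht,
    fun κc κd hc hd hκc hκd f hf =>
      hf.entropy_le_fisher hdiff hchain hrev huniq hc hd hκc hκd⟩
  exact ⟨hf.integrable_flow_mul_hybridGamma hdiff hchain hrev _,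
    hf.hasDerivWithinAt_flowEntropy hdiff hchain hrev ht,
    (hf.integral_flow_mul_hybridTwo hdiff hchain hrev _).1,
    hf.hasDerivWithinAt_derivWithin_flowEntropy hdiff hchain hrev ht⟩
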